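/- **Setting.** Let $\mathsf E_-$ and $\mathsf E_+$ be finite or countable sets, $\mathsf E=\mathsf E_-\sqcup\mathsf E_+$, and let $(\alpha_{\mathsf e})_{\mathsf e\in\mathsf E}$, $(\beta_{\mathsf e})_{\mathsf e\in\mathsf E}$ be bounded real families with $\alpha_{\mathsf e}>0$ and $(1/\alpha_{\mathsf e})_{\mathsf e\in\mathsf E}$ bounded. Let $$L^2(\mathsf G)=\bigoplus_{\mathsf e\in\mathsf E_-}L^2(-\infty,0)\oplus\bigoplus_{\mathsf e\in\mathsf E_+}L^2(0,\infty)$$ (complex Hilbert space direct sum), and let $A_0(u_{\mathsf e})=(\alpha_{\mathsf e}u_{\mathsf e}'''+\beta_{\mathsf e}u_{\mathsf e}')$ on the algebraic direct sum of the spaces $C_c^\infty$ of the half-lines. Let $A_0^*$ be its adjoint, so that $D(A_0^*)=\bigoplus_{\mathsf E_-} H^3(-\infty,0)\oplus\bigoplus_{\mathsf E_+} H^3(0,\infty)$ and $-A_0^*u=(\alpha_{\mathsf e}u_{\mathsf e}'''+\beta_{\mathsf e}u_{\mathsf e}')$. Let $\alpha_\pm,\beta_\pm$ denote the multiplication operators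 on $\ell^2(\mathsf E_\pm)$. On $\mathcal G_\pm=\ell^2(\mathsf E_\pm)^3$ put $$\langle x\mid y\rangle_\pm=(B_\pm x\mid y),\qquad B_\pm=\begin{pmatrix}-\beta_\pm&0&-\alpha_\pm\\0&\alpha_\pm&0\\-\alpha_\pm&0&0\end{pmatrix}.$$ For a densely defined linear operator $L$ from $\mathcal G_-$ to $\mathcal G_+$, its Krein adjoint $L^\sharp$ from $\mathcal G_+$ to $\mathcal G_-$ is given by: $y\in D(L^\sharp)$ and $L^\sharp y=z$ if and only if $\langle Lx\mid y\rangle_+=\langle x\mid z\rangle_-$ for all $x\in D(L)$. The operator $A_L$ is the restriction of $-A_0^*$ to those $u\in D(A_0^*)$ with $(u(0-),u'(0-),u''(0-))\in D(L)$ and $L(u(0-),u'(0-),u''(0-))=(u(0+),u'(0+),u''(0+))$. A $C_0$-semigroup $(T(t))_{t\ge0}$ on $L^2(\mathsf G)$ is called real if $T(t)\operatorname{Re}u=\operatorname{Re}T(t)u$ for all $t\ge0$ and $u\in L^2(\mathsf G)$, i.e. if it maps real-valued functions to real-valued functions; it is contractive if $\|T(t)\|\le1$ for all $t\ge 0$.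 **Proposition 3.18.** (a) Let $L$ be a densely defined linear operator from $\mathcal G_-$ to $\mathcal G_+$ such that $L$ and $L^\sharp$ are Krein contractions, i.e. $\langle Lx\mid Lx\rangle_+\le\langle x\mid x\rangle_-$ for $x\in D(L)$ and $\langle L^\sharp y\mid L^\sharp y\rangle_-\le\langle y\mid y\rangle_+$ for $y\in D(L^\sharp)$. Let $L$ be real, i.e. for $x\in D(L)$ we have $\operatorname{Re}x\in D(L)$ and $\operatorname{Re}Lx=L\operatorname{Re}x$. Then every $C_0$-semigroup generated by $A_L$ is contractive and real. If $L$ is closed, then $A_L$ does generate a $C_0$-semigroup, and exactly one. (b) Let $Y\subseteq\ell^2(\mathsf E_-)\oplus\ell^2(\mathsf E_+)$ be a closed subspace with $(\operatorname{Re}x,\operatorname{Re}y)\in Y$ for all $(x,y)\in Y$. Let $U$ be an everywhere defined linear operator from $\ell^2(\mathsf E_-)$ to $\ell^2(\mathsf E_+)$ with $(\alpha_+Ux\mid Ux)\le(\alpha_-x\mid x)$ and $\operatorname{Re}Ux=U\operatorname{Re}x$ for all $x\in\ell^2(\mathsf E_-)$. Let $A_{Y,U}$ be the restriction of $-A_0^*$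 to those $u\in D(A_0^*)$ with $(u(0-),u(0+))\in Y$, $\bigl(-\alpha_-u''(0-)-\tfrac{\beta_-}2u(0-),\ \alpha_+u''(0+)+\tfrac{\beta_+}2u(0+)\bigr)\in Y^\perp$ and $u'(0+)=Uu'(0-)$. Then $A_{Y,U}$ generates exactly one $C_0$-semigroup, and this semigroup is contractive and real. -/

import Mathlib

open Set Filter Topology MeasureTheory
open scoped NNReal ENNReal ContDiff Distributions

namespace AiryStar

/-! ### Edges and coefficients

`Em` indexes the half-lines `(-∞, 0)`, `Ep` the half-lines `(0, ∞)`; the edge set of the star graph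
is the disjoint union `Em ⊕ Ep`. -/

/-- The coefficients of the Airy operator on a family `E` of edges: `α` and `β` are bounded real
families, `α` is positive and `1 / α` is bounded. -/
structure AiryCoeff (E : Type*) where
  α : E → ℝ
  β : E → ℝ
  α_pos : ∀ e, 0 < α e
  α_bdd : ∃ C, ∀ e, α e ≤ C
  α_inv_bdd : ∃ C, ∀ e, (α e)⁻¹ ≤ C
  β_bdd : ∃ C, ∀ e, |β e| ≤ C

/-- Restriction (more generally, reindexing) of a family of coefficients. -/
def AiryCoeff.reindex {E E' : Type*} (c : AiryCoeff E) (f : E' → E) : AiryCoeff E' where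
  α e := c.α (f e)
  β e := c.β (f e)
  α_pos e := c.α_pos (f e)
  α_bdd := c.α_bdd.imp fun _ h e => h (f e)
  α_inv_bdd := c.α_inv_bdd.imp fun _ h e => h (f e)
  β_bdd := c.β_bdd.imp fun _ h e => h (f e)

/-- The coefficients on the edges `(-∞, 0)`. -/
abbrev AiryCoeff.minus {Em Ep : Type*} (c : AiryCoeff (Em ⊕ Ep)) : AiryCoeff Em :=
  c.reindex Sum.inl

/-- The coefficients on the edges `(0, ∞)`. -/
abbrev AiryCoeff.plus {Em Ep : Type*} (c : AiryCoeff (Em ⊕ Ep)) : AiryCoeff Ep :=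
  c.reindex Sum.inr

theorem AiryCoeff.α_abs_bdd {E : Type*} (c : AiryCoeff E) : ∃ C, ∀ e, |c.α e| ≤ C :=
  c.α_bdd.imp fun _ h e => by rw [abs_of_pos (c.α_pos e)]; exact h e

/-! ### Boundary spaces -/

/-- The complex Hilbert space `ℓ²(E)`. -/
abbrev Ell2 (E : Type*) : Type _ := lp (fun _ : E => ℂ) 2

/-- `ℓ²(E) ⊕ ℓ²(E) ⊕ ℓ²(E)` as a Hilbert space; the component `k` holds the boundary values of the
`k`-th derivatives. -/
abbrev BdSpace (E : Type*) : Type _ := PiLp 2 (fun _ : Fin 3 => Ell2 E)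

/-- Multiplication of a sequence in `ℓ²(E)` by a bounded real sequence. -/
noncomputable def mulOp {E : Type*} (a : E → ℝ) (ha : ∃ C, ∀ e, |a e| ≤ C) :
    Ell2 E →ₗ[ℂ] Ell2 E where
  toFun x := ⟨fun e => (a e : ℂ) * x e, by
    obtain ⟨C, hC⟩ := ha
    refine Memℓp.mono' ((lp.memℓp x).const_smul (C : ℂ)) fun e => ?_
    have h0 : |a e| ≤ |C| := (hC e).trans (le_abs_self C)
    simpa using mul_le_mul_of_nonneg_right h0 (norm_nonneg (x e))⟩
  map_add' x y := by ext e; exact mul_add _ _ _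
  map_smul' r x := by ext e; exact mul_left_comm _ _ _

@[simp] theorem mulOp_apply {E : Type*} (a : E → ℝ) (ha : ∃ C, ∀ e, |a e| ≤ C) (x : Ell2 E)
    (e : E) : mulOp a ha x e = (a e : ℂ) * x e := rfl

/-- Multiplication by `α`. -/
noncomputable def AiryCoeff.mulα {E : Type*} (c : AiryCoeff E) : Ell2 E →ₗ[ℂ] Ell2 E :=
  mulOp c.α c.α_abs_bdd

/-- Multiplication by `β`. -/
noncomputable def AiryCoeff.mulβ {E : Type*} (c : AiryCoeff E) : Ell2 E →ₗ[ℂ] Ell2 E :=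
  mulOp c.β c.β_bdd

/-- The block operator matrix `[[-β, 0, -α], [0, α, 0], [-α, 0, 0]]`. -/
noncomputable def AiryCoeff.B {E : Type*} (c : AiryCoeff E) (x : BdSpace E) : BdSpace E :=
  WithLp.toLp 2 ![-c.mulβ (x 0) - c.mulα (x 2), c.mulα (x 1), -c.mulα (x 0)]

/-- The indefinite inner product `⟨x | y⟩ = (B x | y)`, linear in `x` and conjugate linear in `y`
(Mathlib's `inner` is conjugate linear in its first argument). -/
noncomputable def krein {E : Type*} (c : AiryCoeff E) (x y : BdSpace E) : ℂ :=
  inner ℂ y (c.B x)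

/-- `S` is a contraction between the Krein spaces over `E` and `F`: `⟨S x | S x⟩ ≤ ⟨x | x⟩` on the
domain of `S` (both sides are real numbers). -/
def IsKreinContraction {E F : Type*} (c : AiryCoeff E) (d : AiryCoeff F)
    (S : BdSpace E →ₗ.[ℂ] BdSpace F) : Prop :=
  ∀ x : S.domain, (krein d (S x) (S x)).re ≤ (krein c (x : BdSpace E) (x : BdSpace E)).re

theorem krein_add_right {E : Type*} (c : AiryCoeff E) (x y z : BdSpace E) :
    krein c x (y + z) = krein c x y + krein c x z := inner_add_left _ _ _

theorem krein_smul_right {E : Type*} (c : AiryCoeff E) (x y : BdSpace E) (r : ℂ) :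
    krein c x (r • y) = (starRingEnd ℂ) r * krein c x y := inner_smul_left _ _ _

/-- The graph `{(y, z) | ⟨L x | y⟩ = ⟨x | z⟩ for all x ∈ D(L)}` of the Krein adjoint of `L`. -/
def kreinAdjointGraph {E F : Type*} (c : AiryCoeff E) (d : AiryCoeff F)
    (L : BdSpace E →ₗ.[ℂ] BdSpace F) : Submodule ℂ (BdSpace F × BdSpace E) where
  carrier := {p | ∀ x : L.domain, krein d (L x) p.1 = krein c (x : BdSpace E) p.2}
  zero_mem' x := by simp [krein]
  add_mem' {p q} hp hq x := by
    simp only [Prod.fst_add, Prod.snd_add, krein_add_right, hp x, hq x]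
  smul_mem' r p hp x := by
    simp only [Prod.smul_fst, Prod.smul_snd, krein_smul_right, hp x]

/-- The Krein adjoint `L♯` of a densely defined operator `L`. -/
noncomputable def kreinAdjoint {E F : Type*} (c : AiryCoeff E) (d : AiryCoeff F)
    (L : BdSpace E →ₗ.[ℂ] BdSpace F) : BdSpace F →ₗ.[ℂ] BdSpace E :=
  (kreinAdjointGraph c d L).toLinearPMap

theorem inner_mulOp {E : Type*} (a : E → ℝ) (ha : ∃ C, ∀ e, |a e| ≤ C) (x y : Ell2 E) :
    inner ℂ x (mulOp a ha y) = inner ℂ (mulOp a ha x) y := by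
  simp only [lp.inner_eq_tsum, mulOp_apply]
  refine tsum_congr fun e => ?_
  simp only [RCLike.inner_apply, map_mul, Complex.conj_ofReal]
  ring

theorem krein_eq_inner_B {E : Type*} (c : AiryCoeff E) (x y : BdSpace E) :
    krein c x y = inner ℂ (c.B y) x := by
  simp only [krein, AiryCoeff.B, PiLp.inner_apply, Fin.sum_univ_three, AiryCoeff.mulα,
    AiryCoeff.mulβ]
  simp [inner_sub_left, inner_sub_right, inner_neg_left, inner_neg_right, inner_mulOp]
  ring

theorem mulα_injective {E : Type*} (c : AiryCoeff E) {x : Ell2 E} (h : c.mulα x = 0) : x = 0 := by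
  ext e
  have h1 : (c.α e : ℂ) * x e = 0 := by
    have := congrArg (fun y : Ell2 E => y e) h
    simpa [AiryCoeff.mulα] using this
  have h2 : (c.α e : ℂ) ≠ 0 := by exact_mod_cast (c.α_pos e).ne'
  simpa [h2] using h1

/-- The Krein adjoint of a densely defined operator is single-valued, so that its graph is
`kreinAdjointGraph`. -/
theorem kreinAdjoint_graph {E F : Type*} (c : AiryCoeff E) (d : AiryCoeff F)
    (L : BdSpace E →ₗ.[ℂ] BdSpace F) (hL : Dense (L.domain : Set (BdSpace E))) :
    (kreinAdjoint c d L).graph = kreinAdjointGraph c d L := by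
  refine Submodule.toLinearPMap_graph_eq _ fun p hp h0 => ?_
  have hB : c.B p.2 = 0 := by
    refine hL.eq_zero_of_inner_left ℂ (x := c.B p.2) fun x hx => ?_
    have := hp ⟨x, hx⟩
    rw [krein_eq_inner_B c] at this
    rw [← this, h0]
    simp [krein]
  have h0' : c.mulα (p.2 0) = 0 := by
    have := congrArg (fun y : BdSpace E => y 2) hB
    simpa [AiryCoeff.B] using this
  have h1' : c.mulα (p.2 1) = 0 := by
    have := congrArg (fun y : BdSpace E => y 1) hB
    simpa [AiryCoeff.B] using this
  have h0'' := mulα_injective c h0'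
  have h2' : c.mulα (p.2 2) = 0 := by
    have := congrArg (fun y : BdSpace E => y 0) hB
    simpa [AiryCoeff.B, h0''] using this
  ext k : 1
  fin_cases k
  · exact h0''
  · exact mulα_injective c h1'
  · exact mulα_injective c h2'

/-! ### The Hilbert space of the graph and the minimal operator -/

/-- The half-line belonging to an edge. -/
def halfLine {Em Ep : Type*} : Em ⊕ Ep → TopologicalSpace.Opens ℝ
  | .inl _ => ⟨Iio 0, isOpen_Iio⟩
  | .inr _ => ⟨Ioi 0, isOpen_Ioi⟩

/-- Complex `L²` on an open subset of the line. -/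
abbrev L2On (I : TopologicalSpace.Opens ℝ) : Type :=
  Lp ℂ 2 (volume.restrict (I : Set ℝ))

/-- `L²(G)`: the Hilbert space direct sum of `L²(-∞, 0)` over the edges in `Em` and of `L²(0, ∞)`
over the edges in `Ep`. -/
abbrev L2Graph (Em Ep : Type*) : Type _ :=
  lp (fun e : Em ⊕ Ep => L2On (halfLine e)) 2

/-- The differential expression `α φ''' + β φ'`. -/
noncomputable def airyExpr (a b : ℝ) (φ : ℝ → ℂ) (x : ℝ) : ℂ :=
  (a : ℂ) * iteratedDeriv 3 φ x + (b : ℂ) * deriv φ x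

theorem airyExpr_add (a b : ℝ) {I : TopologicalSpace.Opens ℝ} (φ ψ : 𝓓(I, ℂ)) :
    airyExpr a b (φ + ψ : 𝓓(I, ℂ)) = airyExpr a b φ + airyExpr a b ψ := by
  funext x
  have h3 : iteratedDeriv 3 (⇑φ + ⇑ψ) x = iteratedDeriv 3 φ x + iteratedDeriv 3 ψ x :=
    iteratedDeriv_add (φ.contDiff.contDiffAt.of_le (WithTop.coe_le_coe.2 (le_top : (3 : ℕ∞) ≤ ⊤)))
      (ψ.contDiff.contDiffAt.of_le (WithTop.coe_le_coe.2 (le_top : (3 : ℕ∞) ≤ ⊤)))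
  have h1 : deriv (⇑φ + ⇑ψ) x = deriv φ x + deriv ψ x :=
    deriv_add (φ.contDiff.differentiable (by simp) x) (ψ.contDiff.differentiable (by simp) x)
  simp only [airyExpr, FunLike.coe_add, h3, h1, Pi.add_apply]
  ring

theorem airyExpr_smul (a b : ℝ) {I : TopologicalSpace.Opens ℝ} (r : ℂ) (φ : 𝓓(I, ℂ)) :
    airyExpr a b (r • φ : 𝓓(I, ℂ)) = r • airyExpr a b φ := by
  funext x
  have h3 : iteratedDeriv 3 (r • ⇑φ) x = r • iteratedDeriv 3 φ x :=
    iteratedDeriv_const_smul_field _ _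
  have h1 : deriv (r • ⇑φ) x = r • deriv φ x :=
    deriv_const_smul r (φ.contDiff.differentiable (by simp) x)
  simp only [airyExpr, FunLike.coe_smul, h3, h1, Pi.smul_apply, smul_eq_mul]
  ring

/-- The graph of the minimal operator `A₀`: pairs `(u, w)` for which there are finitely many
nonzero test functions `φ e ∈ C_c^∞` of the half-lines with `u e = φ e` and
`w e = α e φ e''' + β e φ e'`. -/
def minGraph {Em Ep : Type*} (c : AiryCoeff (Em ⊕ Ep)) :
    Submodule ℂ (L2Graph Em Ep × L2Graph Em Ep) where
  carrier := {p | ∃ φ : ∀ e : Em ⊕ Ep, 𝓓(halfLine e, ℂ), {e | φ e ≠ 0}.Finite ∧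
    ∀ e, (p.1 e =ᵐ[volume.restrict (halfLine e : Set ℝ)] φ e) ∧
      (p.2 e =ᵐ[volume.restrict (halfLine e : Set ℝ)] airyExpr (c.α e) (c.β e) (φ e))}
  zero_mem' := by
    refine ⟨fun _ => 0, by simp, fun e => ⟨?_, ?_⟩⟩
    · exact Lp.coeFn_zero _ _ _
    · filter_upwards [Lp.coeFn_zero ℂ 2 (volume.restrict (halfLine e : Set ℝ))] with x hx
      have : (⇑(0 : 𝓓(halfLine e, ℂ)) : ℝ → ℂ) = fun _ => (0 : ℂ) := rfl
      simpa [airyExpr, this, iteratedDeriv_const] using hx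
  add_mem' := by
    rintro p q ⟨φ, hφ, h⟩ ⟨ψ, hψ, k⟩
    refine ⟨fun e => φ e + ψ e, (hφ.union hψ).subset fun e he => ?_, fun e => ⟨?_, ?_⟩⟩
    · by_contra hcon
      simp only [mem_union, mem_ofPred_eq, not_or, not_not] at hcon
      exact he (by simp [hcon.1, hcon.2])
    · filter_upwards [Lp.coeFn_add (p.1 e) (q.1 e), (h e).1, (k e).1] with x h1 h2 h3
      simpa [h2, h3] using h1
    · filter_upwards [Lp.coeFn_add (p.2 e) (q.2 e), (h e).2, (k e).2] with x h1 h2 h3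
      rw [airyExpr_add]
      simpa [h2, h3] using h1
  smul_mem' := by
    rintro r p ⟨φ, hφ, h⟩
    refine ⟨fun e => r • φ e, hφ.subset fun e he => ?_, fun e => ⟨?_, ?_⟩⟩
    · intro h0
      exact he (by simp [h0])
    · filter_upwards [Lp.coeFn_smul r (p.1 e), (h e).1] with x h1 h2
      simpa [h2] using h1
    · filter_upwards [Lp.coeFn_smul r (p.2 e), (h e).2] with x h1 h2
      rw [airyExpr_smul]
      simpa [h2] using h1

/-- The minimal operator `A₀ (φ_e) = (α_e φ_e''' + β_e φ_e')` in `L²(G)`, with domain the algebraic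
direct sum of the spaces `C_c^∞` of the half-lines. -/
noncomputable def minOp {Em Ep : Type*} (c : AiryCoeff (Em ⊕ Ep)) :
    L2Graph Em Ep →ₗ.[ℂ] L2Graph Em Ep :=
  (minGraph c).toLinearPMap

/-- `A₀` is single-valued. -/
theorem minOp_graph {Em Ep : Type*} (c : AiryCoeff (Em ⊕ Ep)) :
    (minOp c).graph = minGraph c := by
  refine Submodule.toLinearPMap_graph_eq _ ?_
  rintro p ⟨φ, -, h⟩ h0
  have hφ : ∀ e, φ e = 0 := by
    intro e
    have hae : (φ e : ℝ → ℂ) =ᵐ[volume.restrict (halfLine e : Set ℝ)] 0 := by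
      filter_upwards [(h e).1, Lp.coeFn_zero ℂ 2 (volume.restrict (halfLine e : Set ℝ))]
        with x h1 h2
      rw [← h1, h0]
      simpa using h2
    have hon : EqOn (φ e : ℝ → ℂ) 0 (halfLine e : Set ℝ) :=
      Measure.eqOn_open_of_ae_eq hae (halfLine e).isOpen (φ e).continuous.continuousOn
        continuousOn_const
    ext x
    by_cases hx : x ∈ (halfLine e : Set ℝ)
    · exact hon hx
    · exact image_eq_zero_of_notMem_tsupport fun hm => hx ((φ e).tsupport_subset hm)
  ext e : 2
  refine Lp.ext ?_
  filter_upwards [(h e).2, Lp.coeFn_zero ℂ 2 (volume.restrict (halfLine e : Set ℝ))] with x h1 h2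
  have : (⇑(0 : 𝓓(halfLine e, ℂ)) : ℝ → ℂ) = fun _ => (0 : ℂ) := rfl
  rw [h1, hφ e]
  simpa [airyExpr, this, iteratedDeriv_const] using h2.symm

/-! ### Boundary values and realizations of the Airy operator -/

/-- `u ∈ L²(I)` has a representative of class `C²` on the half-line `I` for which the derivatives
of order `0, 1, 2` tend to `b 0`, `b 1`, `b 2` at the end point `0` of `I`. (Every `u ∈ H³(I)` has
such boundary values.) -/
def HasBoundaryValues (I : TopologicalSpace.Opens ℝ) (u : L2On I) (b : Fin 3 → ℂ) : Prop :=
  ∃ f : ℝ → ℂ, ContDiffOn ℝ 2 f I ∧ (u =ᵐ[volume.restrict (I : Set ℝ)] f) ∧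
    ∀ k : Fin 3, Tendsto (iteratedDeriv k f) (𝓝[(I : Set ℝ)] 0) (𝓝 (b k))

theorem HasBoundaryValues.add {I : TopologicalSpace.Opens ℝ} {u v : L2On I} {b d : Fin 3 → ℂ}
    (hu : HasBoundaryValues I u b) (hv : HasBoundaryValues I v d) :
    HasBoundaryValues I (u + v) (b + d) := by
  obtain ⟨f, hf, huf, hb⟩ := hu
  obtain ⟨g, hg, hvg, hd⟩ := hv
  refine ⟨f + g, hf.add hg, ?_, fun k => ?_⟩
  · filter_upwards [Lp.coeFn_add u v, huf, hvg] with x h1 h2 h3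
    rw [h1, Pi.add_apply, Pi.add_apply, h2, h3]
  · refine ((hb k).add (hd k)).congr' ?_
    filter_upwards [self_mem_nhdsWithin] with x hx
    have hk : ((k : ℕ) : WithTop ℕ∞) ≤ 2 := by exact_mod_cast Nat.le_of_lt_succ k.2
    exact (iteratedDeriv_add ((hf.contDiffAt (I.isOpen.mem_nhds hx)).of_le hk)
      ((hg.contDiffAt (I.isOpen.mem_nhds hx)).of_le hk)).symm

theorem HasBoundaryValues.smul {I : TopologicalSpace.Opens ℝ} {u : L2On I} {b : Fin 3 → ℂ}
    (hu : HasBoundaryValues I u b) (r : ℂ) : HasBoundaryValues I (r • u) (r • b) := by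
  obtain ⟨f, hf, huf, hb⟩ := hu
  refine ⟨r • f, hf.const_smul r, ?_, fun k => ?_⟩
  · filter_upwards [Lp.coeFn_smul r u, huf] with x h1 h2
    rw [h1, Pi.smul_apply, Pi.smul_apply, h2]
  · refine ((hb k).const_smul r).congr fun x => ?_
    exact (iteratedDeriv_const_smul_field r f).symm

theorem HasBoundaryValues.zero (I : TopologicalSpace.Opens ℝ) : HasBoundaryValues I 0 0 := by
  refine ⟨0, contDiffOn_const, Lp.coeFn_zero _ _ _, fun k => ?_⟩
  have : iteratedDeriv (k : ℕ) (0 : ℝ → ℂ) = fun _ => 0 := by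
    funext x
    exact iteratedDeriv_const_zero
  rw [this]
  exact tendsto_const_nhds

/-- The preimage under the boundary map
`u ↦ ((u(0-), u'(0-), u''(0-)), (u(0+), u'(0+), u''(0+)))` of a subspace `X` of the boundary
space. -/
def bdPreimage {Em Ep : Type*} (X : Submodule ℂ (BdSpace Em × BdSpace Ep)) :
    Submodule ℂ (L2Graph Em Ep) where
  carrier := {u | ∃ p ∈ X,
    (∀ e : Em, HasBoundaryValues (halfLine (.inl e)) (u (.inl e)) fun k => p.1 k e) ∧
    (∀ e : Ep, HasBoundaryValues (halfLine (.inr e)) (u (.inr e)) fun k => p.2 k e)}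
  zero_mem' := ⟨0, X.zero_mem, fun _ => HasBoundaryValues.zero _,
    fun _ => HasBoundaryValues.zero _⟩
  add_mem' := by
    rintro u v ⟨p, hp, h1, h2⟩ ⟨q, hq, k1, k2⟩
    exact ⟨p + q, X.add_mem hp hq, fun e => (h1 e).add (k1 e), fun e => (h2 e).add (k2 e)⟩
  smul_mem' := by
    rintro r u ⟨p, hp, h1, h2⟩
    exact ⟨r • p, X.smul_mem r hp, fun e => (h1 e).smul r, fun e => (h2 e).smul r⟩

/-- The restriction of `-A₀*` to the `u ∈ D(A₀*)` with boundary values in `X`. Here `A₀*` is the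
Hilbert space adjoint of the minimal operator; its domain is the Hilbert space direct sum of the
Sobolev spaces `H³` of the half-lines, and `-A₀* u = (α_e u_e''' + β_e u_e')`. -/
noncomputable def airyOp {Em Ep : Type*} (c : AiryCoeff (Em ⊕ Ep))
    (X : Submodule ℂ (BdSpace Em × BdSpace Ep)) : L2Graph Em Ep →ₗ.[ℂ] L2Graph Em Ep :=
  (-(minOp c).adjoint).domRestrict (bdPreimage X)

/-- The operator `A_L`, with boundary condition
`L (u(0-), u'(0-), u''(0-)) = (u(0+), u'(0+), u''(0+))`. -/
noncomputable def airyOpL {Em Ep : Type*} (c : AiryCoeff (Em ⊕ Ep))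
    (L : BdSpace Em →ₗ.[ℂ] BdSpace Ep) : L2Graph Em Ep →ₗ.[ℂ] L2Graph Em Ep :=
  airyOp c L.graph

/-- The component `k` of an element of the boundary space. -/
def bdComp (E : Type*) (k : Fin 3) : BdSpace E →ₗ[ℂ] Ell2 E where
  toFun x := x k
  map_add' _ _ := rfl
  map_smul' _ _ := rfl

/-- The linear combination `α u'' + (β / 2) u` of boundary values. -/
noncomputable def AiryCoeff.flux {E : Type*} (c : AiryCoeff E) : BdSpace E →ₗ[ℂ] Ell2 E :=
  c.mulα ∘ₗ bdComp E 2 + (1 / 2 : ℂ) • c.mulβ ∘ₗ bdComp E 0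

/-- The separated boundary conditions given by `Y` and `U`; see `mem_sepCond`. -/
noncomputable def sepCond {Em Ep : Type*} (c : AiryCoeff (Em ⊕ Ep))
    (Y : Submodule ℂ (WithLp 2 (Ell2 Em × Ell2 Ep))) (U : Ell2 Em →ₗ.[ℂ] Ell2 Ep) :
    Submodule ℂ (BdSpace Em × BdSpace Ep) :=
  Y.comap ((WithLp.linearEquiv 2 ℂ (Ell2 Em × Ell2 Ep)).symm.toLinearMap ∘ₗ
    (bdComp Em 0).prodMap (bdComp Ep 0)) ⊓
  (Yᗮ.comap ((WithLp.linearEquiv 2 ℂ (Ell2 Em × Ell2 Ep)).symm.toLinearMap ∘ₗ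
    (-c.minus.flux).prodMap c.plus.flux) ⊓
  U.graph.comap ((bdComp Em 1).prodMap (bdComp Ep 1)))

/-- With `x`, `y` the boundary values on the edges in `Em` and `Ep`, the separated conditions read
`(x 0, y 0) ∈ Y`, `(-α₋ x 2 - (β₋ / 2) x 0, α₊ y 2 + (β₊ / 2) y 0) ∈ Yᗮ`, and `x 1 ∈ D(U)`,
`y 1 = U (x 1)`. -/
theorem mem_sepCond {Em Ep : Type*} (c : AiryCoeff (Em ⊕ Ep))
    (Y : Submodule ℂ (WithLp 2 (Ell2 Em × Ell2 Ep))) (U : Ell2 Em →ₗ.[ℂ] Ell2 Ep)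
    (x : BdSpace Em) (y : BdSpace Ep) :
    (x, y) ∈ sepCond c Y U ↔
      WithLp.toLp 2 (x 0, y 0) ∈ Y ∧
      WithLp.toLp 2 (-(c.minus.mulα (x 2) + (1 / 2 : ℂ) • c.minus.mulβ (x 0)),
        c.plus.mulα (y 2) + (1 / 2 : ℂ) • c.plus.mulβ (y 0)) ∈ Yᗮ ∧
      (x 1, y 1) ∈ U.graph := Iff.rfl

/-- The operator `A_{Y,U}` with separated boundary conditions. -/
noncomputable def airyOpYU {Em Ep : Type*} (c : AiryCoeff (Em ⊕ Ep))
    (Y : Submodule ℂ (WithLp 2 (Ell2 Em × Ell2 Ep))) (U : Ell2 Em →ₗ.[ℂ] Ell2 Ep) :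
    L2Graph Em Ep →ₗ.[ℂ] L2Graph Em Ep :=
  airyOp c (sepCond c Y U)

/-- The inner product of `ℓ²(E, α)`, i.e. `∑ α_e x_e conj(y_e)`. As `α` and `1 / α` are bounded,
`ℓ²(E, α)` and `ℓ²(E)` are the same vector space. -/
noncomputable def weightedInner {E : Type*} (c : AiryCoeff E) (x y : Ell2 E) : ℂ :=
  inner ℂ y (c.mulα x)

/-- `U` is contractive from `ℓ²(E, α)` to `ℓ²(F, α)`. -/
def IsWeightedContraction {E F : Type*} (c : AiryCoeff E) (d : AiryCoeff F)
    (U : Ell2 E →ₗ[ℂ] Ell2 F) : Prop :=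
  ∀ x, (weightedInner d (U x) (U x)).re ≤ (weightedInner c x x).re

/-! ### Real parts -/

/-- The real part as a map `ℂ → ℂ`. -/
noncomputable def reC : ℂ →L[ℝ] ℂ := Complex.ofRealCLM.comp Complex.reCLM

theorem norm_reC_le (z : ℂ) : ‖reC z‖ ≤ ‖z‖ := by
  simpa [reC] using Complex.abs_re_le_norm z

/-- Componentwise real part on `ℓ²(E)`. -/
noncomputable def reEll2 {E : Type*} (x : Ell2 E) : Ell2 E :=
  ⟨fun e => reC (x e), Memℓp.mono' (lp.memℓp x) fun e => norm_reC_le (x e)⟩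

/-- Componentwise real part on the boundary space. -/
noncomputable def reBd {E : Type*} (x : BdSpace E) : BdSpace E :=
  WithLp.toLp 2 fun k => reEll2 (x k)

/-- Real part of an element of `L²(I)`. -/
noncomputable def reL2 {I : TopologicalSpace.Opens ℝ} (u : L2On I) : L2On I := reC.compLp u

theorem norm_reL2_le {I : TopologicalSpace.Opens ℝ} (u : L2On I) : ‖reL2 u‖ ≤ ‖u‖ := by
  refine Lp.norm_le_norm_of_ae_le ?_
  filter_upwards [reC.coeFn_compLp u] with x hx
  rw [reL2, hx]
  exact norm_reC_le _

/-- Real part of an element of `L²(G)`. -/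
noncomputable def reGraph {Em Ep : Type*} (u : L2Graph Em Ep) : L2Graph Em Ep :=
  ⟨fun e => reL2 (u e), Memℓp.mono' (lp.memℓp u) fun e => norm_reL2_le (u e)⟩

/-- `L` is real: `Re x ∈ D(L)` and `L (Re x) = Re (L x)` for all `x ∈ D(L)`. -/
def IsRealOp {E F : Type*} (L : BdSpace E →ₗ.[ℂ] BdSpace F) : Prop :=
  ∀ x : L.domain, ∃ h : reBd (x : BdSpace E) ∈ L.domain, L ⟨reBd (x : BdSpace E), h⟩ = reBd (L x)

/-! ### Strongly continuous semigroups -/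

/-- A `C₀`-semigroup of bounded operators on `H`. -/
structure C0Semigroup (H : Type*) [NormedAddCommGroup H] [NormedSpace ℂ H] where
  toFun : ℝ≥0 → H →L[ℂ] H
  map_zero : toFun 0 = ContinuousLinearMap.id ℂ H
  map_add : ∀ s t, toFun (s + t) = (toFun s).comp (toFun t)
  continuous_orbit : ∀ x, Continuous fun t => toFun t x

/-- `A` is the generator of `T`: `x ∈ D(A)` with `A x = y` if and only if
`(T(t) x - x) / t → y` as `t → 0+`. -/
def C0Semigroup.IsGeneratedBy {H : Type*} [NormedAddCommGroup H] [NormedSpace ℂ H]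
    (T : C0Semigroup H) (A : H →ₗ.[ℂ] H) : Prop :=
  ∀ x y : H, (x, y) ∈ A.graph ↔
    Tendsto (fun t : ℝ≥0 => (t : ℝ)⁻¹ • (T.toFun t x - x)) (𝓝[>] 0) (𝓝 y)

/-- A contraction semigroup. -/
def C0Semigroup.IsContractive {H : Type*} [NormedAddCommGroup H] [NormedSpace ℂ H]
    (T : C0Semigroup H) : Prop :=
  ∀ t, ‖T.toFun t‖ ≤ 1

/-- A semigroup on `L²(G)` is real if `T(t) Re u = Re T(t) u`. -/
def IsRealSemigroup {Em Ep : Type*} (T : C0Semigroup (L2Graph Em Ep)) : Prop :=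
  ∀ t u, T.toFun t (reGraph u) = reGraph (T.toFun t u)

end AiryStar

namespace AiryStar

/-! ### Dissipative evolution equations -/

section Semigroup

variable {H : Type*} [NormedAddCommGroup H] [InnerProductSpace ℂ H]

/-! Everything rests on Green's formula on the graph, `HasTrace.green`: if `u`, `v` lie in the
domain of the maximal operator `-A₀*` and have boundary values `p`, `q`, then `(-A₀* u | v) + (u |
-A₀* v) = ⟨p₊ | q₊⟩₊ - ⟨p₋ | q₋⟩₋`. Let `X` be a subspace of boundary values and `A_X` the
corresponding restriction of `-A₀*`. If `⟨x₊ | x₊⟩₊ ≤ ⟨x₋ | x₋⟩₋` on `X`, then `Re (A_X u | u) ≤ 0`,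
so `A_X` is dissipative.

Conversely, a vector `z` orthogonal to the range of `r - A_X` with `r > 0` satisfies `-A₀* z = -r
z`, and its boundary values `q` satisfy `⟨x₊ | q₊⟩₊ = ⟨x₋ | q₋⟩₋` for all `x ∈ X`. If the reverse
inequality `⟨q₋ | q₋⟩₋ ≤ ⟨q₊ | q₊⟩₊` holds for all such `q`, Green's formula gives `-2r‖z‖² ≥ 0`,
hence `z = 0`. If `X` is closed, so is `A_X`, because boundary values depend continuously on the
graph norm; then `r - A_X` is onto and the Lumer–Phillips theorem, proved by Yosida approximation,
yields a semigroup.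

Contractivity, uniqueness and reality have one source: the norm of a solution of the Cauchy problem
of a dissipative operator does not increase. This is applied to an orbit, to the difference of
orbits of two semigroups, and to `T(t) Re u - Re T(t) u`.

In (a), `X` is the graph of `L`, and the admissible `q` are exactly the pairs `(L♯ y, y)`, so the
two inequalities are the two contraction hypotheses. In (b), the Krein form decouples in the
coordinates `u`, `u'` and `α u'' + (β / 2) u` (`krein_eq_flux`); the conditions by `Y` and `Yᗮ`
cancel, and what remains are the contractivity of `U` and of its weighted adjoint.

The analytic input is about one half-line, with constants depending only on a common bound of the
coefficients, so that sums over edges converge: weak solutions are regular (`EdgeSol.of_weak`),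
boundary values are bounded by the graph norm (`EdgeSol.exists_bound`), and every triple of boundary
values is attained with control (`EdgeSol.exists_of_boundaryValues`). -/

/-- `A` is dissipative. -/
def IsDissipative (A : H →ₗ.[ℂ] H) : Prop :=
  ∀ x y, (x, y) ∈ A.graph → (inner ℂ x y).re ≤ 0

/-- The right derivative of `‖v‖²` is `2 Re (v, v') ≤ 0`. A one-sided derivative suffices for a
continuous function to be nonincreasing, and the definition of a generator only provides limits from
the right. -/
theorem norm_le_of_dissipative_deriv {v v' : ℝ → H} (hv : ContinuousOn v (Ici 0))
    (hd : ∀ t, 0 ≤ t → HasDerivWithinAt v (v' t) (Ici t) t)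
    (hdiss : ∀ t, 0 ≤ t → (inner ℂ (v t) (v' t)).re ≤ 0) {t : ℝ} (ht : 0 ≤ t) :
    ‖v t‖ ≤ ‖v 0‖ := by
  let _ : InnerProductSpace ℝ H := InnerProductSpace.complexToReal
  have hsq : ‖v t‖ ^ 2 ≤ ‖v 0‖ ^ 2 := by
    refine image_le_of_deriv_right_le_deriv_boundary (a := 0) (b := t)
      (f := fun s => ‖v s‖ ^ 2) (f' := fun s => 2 * (inner ℝ (v s) (v' s)))
      (B := fun _ => ‖v 0‖ ^ 2) (B' := fun _ => 0) ?_ ?_ le_rfl continuousOn_const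
      (fun x _ => hasDerivWithinAt_const _ _ _) ?_ ⟨ht, le_rfl⟩
    · exact (hv.mono Icc_subset_Ici_self).norm.pow 2
    · intro x hx
      exact (hd x hx.1).norm_sq
    · intro x hx
      have h := hdiss x hx.1
      have h2 : inner ℝ (v x) (v' x) = (inner ℂ (v x) (v' x)).re := rfl
      rw [h2]
      linarith
  exact le_of_sq_le_sq hsq (norm_nonneg _) 

theorem C0Semigroup.ext {H : Type*} [NormedAddCommGroup H] [NormedSpace ℂ H]
    {S T : C0Semigroup H} (h : ∀ t x, S.toFun t x = T.toFun t x) : S = T := by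
  cases S; cases T
  congr
  funext t
  ext x
  exact h t x

variable {A : H →ₗ.[ℂ] H} {T : C0Semigroup H}

/-- Orbits of elements of the domain are right differentiable and stay in the domain. -/
theorem C0Semigroup.IsGeneratedBy.mem_graph (hT : T.IsGeneratedBy A) {x y : H}
    (hxy : (x, y) ∈ A.graph) (t : ℝ≥0) : (T.toFun t x, T.toFun t y) ∈ A.graph := by
  rw [hT]
  have h := ((T.toFun t).continuous.tendsto y).comp ((hT x y).1 hxy)
  refine h.congr fun s => ?_
  have h1 : T.toFun s (T.toFun t x) = T.toFun t (T.toFun s x) := by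
    have h2 := T.map_add s t
    rw [add_comm, T.map_add] at h2
    exact (DFunLike.congr_fun h2 x).symm
  rw [Function.comp_apply, h1, ← map_sub]
  exact ((T.toFun t).restrictScalars ℝ).map_smul _ _

/-- A solution `ℝ≥0 → H` of the Cauchy problem: continuous, with right derivative `v'`. -/
theorem hasDerivWithinAt_toNNReal {v : ℝ≥0 → H} {t : ℝ≥0} {y : H}
    (h : Tendsto (fun s : ℝ≥0 => (s : ℝ)⁻¹ • (v (s + t) - v t)) (𝓝[>] 0) (𝓝 y)) :
    HasDerivWithinAt (fun r : ℝ => v r.toNNReal) y (Ici (t : ℝ)) t := by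
  rw [hasDerivWithinAt_iff_tendsto_slope, Ici_sdiff_left]
  have h1 : Tendsto (fun r : ℝ => (r - t).toNNReal) (𝓝[>] (t : ℝ)) (𝓝[>] 0) := by
    refine tendsto_nhdsWithin_iff.2 ⟨?_, ?_⟩
    · have : Tendsto (fun r : ℝ => (r - t).toNNReal) (𝓝 (t : ℝ)) (𝓝 ((t : ℝ) - t).toNNReal) :=
        (by fun_prop : Continuous fun r : ℝ => (r - t).toNNReal).tendsto _
      rw [sub_self, Real.toNNReal_zero] at this
      exact this.mono_left nhdsWithin_le_nhds
    · filter_upwards [self_mem_nhdsWithin] with r hr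
      simpa using hr
  refine (h.comp h1).congr' ?_
  filter_upwards [self_mem_nhdsWithin] with r hr
  have hr' : (t : ℝ) < r := hr
  have h2 : ((r - t).toNNReal : ℝ) = r - t := Real.coe_toNNReal _ (by linarith)
  have h3 : (r - t).toNNReal + t = r.toNNReal := by
    apply NNReal.eq
    rw [NNReal.coe_add, h2, Real.coe_toNNReal _ (t.2.trans hr'.le)]
    ring
  simp only [Function.comp_apply, h2, h3, slope, vsub_eq_sub, Real.toNNReal_coe]

/-- Solutions of the Cauchy problem for a dissipative operator do not grow. -/
theorem IsDissipative.norm_solution_le (hA : IsDissipative A) {v v' : ℝ≥0 → H}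
    (hv : Continuous v) (hmem : ∀ t, (v t, v' t) ∈ A.graph)
    (hd : ∀ t, Tendsto (fun s : ℝ≥0 => (s : ℝ)⁻¹ • (v (s + t) - v t)) (𝓝[>] 0) (𝓝 (v' t)))
    (t : ℝ≥0) : ‖v t‖ ≤ ‖v 0‖ := by
  have := norm_le_of_dissipative_deriv (v := fun r : ℝ => v r.toNNReal)
    (v' := fun r : ℝ => v' r.toNNReal) (hv.comp continuous_real_toNNReal).continuousOn
    (fun r hr => ?_) (fun r _ => hA _ _ (hmem _)) t.2
  · simpa using this
  · have h := hasDerivWithinAt_toNNReal (hd r.toNNReal)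
    rwa [Real.coe_toNNReal _ hr] at h

theorem C0Semigroup.IsGeneratedBy.tendsto (hT : T.IsGeneratedBy A) {x y : H}
    (hxy : (x, y) ∈ A.graph) (t : ℝ≥0) :
    Tendsto (fun s : ℝ≥0 => (s : ℝ)⁻¹ • (T.toFun (s + t) x - T.toFun t x)) (𝓝[>] 0)
      (𝓝 (T.toFun t y)) := by
  have h := (hT _ _).1 (hT.mem_graph hxy t)
  refine h.congr fun s => ?_
  rw [T.map_add]
  rfl

/-- Orbits starting in the domain solve the Cauchy problem, so their norms do not grow; the bound
extends by density. -/
theorem IsDissipative.isContractive (hA : IsDissipative A) (hdense : Dense (A.domain : Set H))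
    (hT : T.IsGeneratedBy A) : T.IsContractive := by
  intro t
  refine ContinuousLinearMap.opNorm_le_bound _ zero_le_one fun x => ?_
  rw [one_mul]
  refine hdense.induction (fun x hx => ?_) ?_ x
  · have := hA.norm_solution_le (T.continuous_orbit x) (v' := fun t => T.toFun t (A ⟨x, hx⟩))
      (fun t => hT.mem_graph (LinearPMap.mem_graph A ⟨x, hx⟩) t)
      (fun t => hT.tendsto (LinearPMap.mem_graph A ⟨x, hx⟩) t) t
    simpa [T.map_zero] using this
  · exact isClosed_le (by fun_prop) (by fun_prop)

/-- If `J` is real linear and leaves the graph of `A` invariant, it commutes with the semigroup. -/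
theorem IsDissipative.commutes (hA : IsDissipative A) (hdense : Dense (A.domain : Set H))
    {S : C0Semigroup H} (hS : S.IsGeneratedBy A) (hT : T.IsGeneratedBy A) (J : H →L[ℝ] H)
    (hJ : ∀ x y, (x, y) ∈ A.graph → (J x, J y) ∈ A.graph) (t : ℝ≥0) (x : H) :
    S.toFun t (J x) = J (T.toFun t x) := by
  refine hdense.induction (fun x hx => ?_) ?_ x
  · have hxy := LinearPMap.mem_graph A ⟨x, hx⟩
    set y := A ⟨x, hx⟩
    have hxy' := hJ _ _ hxy
    -- The difference of the two orbits stays in the graph, solves the Cauchy problem and starts at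
    -- `0`, hence vanishes.
    have := hA.norm_solution_le (v := fun t => S.toFun t (J x) - J (T.toFun t x))
      (v' := fun t => S.toFun t (J y) - J (T.toFun t y))
      ((S.continuous_orbit _).sub (J.continuous.comp (T.continuous_orbit x)))
      (fun t => A.graph.sub_mem (hS.mem_graph hxy' t) (hJ _ _ (hT.mem_graph hxy t)))
      (fun t => ?_) t
    · simpa [T.map_zero, S.map_zero, sub_eq_zero] using this
    · refine ((hS.tendsto hxy' t).sub ((J.continuous.tendsto _).comp (hT.tendsto hxy t))).congr
        fun s => ?_
      rw [Function.comp_apply, map_smul, ← smul_sub, map_sub]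
      congr 1
      abel
  · exact isClosed_eq (by fun_prop) (by fun_prop)

theorem IsDissipative.unique (hA : IsDissipative A) (hdense : Dense (A.domain : Set H))
    {S : C0Semigroup H} (hS : S.IsGeneratedBy A) (hT : T.IsGeneratedBy A) : S = T :=
  C0Semigroup.ext fun t x =>
    hA.commutes hdense hS hT (ContinuousLinearMap.id ℝ H) (fun _ _ h => h) t x

end Semigroup

/-! ### The Lumer–Phillips theorem in Hilbert spaces -/

section LumerPhillips

variable {H : Type*} [NormedAddCommGroup H] [InnerProductSpace ℂ H]
variable {A : H →ₗ.[ℂ] H}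

/-- Cauchy–Schwarz applied to `Re (x, r x - y) = r ‖x‖² - Re (x, y) ≥ r ‖x‖²`. For `r > 0` this
bounds the inverse of `r - A` on its range. -/
theorem IsDissipative.norm_resolvent_le (hA : IsDissipative A) {r : ℝ} {x y : H}
    (hxy : (x, y) ∈ A.graph) : r * ‖x‖ ≤ ‖(r : ℂ) • x - y‖ := by
  have h1 : (inner ℂ x ((r : ℂ) • x - y)).re = r * ‖x‖ ^ 2 - (inner ℂ x y).re := by
    rw [inner_sub_right, inner_smul_right, inner_self_eq_norm_sq_to_K, Complex.sub_re]
    congr 1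
    simp only [Complex.coe_algebraMap, ← Complex.ofReal_pow, ← Complex.ofReal_mul,
      Complex.ofReal_re]
  have h2 := hA x y hxy
  have h3 : (inner ℂ x ((r : ℂ) • x - y)).re ≤ ‖x‖ * ‖(r : ℂ) • x - y‖ :=
    (Complex.re_le_norm _).trans (norm_inner_le_norm _ _)
  rcases (norm_nonneg x).eq_or_lt with h | h
  · rw [← h, mul_zero]; exact norm_nonneg _
  · refine le_of_mul_le_mul_left ?_ h
    nlinarith

/-- The range of `r - A`. -/
def resolventRange (A : H →ₗ.[ℂ] H) (r : ℝ) : Submodule ℂ H :=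
  A.graph.map ((r : ℂ) • LinearMap.fst ℂ H H - LinearMap.snd ℂ H H)

theorem mem_resolventRange {r : ℝ} {z : H} :
    z ∈ resolventRange A r ↔ ∃ x y, (x, y) ∈ A.graph ∧ (r : ℂ) • x - y = z := by
  simp only [resolventRange, Submodule.mem_map, Prod.exists]
  rfl

variable [CompleteSpace H]

/-- By `norm_resolvent_le`, a convergent sequence in the range has Cauchy preimages; closedness of
`A` then identifies the limit. -/
theorem IsDissipative.isClosed_resolventRange (hA : IsDissipative A) (hcl : A.IsClosed) {r : ℝ}
    (hr : 0 < r) : IsClosed (resolventRange A r : Set H) := by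
  refine IsSeqClosed.isClosed fun z z₀ hz hlim => ?_
  choose x y hxy hz' using fun n => mem_resolventRange.1 (hz n)
  have hx : CauchySeq x := by
    rw [Metric.cauchySeq_iff]
    intro ε hε
    obtain ⟨N, hN⟩ := Metric.cauchySeq_iff.1 hlim.cauchySeq (r * ε) (by positivity)
    refine ⟨N, fun m hm n hn => ?_⟩
    have h1 := hN m hm n hn
    have h2 := hA.norm_resolvent_le (r := r) (A.graph.sub_mem (hxy m) (hxy n))
    rw [dist_eq_norm] at h1 ⊢
    have h3 : (r : ℂ) • (x m - x n) - (y m - y n) = z m - z n := by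
      rw [← hz' m, ← hz' n, smul_sub]; abel
    rw [h3] at h2
    exact lt_of_mul_lt_mul_left (h2.trans_lt h1) hr.le
  obtain ⟨x₀, hx₀⟩ := cauchySeq_tendsto_of_complete hx
  have hy : Tendsto y atTop (𝓝 ((r : ℂ) • x₀ - z₀)) := by
    refine ((hx₀.const_smul (r : ℂ)).sub hlim).congr fun n => ?_
    rw [← hz' n]; abel
  have hmem : (x₀, (r : ℂ) • x₀ - z₀) ∈ A.graph :=
    IsClosed.mem_of_tendsto hcl (hx₀.prodMk_nhds hy) (Eventually.of_forall hxy)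
  exact mem_resolventRange.2 ⟨_, _, hmem, by abel⟩

theorem IsDissipative.resolventRange_eq_top (hA : IsDissipative A) (hcl : A.IsClosed) {r : ℝ}
    (hr : 0 < r) (h : ∀ z, (∀ x y, (x, y) ∈ A.graph → inner ℂ z ((r : ℂ) • x - y) = 0) → z = 0) :
    resolventRange A r = ⊤ := by
  have := (hA.isClosed_resolventRange hcl hr).completeSpace_coe
  rw [← Submodule.orthogonal_eq_bot_iff, Submodule.eq_bot_iff]
  intro z hz
  refine h z fun x y hxy => ?_
  exact Submodule.inner_left_of_mem_orthogonal (mem_resolventRange.2 ⟨x, y, hxy, rfl⟩) hz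

omit [CompleteSpace H] in
/-- The resolvent `R = (r - A)⁻¹`. -/
theorem IsDissipative.exists_resolvent (hA : IsDissipative A) {r : ℝ} (hr : 0 < r)
    (h : resolventRange A r = ⊤) : ∃ R : H →L[ℂ] H, (∀ z, r * ‖R z‖ ≤ ‖z‖) ∧
      (∀ z, (R z, (r : ℂ) • R z - z) ∈ A.graph) ∧
      ∀ x y, (x, y) ∈ A.graph → R ((r : ℂ) • x - y) = x := by
  have hinj : ∀ {x y x' y' : H}, (x, y) ∈ A.graph → (x', y') ∈ A.graph →
      (r : ℂ) • x - y = (r : ℂ) • x' - y' → x = x' := by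
    intro x y x' y' h1 h2 h3
    have h4 := hA.norm_resolvent_le (r := r) (A.graph.sub_mem h1 h2)
    have h5 : (r : ℂ) • (x - x') - (y - y') = 0 := by
      rw [smul_sub, ← sub_eq_zero.2 h3]; abel
    rw [h5, norm_zero] at h4
    have h6 : ‖x - x'‖ ≤ 0 := by
      by_contra hcon
      push Not at hcon
      have := mul_pos hr hcon
      linarith
    exact sub_eq_zero.1 (norm_le_zero_iff.1 h6)
  have hex : ∀ z, ∃ x, (x, (r : ℂ) • x - z) ∈ A.graph := by
    intro z
    obtain ⟨x, y, hxy, rfl⟩ := mem_resolventRange.1 (h ▸ Submodule.mem_top : z ∈ resolventRange A r)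
    exact ⟨x, by rwa [sub_sub_cancel]⟩
  choose R hR using hex
  have huniq : ∀ {x y z : H}, (x, y) ∈ A.graph → (r : ℂ) • x - y = z → R z = x :=
    fun hxy hz => hinj (hR _) hxy (by rw [sub_sub_cancel, hz])
  have hbound : ∀ z, r * ‖R z‖ ≤ ‖z‖ := fun z => by
    have := hA.norm_resolvent_le (r := r) (hR z)
    rwa [sub_sub_cancel] at this
  let Rl : H →ₗ[ℂ] H :=
    { toFun := R
      map_add' := fun z w => huniq (A.graph.add_mem (hR z) (hR w)) (by
        simp only [smul_add]; abel)
      map_smul' := fun a z => huniq (A.graph.smul_mem a (hR z)) (by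
        simp only [RingHom.id_apply, smul_sub, smul_comm a (r : ℂ)]; abel) }
  refine ⟨Rl.mkContinuous r⁻¹ fun z => ?_, hbound, hR, fun x y hxy => huniq hxy rfl⟩
  rw [inv_mul_eq_div, le_div_iff₀' hr]
  exact hbound z

/-- The resolvents of `A` at the points `n + 1`, with their characteristic properties. -/
structure ResolventFamily (A : H →ₗ.[ℂ] H) (R : ℕ → H →L[ℂ] H) : Prop where
  bound : ∀ (n : ℕ) z, ((n : ℝ) + 1) * ‖R n z‖ ≤ ‖z‖
  mem : ∀ (n : ℕ) z, (R n z, ((n + 1 : ℝ) : ℂ) • R n z - z) ∈ A.graph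
  left_inv : ∀ (n : ℕ) x y, (x, y) ∈ A.graph → R n (((n + 1 : ℝ) : ℂ) • x - y) = x

/-- The Yosida approximation `r (r R - 1)` of `A`, at `r = n + 1`. -/
noncomputable def yosida (R : ℕ → H →L[ℂ] H) (n : ℕ) : H →L[ℂ] H :=
  ((n + 1 : ℝ) : ℂ) • (((n + 1 : ℝ) : ℂ) • R n - 1)

namespace ResolventFamily

variable {R : ℕ → H →L[ℂ] H} (hR : ResolventFamily A R)
include hR

omit [CompleteSpace H] in
-- Apply `R n` to `(n + 1 - A) (R m z) = (n - m) R m z + z`.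
theorem resolvent_identity (m n : ℕ) (z : H) :
    R m z - R n z = ((n : ℂ) - m) • R n (R m z) := by
  have h1 := hR.left_inv n _ _ (hR.mem m z)
  have h2 : ((n + 1 : ℝ) : ℂ) • R m z - (((m + 1 : ℝ) : ℂ) • R m z - z)
      = ((n : ℂ) - m) • R m z + z := by
    push_cast
    module
  rw [h2, map_add, map_smul] at h1
  nth_rw 1 [← h1]
  abel

omit [CompleteSpace H] in
-- Adding the resolvent identity to the one with `m` and `n` exchanged leaves `(n - m)(R n R m - R m
-- R n) = 0`. Commutation is what allows the exponentials of two Yosida approximations to be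
-- compared.
theorem commute (m n : ℕ) : Commute (R m) (R n) := by
  rcases eq_or_ne m n with rfl | hmn
  · exact Commute.refl _
  · ext z
    have h1 := hR.resolvent_identity m n z
    have h2 := hR.resolvent_identity n m z
    have h3 : ((n : ℂ) - m) • (R n (R m z) - R m (R n z)) = 0 := by
      rw [smul_sub, ← h1, ← neg_sub (m : ℂ) n, neg_smul, ← h2]; abel
    rcases smul_eq_zero.1 h3 with h | h
    · rw [sub_eq_zero, Nat.cast_inj] at h
      exact absurd h.symm hmn
    · exact (sub_eq_zero.1 h).symm

omit [CompleteSpace H] in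
theorem commute_yosida (m n : ℕ) : Commute (yosida R m) (yosida R n) := by
  have := hR.commute m n
  unfold yosida
  refine Commute.smul_left (Commute.smul_right ?_ _) _
  refine Commute.sub_left (Commute.sub_right ?_ (Commute.one_right _)) (Commute.one_left _)
  exact Commute.smul_left (Commute.smul_right this _) _

omit [CompleteSpace H] in
theorem yosida_apply {x y : H} (h : (x, y) ∈ A.graph) (n : ℕ) :
    yosida R n x = ((n + 1 : ℝ) : ℂ) • R n y := by
  have h1 := hR.left_inv n _ _ h
  rw [map_sub, map_smul] at h1
  have h2 : R n y = ((n + 1 : ℝ) : ℂ) • R n x - x := by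
    nth_rw 2 [← h1]; abel
  rw [h2]
  rfl

omit [CompleteSpace H] in
theorem norm_smul_resolvent_le (n : ℕ) (z : H) : ‖((n + 1 : ℝ) : ℂ) • R n z‖ ≤ ‖z‖ := by
  rw [norm_smul, Complex.norm_real, Real.norm_of_nonneg (by positivity)]
  exact hR.bound n z

omit [CompleteSpace H] in
-- For `(x, y)` in the graph the error `(n + 1) R n x - x` equals `R n y`, which is of order `1 / (n
-- + 1)`. The operators `(n + 1) R n` are contractions, so convergence extends to the closure of the
-- domain.
theorem tendsto_smul_resolvent (hdense : Dense (A.domain : Set H)) (z : H) :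
    Tendsto (fun n : ℕ => ((n + 1 : ℝ) : ℂ) • R n z) atTop (𝓝 z) := by
  have key : ∀ x y, (x, y) ∈ A.graph →
      Tendsto (fun n : ℕ => ((n + 1 : ℝ) : ℂ) • R n x) atTop (𝓝 x) := by
    intro x y hxy
    rw [tendsto_iff_norm_sub_tendsto_zero]
    refine squeeze_zero (fun _ => norm_nonneg _) (g := fun n : ℕ => ‖y‖ * (1 / ((n : ℝ) + 1)))
      (fun n => ?_) (by simpa using tendsto_one_div_add_atTop_nhds_zero_nat.const_mul ‖y‖)
    have h1 := hR.left_inv n _ _ hxy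
    rw [map_sub, map_smul] at h1
    have h2 : ((n + 1 : ℝ) : ℂ) • R n x - x = R n y := by
      nth_rw 2 [← h1]; abel
    rw [h2, mul_one_div, le_div_iff₀' (by positivity)]
    exact hR.bound n y
  rw [Metric.tendsto_atTop]
  intro ε hε
  obtain ⟨x, hx, hxz⟩ := Metric.mem_closure_iff.1 (hdense z) (ε / 3) (by positivity)
  obtain ⟨N, hN⟩ := Metric.tendsto_atTop.1 (key x _ (LinearPMap.mem_graph A ⟨x, hx⟩)) (ε / 3)
    (by positivity)
  refine ⟨N, fun n hn => ?_⟩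
  have h1 := hN n hn
  have h2 := hR.norm_smul_resolvent_le n (z - x)
  rw [map_sub, smul_sub] at h2
  rw [dist_eq_norm] at *
  have h3 : ((n + 1 : ℝ) : ℂ) • R n z - z = (((n + 1 : ℝ) : ℂ) • R n z - ((n + 1 : ℝ) : ℂ) • R n x)
      + (((n + 1 : ℝ) : ℂ) • R n x - x) - (z - x) := by abel
  rw [h3]
  have h4 := norm_sub_le ((((n + 1 : ℝ) : ℂ) • R n z - ((n + 1 : ℝ) : ℂ) • R n x)
      + (((n + 1 : ℝ) : ℂ) • R n x - x)) (z - x)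
  have h5 := norm_add_le (((n + 1 : ℝ) : ℂ) • R n z - ((n + 1 : ℝ) : ℂ) • R n x)
      (((n + 1 : ℝ) : ℂ) • R n x - x)
  linarith

omit [CompleteSpace H] in
theorem tendsto_yosida (hdense : Dense (A.domain : Set H)) {x y : H} (h : (x, y) ∈ A.graph) :
    Tendsto (fun n : ℕ => yosida R n x) atTop (𝓝 y) :=
  (hR.tendsto_smul_resolvent hdense y).congr fun n => (hR.yosida_apply h n).symm

omit [CompleteSpace H] in
theorem norm_yosida_le {x y : H} (h : (x, y) ∈ A.graph) (n : ℕ) : ‖yosida R n x‖ ≤ ‖y‖ := by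
  rw [hR.yosida_apply h]
  exact hR.norm_smul_resolvent_le n y

omit [CompleteSpace H] in
-- A nonnegative multiple of a contraction minus the identity is dissipative, by Cauchy–Schwarz.
theorem yosida_dissipative (n : ℕ) (x : H) : (inner ℂ x (yosida R n x)).re ≤ 0 := by
  have h1 : yosida R n x = ((n + 1 : ℝ) : ℂ) • (((n + 1 : ℝ) : ℂ) • R n x - x) := rfl
  rw [h1, inner_smul_right, Complex.re_ofReal_mul]
  refine mul_nonpos_of_nonneg_of_nonpos (by positivity) ?_
  rw [inner_sub_right, Complex.sub_re, inner_self_eq_norm_sq_to_K]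
  have h2 : (inner ℂ x (((n + 1 : ℝ) : ℂ) • R n x)).re ≤ ‖x‖ * ‖x‖ :=
    (Complex.re_le_norm _).trans ((norm_inner_le_norm _ _).trans
      (mul_le_mul_of_nonneg_left (hR.norm_smul_resolvent_le n x) (norm_nonneg _)))
  have h3 : (((‖x‖ : ℝ) : ℂ) ^ 2).re = ‖x‖ * ‖x‖ := by
    rw [← Complex.ofReal_pow, Complex.ofReal_re, sq]
  simp only [Complex.coe_algebraMap] at *
  linarith

end ResolventFamily
end LumerPhillips

/-! ### Exponentials of bounded dissipative operators -/

section BoundedDissipative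

variable {H : Type*} [NormedAddCommGroup H] [InnerProductSpace ℂ H] [CompleteSpace H]
variable {B C : H →L[ℂ] H}

/-- The exponential `exp (t B)` of a bounded operator. -/
noncomputable def expOp (B : H →L[ℂ] H) (t : ℝ) : H →L[ℂ] H := NormedSpace.exp (t • B)

theorem expOp_zero (B : H →L[ℂ] H) : expOp B 0 = 1 := by
  rw [expOp, zero_smul, NormedSpace.exp_zero]

theorem exp_add_of_commute {B C : H →L[ℂ] H} (h : Commute B C) :
    NormedSpace.exp (B + C) = NormedSpace.exp B * NormedSpace.exp C := by
  let _ : NormedAlgebra ℚ (H →L[ℂ] H) := NormedAlgebra.restrictScalars ℚ ℂ _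
  exact NormedSpace.exp_add_of_commute h

theorem expOp_add (B : H →L[ℂ] H) (s t : ℝ) : expOp B (s + t) = expOp B s * expOp B t := by
  rw [expOp, add_smul, exp_add_of_commute ((Commute.refl B).smul_left s |>.smul_right t)]
  rfl

theorem hasDerivAt_expOp_apply (B : H →L[ℂ] H) (x : H) (t : ℝ) :
    HasDerivAt (fun s => expOp B s x) (expOp B t (B x)) t := by
  have h := hasDerivAt_exp_smul_const (𝕂 := ℝ) B t
  exact ((ContinuousLinearMap.apply ℂ H x).restrictScalars ℝ).hasFDerivAt.comp_hasDerivAt t h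

theorem commute_expOp (h : Commute B C) (t : ℝ) : Commute B (expOp C t) :=
  Commute.exp_right (h.smul_right t)

theorem norm_expOp_apply_le (hB : ∀ x, (inner ℂ x (B x)).re ≤ 0) {t : ℝ} (ht : 0 ≤ t) (x : H) :
    ‖expOp B t x‖ ≤ ‖x‖ := by
  have h := norm_le_of_dissipative_deriv (v := fun s => expOp B s x)
    (v' := fun s => expOp B s (B x))
    (fun s _ => (hasDerivAt_expOp_apply B x s).continuousAt.continuousWithinAt)
    (fun s _ => (hasDerivAt_expOp_apply B x s).hasDerivWithinAt) (fun s _ => ?_) ht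
  · simpa [expOp_zero] using h
  · have h2 : expOp B s (B x) = B (expOp B s x) :=
      DFunLike.congr_fun (commute_expOp (Commute.refl B) s).eq.symm x
    rw [h2]
    exact hB _

theorem norm_expOp_sub_le (hB : ∀ x, (inner ℂ x (B x)).re ≤ 0) {t : ℝ} (ht : 0 ≤ t) (x : H) :
    ‖expOp B t x - x‖ ≤ t * ‖B x‖ := by
  have h := norm_image_sub_le_of_norm_deriv_le_segment' (f := fun s => expOp B s x) (a := 0)
    (b := t) (C := ‖B x‖) (fun s _ => (hasDerivAt_expOp_apply B x s).hasDerivWithinAt)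
    (fun s hs => norm_expOp_apply_le hB hs.1 _) t ⟨ht, le_rfl⟩
  simpa [expOp_zero, mul_comm] using h

/-- The path `s ↦ exp (s B) exp ((t - s) C) x` joins `exp (t C) x` to `exp (t B) x`, and its
derivative `exp (s B) exp ((t - s) C) (B x - C x)` has norm at most `‖B x - C x‖`. -/
theorem norm_expOp_sub_expOp_le (hB : ∀ x, (inner ℂ x (B x)).re ≤ 0)
    (hC : ∀ x, (inner ℂ x (C x)).re ≤ 0) (h : Commute B C) {t : ℝ} (ht : 0 ≤ t) (x : H) :
    ‖expOp B t x - expOp C t x‖ ≤ t * ‖B x - C x‖ := by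
  -- The left side is a single exponential in `s` and easy to differentiate; the right side is
  -- visibly a product of two contractions for `0 ≤ s ≤ t`.
  have hBC : ∀ s : ℝ, expOp (B - C) s * expOp C t = expOp B s * expOp C (t - s) := by
    intro s
    have h1 : Commute (s • B) ((t - s) • C) := (h.smul_left s).smul_right _
    have h2 : Commute (s • (B - C)) (t • C) :=
      ((h.sub_left (Commute.refl C)).smul_left s).smul_right t
    rw [expOp, expOp, expOp, expOp, ← exp_add_of_commute h1, ← exp_add_of_commute h2]
    congr 1
    module
  have hcomm : ∀ y, (B - C) (expOp C t y) = expOp C t ((B - C) y) := fun y =>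
    DFunLike.congr_fun (commute_expOp (h.sub_left (Commute.refl C)) t).eq y
  have h := norm_image_sub_le_of_norm_deriv_le_segment'
    (f := fun s => expOp (B - C) s (expOp C t x)) (a := 0)
    (b := t) (C := ‖B x - C x‖)
    (fun s _ => (hasDerivAt_expOp_apply (B - C) (expOp C t x) s).hasDerivWithinAt)
    (fun s hs => ?_) t ⟨ht, le_rfl⟩
  · have h3 := DFunLike.congr_fun (hBC t) x
    simp only [mul_apply_eq_comp, sub_self, expOp_zero] at h3
    simp only [h3, expOp_zero, sub_zero] at h
    rw [mul_comm]
    exact h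
  · have h3 := DFunLike.congr_fun (hBC s) ((B - C) x)
    rw [hcomm]
    rw [mul_apply_eq_comp] at h3
    rw [h3]
    exact (norm_expOp_apply_le hB hs.1 _).trans
      (norm_expOp_apply_le hC (sub_nonneg.2 hs.2.le) _)

/-- The derivative of the left side is `exp (s B) (B x) - B x`; splitting `B x = (B x - z) + z`
bounds it. The free vector `z` avoids `‖B² x‖`, which need not stay bounded along Yosida
approximations, whereas `‖B z‖` does when `z` is in the domain of `A`. -/
theorem norm_expOp_sub_sub_le (hB : ∀ x, (inner ℂ x (B x)).re ≤ 0) {t : ℝ} (ht : 0 ≤ t)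
    (x z : H) : ‖expOp B t x - x - t • B x‖ ≤ t * (t * ‖B z‖ + 2 * ‖B x - z‖) := by
  have h := norm_image_sub_le_of_norm_deriv_le_segment' (f := fun s => expOp B s x - s • B x)
    (f' := fun s => expOp B s (B x) - (1 : ℝ) • B x)
    (a := 0) (b := t) (C := t * ‖B z‖ + 2 * ‖B x - z‖)
    (fun s _ => ((hasDerivAt_expOp_apply B x s).sub
      ((hasDerivAt_id s).smul_const (B x))).hasDerivWithinAt)
    (fun s hs => ?_) t ⟨ht, le_rfl⟩
  · simp only [expOp_zero, zero_smul, sub_zero] at h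
    rw [mul_comm t, sub_right_comm]
    exact h
  · have h1 : expOp B s (B x) - (1 : ℝ) • B x
        = (expOp B s (B x - z) - (B x - z)) + (expOp B s z - z) := by
      rw [one_smul, map_sub]; abel
    rw [h1]
    have h2 := norm_expOp_sub_le hB hs.1 z
    have h3 := norm_expOp_apply_le hB hs.1 (B x - z)
    have h4 := norm_sub_le (expOp B s (B x - z)) (B x - z)
    have h5 := norm_add_le (expOp B s (B x - z) - (B x - z)) (expOp B s z - z)
    have h6 : s * ‖B z‖ ≤ t * ‖B z‖ := mul_le_mul_of_nonneg_right hs.2.le (norm_nonneg _)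
    linarith

end BoundedDissipative

/-! ### Generation by Yosida approximation -/

section Generation

variable {H : Type*} [NormedAddCommGroup H] [InnerProductSpace ℂ H] [CompleteSpace H]
variable {A : H →ₗ.[ℂ] H} {R : ℕ → H →L[ℂ] H}

/-- On the domain, `norm_expOp_sub_expOp_le` reduces the claim to convergence of the Yosida
approximations; contractivity extends it to all of `H`. -/
theorem ResolventFamily.cauchySeq (hR : ResolventFamily A R) (hdense : Dense (A.domain : Set H))
    {t : ℝ} (ht : 0 ≤ t) (x : H) : CauchySeq fun n => expOp (yosida R n) t x := by
  rw [Metric.cauchySeq_iff]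
  intro ε hε
  obtain ⟨x', hx', hxx'⟩ := Metric.mem_closure_iff.1 (hdense x) (ε / 3) (by positivity)
  have hc := (hR.tendsto_yosida hdense (LinearPMap.mem_graph A ⟨x', hx'⟩)).cauchySeq
  -- Dividing by `t + 1` instead of `t` covers `t = 0`.
  obtain ⟨N, hN⟩ := Metric.cauchySeq_iff.1 hc (ε / 3 / (t + 1)) (by positivity)
  refine ⟨N, fun m hm n hn => ?_⟩
  have h0 := hN m hm n hn
  have h1 := norm_expOp_sub_expOp_le (hR.yosida_dissipative m) (hR.yosida_dissipative n)
    (hR.commute_yosida m n) ht x'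
  have h2 := norm_expOp_apply_le (hR.yosida_dissipative m) ht (x - x')
  have h3 := norm_expOp_apply_le (hR.yosida_dissipative n) ht (x - x')
  rw [map_sub] at h2 h3
  rw [dist_eq_norm] at *
  have h4 : t * ‖yosida R m x' - yosida R n x'‖ ≤ ε / 3 := by
    have h5 : (t + 1) * ‖yosida R m x' - yosida R n x'‖ < ε / 3 := by
      rwa [lt_div_iff₀' (by positivity)] at h0
    nlinarith [norm_nonneg (yosida R m x' - yosida R n x')]
  have h6 : expOp (yosida R m) t x - expOp (yosida R n) t x
      = (expOp (yosida R m) t x - expOp (yosida R m) t x')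
        + (expOp (yosida R m) t x' - expOp (yosida R n) t x')
        - (expOp (yosida R n) t x - expOp (yosida R n) t x') := by abel
  rw [h6]
  refine (norm_sub_le _ _).trans_lt ?_
  have h7 := norm_add_le (expOp (yosida R m) t x - expOp (yosida R m) t x')
    (expOp (yosida R m) t x' - expOp (yosida R n) t x')
  linarith

/-- A family of contractions obtained as the strong limit of the exponentials of the Yosida
approximations. -/
theorem ResolventFamily.exists_limit (hR : ResolventFamily A R)
    (hdense : Dense (A.domain : Set H)) :
    ∃ T : ℝ≥0 → H →L[ℂ] H, (∀ t x, ‖T t x‖ ≤ ‖x‖) ∧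
      ∀ (t : ℝ≥0) x, Tendsto (fun n => expOp (yosida R n) t x) atTop (𝓝 (T t x)) := by
  choose T hT using fun (t : ℝ≥0) (x : H) =>
    cauchySeq_tendsto_of_complete (hR.cauchySeq hdense t.2 x)
  have hbound : ∀ t x, ‖T t x‖ ≤ ‖x‖ := fun t x =>
    le_of_tendsto (hT t x).norm (Eventually.of_forall fun n =>
      norm_expOp_apply_le (hR.yosida_dissipative n) t.2 x)
  let Tl : ℝ≥0 → H →ₗ[ℂ] H := fun t =>
    { toFun := T t
      map_add' := fun x y => tendsto_nhds_unique (hT t (x + y)) (by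
        simpa only [map_add] using (hT t x).add (hT t y))
      map_smul' := fun a x => tendsto_nhds_unique (hT t (a • x)) (by
        simpa only [map_smul, RingHom.id_apply] using (hT t x).const_smul a) }
  refine ⟨fun t => (Tl t).mkContinuous 1 fun x => ?_, hbound, hT⟩
  rw [one_mul]
  exact hbound t x

omit [CompleteSpace H] in
/-- Continuity of the orbits of a contraction semigroup follows from continuity at `0` on a dense
subspace. -/
theorem continuous_orbit_of_dense {T : ℝ≥0 → H →L[ℂ] H} (hbound : ∀ t x, ‖T t x‖ ≤ ‖x‖)
    (hadd : ∀ s t x, T (s + t) x = T s (T t x)) {D : Set H} (hD : Dense D)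
    (h : ∀ x ∈ D, ∃ K : ℝ, ∀ t : ℝ≥0, ‖T t x - x‖ ≤ K * t) (x : H) :
    Continuous fun t => T t x := by
  refine hD.induction (P := fun x => Continuous fun t => T t x) (fun x hx => ?_) ?_ x
  · obtain ⟨K, hK⟩ := h x hx
    have hK0 : 0 ≤ K := by simpa using (norm_nonneg _).trans (hK 1)
    refine LipschitzWith.continuous (K := K.toNNReal) ?_
    have key : ∀ s r : ℝ≥0, dist (T (s + r) x) (T s x) ≤ K * r := by
      intro s r
      rw [dist_eq_norm, hadd, ← map_sub]
      exact (hbound _ _).trans (hK r)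
    refine LipschitzWith.of_dist_le_mul fun s t => ?_
    rcases le_total s t with hst | hst
    · obtain ⟨r, rfl⟩ := exists_add_of_le hst
      rw [dist_comm, dist_comm s, NNReal.dist_eq]
      refine (key s r).trans (le_of_eq ?_)
      simp only [NNReal.coe_add, add_sub_cancel_left, NNReal.abs_eq, Real.coe_toNNReal _ hK0]
    · obtain ⟨r, rfl⟩ := exists_add_of_le hst
      rw [NNReal.dist_eq]
      refine (key t r).trans (le_of_eq ?_)
      simp only [NNReal.coe_add, add_sub_cancel_left, NNReal.abs_eq, Real.coe_toNNReal _ hK0]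
  -- Since all `T t` are contractions, orbits of nearby points are uniformly close, so continuity of
  -- orbits is a closed condition on the starting point.
  · refine isClosed_of_closure_subset fun x hx => ?_
    refine continuous_of_uniform_approx_of_continuous fun u hu => ?_
    obtain ⟨ε, hε, hεu⟩ := Metric.mem_uniformity_dist.1 hu
    obtain ⟨x', hx', hd⟩ := Metric.mem_closure_iff.1 hx ε hε
    refine ⟨fun t => T t x', hx', fun t => hεu ?_⟩
    rw [dist_eq_norm] at hd ⊢
    rw [← map_sub]
    exact (hbound _ _).trans_lt hd

theorem ResolventFamily.exists_semigroup (hR : ResolventFamily A R)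
    (hdense : Dense (A.domain : Set H)) :
    ∃ T : C0Semigroup H, (∀ t x, ‖T.toFun t x‖ ≤ ‖x‖) ∧
      ∀ x y, (x, y) ∈ A.graph →
        Tendsto (fun t : ℝ≥0 => (t : ℝ)⁻¹ • (T.toFun t x - x)) (𝓝[>] 0) (𝓝 y) := by
  obtain ⟨T, hbound, hT⟩ := hR.exists_limit hdense
  have hadd : ∀ s t x, T (s + t) x = T s (T t x) := by
    intro s t x
    refine tendsto_nhds_unique (hT (s + t) x) ?_
    rw [tendsto_iff_norm_sub_tendsto_zero]
    have h1 := tendsto_iff_norm_sub_tendsto_zero.1 (hT s (T t x))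
    have h2 := tendsto_iff_norm_sub_tendsto_zero.1 (hT t x)
    refine squeeze_zero (fun _ => norm_nonneg _) (fun n => ?_) (by simpa using h2.add h1)
    have h3 : expOp (yosida R n) ((s + t : ℝ≥0) : ℝ) x
        = expOp (yosida R n) s (expOp (yosida R n) t x) := by
      rw [NNReal.coe_add, expOp_add]; rfl
    have h4 := norm_expOp_apply_le (hR.yosida_dissipative n) s.2
      (expOp (yosida R n) t x - T t x)
    rw [map_sub] at h4
    rw [h3]
    exact (norm_sub_le_norm_sub_add_norm_sub _ _ _).trans (add_le_add_left h4 _)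
  have hlip : ∀ x ∈ (A.domain : Set H), ∃ K : ℝ, ∀ t : ℝ≥0, ‖T t x - x‖ ≤ K * t := by
    intro x hx
    have hxy := LinearPMap.mem_graph A ⟨x, hx⟩
    refine ⟨‖A ⟨x, hx⟩‖, fun t => ?_⟩
    refine le_of_tendsto ((hT t x).sub_const x).norm (Eventually.of_forall fun n => ?_)
    refine (norm_expOp_sub_le (hR.yosida_dissipative n) t.2 x).trans ?_
    rw [mul_comm]
    exact mul_le_mul_of_nonneg_right (hR.norm_yosida_le hxy n) t.2
  refine ⟨⟨T, ?_, fun s t => ContinuousLinearMap.ext (hadd s t),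
    continuous_orbit_of_dense hbound hadd hdense hlip⟩, hbound, fun x y hxy => ?_⟩
  · ext x
    refine tendsto_nhds_unique (hT 0 x) ?_
    simp [expOp_zero]
  · change Tendsto (fun t : ℝ≥0 => (t : ℝ)⁻¹ • (T t x - x)) (𝓝[>] 0) (𝓝 y)
    -- The bound `norm_expOp_sub_sub_le` for the Yosida approximations, passed to the limit `n → ∞`.
    have key : ∀ z z', (z, z') ∈ A.graph → ∀ t : ℝ≥0,
        ‖T t x - x - (t : ℝ) • y‖ ≤ t * (t * ‖z'‖ + 2 * ‖y - z‖) := by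
      intro z z' hz t
      have hy := hR.tendsto_yosida hdense hxy
      refine le_of_tendsto_of_tendsto (((hT t x).sub_const x).sub (hy.const_smul (t : ℝ))).norm
        (((((hR.tendsto_yosida hdense hz).norm.const_mul (t : ℝ))).add
          ((hy.sub_const z).norm.const_mul 2)).const_mul (t : ℝ)) (Eventually.of_forall fun n => ?_)
      exact norm_expOp_sub_sub_le (hR.yosida_dissipative n) t.2 x z
    rw [Metric.tendsto_nhdsWithin_nhds]
    intro ε hε
    -- The bracket `t ‖z'‖ + 2 ‖y - z‖` must be below `ε`: each summand gets `ε / 2`. The radius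
    -- below uses `‖z'‖ + 1` to avoid dividing by zero.
    obtain ⟨z, hz, hyz⟩ := Metric.mem_closure_iff.1 (hdense y) (ε / 4) (by positivity)
    set z' := A ⟨z, hz⟩
    refine ⟨ε / 2 / (‖z'‖ + 1), by positivity, fun t ht htd => ?_⟩
    have ht0 : (0 : ℝ) < t := ht
    have h1 := key z z' (LinearPMap.mem_graph A ⟨z, hz⟩) t
    rw [dist_eq_norm] at hyz ⊢
    have h2 : (t : ℝ)⁻¹ • (T t x - x) - y = (t : ℝ)⁻¹ • (T t x - x - (t : ℝ) • y) := by
      rw [smul_sub _ (T t x - x), inv_smul_smul₀ ht0.ne']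
    rw [h2, norm_smul, norm_inv, Real.norm_of_nonneg ht0.le, inv_mul_lt_iff₀ ht0]
    refine h1.trans_lt (mul_lt_mul_of_pos_left ?_ ht0)
    have h3 : (t : ℝ) < ε / 2 / (‖z'‖ + 1) := by
      simpa [NNReal.dist_eq] using htd
    rw [lt_div_iff₀ (by positivity)] at h3
    nlinarith [norm_nonneg z']

/-- The Lumer–Phillips theorem. -/
theorem IsDissipative.exists_isGeneratedBy (hA : IsDissipative A)
    (hdense : Dense (A.domain : Set H)) (h : ∀ r : ℝ, 0 < r → resolventRange A r = ⊤) :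
    ∃ T : C0Semigroup H, T.IsGeneratedBy A := by
  choose R h1 h2 h3 using fun n : ℕ => hA.exists_resolvent (r := (n + 1 : ℝ)) (by positivity)
    (h _ (by positivity))
  have hR : ResolventFamily A R := ⟨h1, h2, h3⟩
  obtain ⟨T, hbound, hT⟩ := hR.exists_semigroup hdense
  refine ⟨T, fun x y => ⟨hT x y, fun hxy => ?_⟩⟩
  -- The generator of `T` already extends `A`; the range condition rules out a proper extension. If
  -- `x` has derivative `y` at `0`, choose `(x', y')` in the graph with `x' - y' = x - y`. Then `y -
  -- y' = x - x'`, while contractivity gives `Re (x - x', y - y') ≤ 0`, so `x = x'`.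
  obtain ⟨x', y', hxy', hx'⟩ := mem_resolventRange.1
    ((h 1 one_pos) ▸ Submodule.mem_top : x - y ∈ resolventRange A 1)
  have hd := hxy.sub (hT x' y' hxy')
  have hdiss : (inner ℂ (x - x') (y - y')).re ≤ 0 := by
    refine le_of_tendsto (((Complex.continuous_re.tendsto _).comp
      (Tendsto.inner (𝕜 := ℂ) (tendsto_const_nhds (x := x - x')) hd))) ?_
    filter_upwards with t
    have h4 : (t : ℝ)⁻¹ • (T.toFun t x - x) - (t : ℝ)⁻¹ • (T.toFun t x' - x')
        = (((t : ℝ)⁻¹ : ℝ) : ℂ) • (T.toFun t (x - x') - (x - x')) := by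
      rw [← smul_sub, map_sub, Complex.coe_smul]
      congr 1
      abel
    rw [Function.comp_apply, h4, inner_smul_right, Complex.re_ofReal_mul]
    refine mul_nonpos_of_nonneg_of_nonpos (by positivity) ?_
    rw [inner_sub_right, Complex.sub_re, sub_nonpos]
    refine ((Complex.re_le_norm _).trans (norm_inner_le_norm _ _)).trans ?_
    have h5 : (inner ℂ (x - x') (x - x')).re = ‖x - x'‖ * ‖x - x'‖ := by
      have := inner_self_eq_norm_mul_norm (𝕜 := ℂ) (x - x')
      simpa using this
    rw [h5]
    exact mul_le_mul_of_nonneg_left (hbound _ _) (norm_nonneg _)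
  have h6 : y - y' = x - x' := by
    simp only [Complex.ofReal_one, one_smul] at hx'
    have : y = x - (x' - y') := by rw [hx']; abel
    rw [this]; abel
  rw [h6] at hdiss
  have h7 : x - x' = 0 := by
    have h8 := inner_self_eq_norm_sq (𝕜 := ℂ) (x - x')
    have h9 : ‖x - x'‖ ^ 2 ≤ 0 := by rw [← h8]; simpa using hdiss
    exact norm_eq_zero.1 (pow_eq_zero_iff two_ne_zero |>.1 (le_antisymm h9 (by positivity)))
  rw [h7] at h6
  rwa [sub_eq_zero.1 h7, sub_eq_zero.1 h6]

end Generation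

/-! ### Primitives of locally integrable functions -/

/-- `F` is a primitive of the locally integrable function `f`. -/
structure IsPrimitive (F f : ℝ → ℂ) : Prop where
  locallyIntegrable : LocallyIntegrable f
  sub_eq : ∀ a b, F b - F a = ∫ x in a..b, f x

namespace IsPrimitive

variable {F f G g : ℝ → ℂ}

theorem intervalIntegrable (h : IsPrimitive F f) (a b : ℝ) : IntervalIntegrable f volume a b :=
  (h.locallyIntegrable.integrableOn_isCompact isCompact_uIcc).intervalIntegrable

theorem eq_add (h : IsPrimitive F f) (a : ℝ) : F = fun x => F a + ∫ t in a..x, f t := by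
  funext x
  rw [← h.sub_eq a x]
  abel

theorem ae_hasDerivAt (h : IsPrimitive F f) : ∀ᵐ x, HasDerivAt F (f x) x := by
  filter_upwards [LocallyIntegrable.ae_hasDerivAt_integral h.locallyIntegrable] with x hx
  rw [h.eq_add 0]
  exact (hx 0).const_add _

theorem continuous (h : IsPrimitive F f) : Continuous F := by
  rw [h.eq_add 0]
  exact continuous_const.add (intervalIntegral.continuous_primitive h.intervalIntegrable 0)

theorem hasDerivAt (h : IsPrimitive F f) (hf : Continuous f) (x : ℝ) : HasDerivAt F (f x) x := by
  rw [h.eq_add 0]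
  exact (intervalIntegral.integral_hasDerivAt_right (h.intervalIntegrable _ _)
    hf.stronglyMeasurable.stronglyMeasurableAtFilter hf.continuousAt).const_add _

theorem of_integral (hf : LocallyIntegrable f) (a : ℝ) :
    IsPrimitive (fun x => ∫ t in a..x, f t) f :=
  have h (a b : ℝ) : IntervalIntegrable f volume a b :=
    (hf.integrableOn_isCompact isCompact_uIcc).intervalIntegrable
  ⟨hf, fun _ _ => intervalIntegral.integral_interval_sub_left (h _ _) (h _ _)⟩

theorem of_hasDerivAt (h : ∀ x, HasDerivAt F (f x) x) (hf : Continuous f) : IsPrimitive F f :=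
  ⟨hf.locallyIntegrable, fun _ _ => (intervalIntegral.integral_eq_sub_of_hasDerivAt
    (fun x _ => h x) (hf.intervalIntegrable _ _)).symm⟩

theorem add (hF : IsPrimitive F f) (hG : IsPrimitive G g) : IsPrimitive (F + G) (f + g) := by
  refine ⟨hF.locallyIntegrable.add hG.locallyIntegrable, fun a b => ?_⟩
  simp only [Pi.add_apply]
  rw [intervalIntegral.integral_add (hF.intervalIntegrable a b) (hG.intervalIntegrable a b),
    ← hF.sub_eq, ← hG.sub_eq]
  ring

theorem const_mul (hF : IsPrimitive F f) (r : ℂ) :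
    IsPrimitive (fun x => r * F x) (fun x => r * f x) := by
  refine ⟨hF.locallyIntegrable.smul r, fun a b => ?_⟩
  rw [intervalIntegral.integral_const_mul, ← hF.sub_eq]
  ring

theorem const (r : ℂ) : IsPrimitive (fun _ => r) (fun _ => 0) :=
  of_hasDerivAt (fun x => hasDerivAt_const x r) continuous_const

theorem clm_comp (hF : IsPrimitive F f) (L : ℂ →L[ℝ] ℂ) :
    IsPrimitive (fun x => L (F x)) (fun x => L (f x)) := by
  refine ⟨fun x => ?_, fun a b => ?_⟩
  · obtain ⟨s, hs, h⟩ := hF.locallyIntegrable x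
    exact ⟨s, hs, L.integrable_comp h⟩
  · rw [ContinuousLinearMap.intervalIntegral_comp_comm L (hF.intervalIntegrable a b),
      ← hF.sub_eq, map_sub]

theorem comp_neg (hF : IsPrimitive F f) : IsPrimitive (fun x => F (-x)) (fun x => -f (-x)) := by
  refine ⟨?_, fun a b => ?_⟩
  · refine LocallyIntegrable.neg ?_
    intro x
    obtain ⟨s, hs, h⟩ := hF.locallyIntegrable (-x)
    refine ⟨(fun y => -y) ⁻¹' s, continuous_neg.continuousAt.preimage_mem_nhds hs, ?_⟩
    exact ((Measure.measurePreserving_neg volume).integrableOn_comp_preimage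
      (MeasurableEquiv.neg ℝ).measurableEmbedding).2 h
  · rw [intervalIntegral.integral_neg, intervalIntegral.integral_comp_neg, hF.sub_eq,
      intervalIntegral.integral_symm]

theorem comp_add (hF : IsPrimitive F f) (r : ℝ) :
    IsPrimitive (fun x => F (x + r)) (fun x => f (x + r)) := by
  refine ⟨?_, fun a b => ?_⟩
  · intro x
    obtain ⟨s, hs, h⟩ := hF.locallyIntegrable (x + r)
    refine ⟨(fun y => y + r) ⁻¹' s,
      (by fun_prop : Continuous fun y => y + r).continuousAt.preimage_mem_nhds hs, ?_⟩
    exact ((measurePreserving_add_right volume r).integrableOn_comp_preimage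
      (MeasurableEquiv.addRight r).measurableEmbedding).2 h
  · rw [intervalIntegral.integral_comp_add_right, hF.sub_eq]

/-- The real and imaginary parts of `f` have absolutely continuous integrals, and `F` is a constant
plus these integrals multiplied by `1` and `Complex.I`. -/
theorem absolutelyContinuousOnInterval (h : IsPrimitive F f) (a b : ℝ) :
    AbsolutelyContinuousOnInterval F a b := by
  have hconst : ∀ z : ℂ, AbsolutelyContinuousOnInterval (fun _ : ℝ => z) a b := fun z =>
    (contDiffOn_const : ContDiffOn ℝ 1 (fun _ : ℝ => z) (uIcc a b)).absolutelyContinuousOnInterval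
  have hre : IntervalIntegrable (fun x => (f x).re) volume a b :=
    ⟨(h.intervalIntegrable a b).1.re, (h.intervalIntegrable a b).2.re⟩
  have him : IntervalIntegrable (fun x => (f x).im) volume a b :=
    ⟨(h.intervalIntegrable a b).1.im, (h.intervalIntegrable a b).2.im⟩
  have h1 := (hre.absolutelyContinuousOnInterval_intervalIntegral (c := a) left_mem_uIcc).fun_smul
    (hconst 1)
  have h2 := (him.absolutelyContinuousOnInterval_intervalIntegral (c := a) left_mem_uIcc).fun_smul
    (hconst Complex.I)
  have h3 := ((hconst (F a)).fun_add h1).fun_add h2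
  suffices h4 : F = fun x => F a + (∫ v in a..x, (f v).re) • (1 : ℂ)
      + (∫ v in a..x, (f v).im) • Complex.I by
    rw [h4]; exact h3
  rw [h.eq_add a]
  funext x
  simp only [intervalIntegral.integral_same, add_zero]
  have hre' := Complex.reCLM.intervalIntegral_comp_comm (h.intervalIntegrable a x)
  have him' := Complex.imCLM.intervalIntegral_comp_comm (h.intervalIntegrable a x)
  simp only [Complex.reCLM_apply, Complex.imCLM_apply] at hre' him'
  rw [hre', him', add_assoc]
  congr 1
  apply Complex.ext <;> simp

/-- `F` and the integral of `f` are absolutely continuous with the same derivative almost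
everywhere, so they differ by a constant. -/
theorem of_absolutelyContinuous (hF : ∀ a b, AbsolutelyContinuousOnInterval F a b)
    (hf : LocallyIntegrable f) (hd : ∀ᵐ x, HasDerivAt F (f x) x) : IsPrimitive F f := by
  refine ⟨hf, fun a b => ?_⟩
  have h := of_integral hf a
  obtain ⟨C, hC⟩ := ((hF a b).sub
    (h.absolutelyContinuousOnInterval a b)).const_of_ae_hasDerivAt_zero (by
      filter_upwards [hd, h.ae_hasDerivAt] with x h1 h2 _
      simpa using h1.sub h2)
  have ha := hC a left_mem_uIcc
  have hb := hC b right_mem_uIcc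
  simp only [Pi.sub_apply, intervalIntegral.integral_same] at ha hb
  linear_combination hb - ha

/-- Products of absolutely continuous functions are absolutely continuous and obey the Leibniz rule
almost everywhere. This is the source of every integration by parts below. -/
theorem mul (hF : IsPrimitive F f) (hG : IsPrimitive G g) :
    IsPrimitive (fun x => F x * G x) (fun x => f x * G x + F x * g x) := by
  refine of_absolutelyContinuous (fun a b => (hF.absolutelyContinuousOnInterval a b).fun_smul
    (hG.absolutelyContinuousOnInterval a b)) ?_ ?_
  · refine LocallyIntegrable.add ?_ ?_
    · have h := (locallyIntegrableOn_univ.2 hF.locallyIntegrable).mul_continuousOn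
        hG.continuous.continuousOn (isOpen_univ.isLocallyClosed)
      exact locallyIntegrableOn_univ.1 h
    · have h := (locallyIntegrableOn_univ.2 hG.locallyIntegrable).continuousOn_mul
        hF.continuous.continuousOn (isOpen_univ.isLocallyClosed)
      exact locallyIntegrableOn_univ.1 h
  · filter_upwards [hF.ae_hasDerivAt, hG.ae_hasDerivAt] with x h1 h2
    exact h1.mul h2

end IsPrimitive

/-! ### Third order jets and Green's formula -/

/-- `f₁`, `f₂`, `f₃` are the first three derivatives of `f`, the last one in the sense of
locally integrable functions. -/
structure IsJet (f f₁ f₂ f₃ : ℝ → ℂ) : Prop where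
  prim₁ : IsPrimitive f f₁
  prim₂ : IsPrimitive f₁ f₂
  prim₃ : IsPrimitive f₂ f₃

namespace IsJet

variable {f f₁ f₂ f₃ g g₁ g₂ g₃ : ℝ → ℂ}

theorem hasDerivAt₁ (h : IsJet f f₁ f₂ f₃) (x : ℝ) : HasDerivAt f (f₁ x) x :=
  h.prim₁.hasDerivAt h.prim₂.continuous x

theorem hasDerivAt₂ (h : IsJet f f₁ f₂ f₃) (x : ℝ) : HasDerivAt f₁ (f₂ x) x :=
  h.prim₂.hasDerivAt h.prim₃.continuous x

theorem add (hf : IsJet f f₁ f₂ f₃) (hg : IsJet g g₁ g₂ g₃) :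
    IsJet (f + g) (f₁ + g₁) (f₂ + g₂) (f₃ + g₃) :=
  ⟨hf.prim₁.add hg.prim₁, hf.prim₂.add hg.prim₂, hf.prim₃.add hg.prim₃⟩

theorem const_mul (hf : IsJet f f₁ f₂ f₃) (r : ℂ) :
    IsJet (fun x => r * f x) (fun x => r * f₁ x) (fun x => r * f₂ x) (fun x => r * f₃ x) :=
  ⟨hf.prim₁.const_mul r, hf.prim₂.const_mul r, hf.prim₃.const_mul r⟩

theorem clm_comp (hf : IsJet f f₁ f₂ f₃) (L : ℂ →L[ℝ] ℂ) :
    IsJet (fun x => L (f x)) (fun x => L (f₁ x)) (fun x => L (f₂ x)) (fun x => L (f₃ x)) :=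
  ⟨hf.prim₁.clm_comp L, hf.prim₂.clm_comp L, hf.prim₃.clm_comp L⟩

theorem comp_add (hf : IsJet f f₁ f₂ f₃) (r : ℝ) :
    IsJet (fun x => f (x + r)) (fun x => f₁ (x + r)) (fun x => f₂ (x + r))
      (fun x => f₃ (x + r)) :=
  ⟨hf.prim₁.comp_add r, hf.prim₂.comp_add r, hf.prim₃.comp_add r⟩

theorem comp_neg (hf : IsJet f f₁ f₂ f₃) :
    IsJet (fun x => f (-x)) (fun x => -f₁ (-x)) (fun x => f₂ (-x)) (fun x => -f₃ (-x)) := by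
  refine ⟨hf.prim₁.comp_neg, ?_, hf.prim₃.comp_neg⟩
  simpa using hf.prim₂.comp_neg.const_mul (-1)

/-- Derivatives of a smooth function. -/
theorem of_contDiff (hf : ContDiff ℝ ∞ f) :
    IsJet f (iteratedDeriv 1 f) (iteratedDeriv 2 f) (iteratedDeriv 3 f) := by
  have h : ∀ n : ℕ, IsPrimitive (iteratedDeriv n f) (iteratedDeriv (n + 1) f) := by
    intro n
    refine IsPrimitive.of_hasDerivAt (fun x => ?_) (hf.continuous_iteratedDeriv _ (by
      exact_mod_cast le_top))
    rw [iteratedDeriv_succ]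
    exact ((hf.differentiable_iteratedDeriv n (by
      exact_mod_cast WithTop.coe_lt_top n)) x).hasDerivAt
  have h0 := h 0
  rw [iteratedDeriv_zero] at h0
  exact ⟨h0, h 1, h 2⟩

end IsJet

/-- The sesquilinear form of the boundary terms at a point. -/
noncomputable def bdForm (a b : ℝ) (t s : Fin 3 → ℂ) : ℂ :=
  (a : ℂ) * (t 2 * star (s 0) - t 1 * star (s 1) + t 0 * star (s 2)) + (b : ℂ) * (t 0 * star (s 0))

/-- Green's formula. -/
theorem IsJet.isPrimitive_bdForm {f f₁ f₂ f₃ g g₁ g₂ g₃ : ℝ → ℂ} (hf : IsJet f f₁ f₂ f₃)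
    (hg : IsJet g g₁ g₂ g₃) (a b : ℝ) :
    IsPrimitive (fun x => bdForm a b ![f x, f₁ x, f₂ x] ![g x, g₁ x, g₂ x])
      (fun x => (a * f₃ x + b * f₁ x) * star (g x) + f x * star (a * g₃ x + b * g₁ x)) := by
  have hs := hg.clm_comp (starL' ℝ : ℂ ≃L[ℝ] ℂ).toContinuousLinearMap
  simp only [ContinuousLinearEquiv.coe_coe, starL'_apply] at hs
  -- In the derivative of `f₂ ḡ - f₁ ḡ₁ + f ḡ₂` the mixed terms cancel, leaving `f₃ ḡ + f ḡ₃`; the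
  -- `b` term is the Leibniz rule for `f ḡ`.
  have h1 := ((((hf.prim₃.mul hs.prim₁).add ((hf.prim₂.mul hs.prim₂).const_mul (-1))).add
    (hf.prim₁.mul hs.prim₃)).const_mul a).add ((hf.prim₁.mul hs.prim₁).const_mul b)
  convert h1 using 1
  · funext x
    simp only [bdForm, Pi.add_apply, Matrix.cons_val]
    ring
  · funext x
    simp
    ring

/-! ### The du Bois-Reymond lemma of third order -/

/-- `φ` is a real test function with support in `I`. -/
structure IsTestFn (I : Set ℝ) (φ : ℝ → ℝ) : Prop where
  contDiff : ContDiff ℝ ∞ φ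
  hasCompactSupport : HasCompactSupport φ
  tsupport_subset : tsupport φ ⊆ I

namespace IsTestFn

variable {I : Set ℝ} {φ ψ : ℝ → ℝ}

theorem deriv (h : IsTestFn I φ) : IsTestFn I (deriv φ) :=
  ⟨(contDiff_infty_iff_deriv.1 h.contDiff).2, h.hasCompactSupport.deriv,
    (closure_mono (support_deriv_subset)).trans
      (by rw [(isClosed_tsupport φ).closure_eq]; exact h.tsupport_subset)⟩

theorem sub_smul (h : IsTestFn I φ) (h' : IsTestFn I ψ) (r : ℝ) : IsTestFn I (φ - r • ψ) := by
  refine ⟨h.contDiff.sub (h'.contDiff.const_smul r),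
    h.hasCompactSupport.sub h'.hasCompactSupport.smul_left, ?_⟩
  refine (tsupport_sub _ _).trans (union_subset h.tsupport_subset ?_)
  exact (tsupport_smul_subset_right (fun _ => r) ψ).trans h'.tsupport_subset

theorem integrable (h : IsTestFn I φ) : Integrable φ :=
  h.contDiff.continuous.integrable_of_hasCompactSupport h.hasCompactSupport

theorem integrable_mul (h : IsTestFn I φ) {f : ℝ → ℂ} (hf : LocallyIntegrable f) :
    Integrable fun x => (φ x : ℂ) * f x := by
  have := hf.integrable_smul_left_of_hasCompactSupport h.contDiff.continuous h.hasCompactSupport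
  simpa using this

theorem exists_support_subset (h : IsTestFn I φ) : ∃ r : ℝ, Function.support φ ⊆ Ioc (-r) r := by
  obtain ⟨r, hr⟩ := h.hasCompactSupport.isCompact.isBounded.subset_ball 0
  refine ⟨r, (subset_tsupport φ).trans (hr.trans fun x hx => ?_)⟩
  rw [Metric.mem_ball, Real.dist_eq, sub_zero, abs_lt] at hx
  exact ⟨hx.1, hx.2.le⟩

theorem integral_deriv_mul (h : IsTestFn I φ) {F f : ℝ → ℂ} (hF : IsPrimitive F f) :
    ∫ x, ((_root_.deriv φ x : ℝ) : ℂ) * F x = -∫ x, (φ x : ℂ) * f x := by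
  obtain ⟨r, hr⟩ := h.exists_support_subset
  have hφ : IsPrimitive (fun x => (φ x : ℂ)) (fun x => ((_root_.deriv φ x : ℝ) : ℂ)) :=
    IsPrimitive.of_hasDerivAt
      (fun x => ((h.contDiff.differentiable (by simp)) x).hasDerivAt.ofReal_comp)
      (Complex.continuous_ofReal.comp h.deriv.contDiff.continuous)
  have h1 := (hφ.mul hF)
  obtain ⟨s, hs⟩ := (h.deriv).exists_support_subset
  -- Beyond the supports of both `φ` and its derivative, so the boundary terms vanish and the
  -- interval integral is the integral over the line.
  set q := max r s + 1
  have h2 := h1.sub_eq (-q) q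
  have hr1 : r ≤ max r s := le_max_left _ _
  have hs1 : s ≤ max r s := le_max_right _ _
  have hz : ∀ x, x ∉ Ioc (-r) r → φ x = 0 := fun x hx => by
    by_contra hne
    exact hx (hr hne)
  have e1 : φ q = 0 := hz q fun hx => by linarith [hx.2]
  have e2 : φ (-q) = 0 := hz (-q) fun hx => by linarith [hx.1]
  rw [e1, e2, Complex.ofReal_zero, zero_mul, zero_mul, sub_zero,
    intervalIntegral.integral_eq_integral_of_support_subset, integral_add] at h2
  · exact eq_neg_of_add_eq_zero_left h2.symm
  · exact h.deriv.integrable_mul hF.continuous.locallyIntegrable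
  · exact h.integrable_mul hF.locallyIntegrable
  · intro x hx
    by_contra hxq
    have hx1 : φ x = 0 := hz x fun hx' => hxq ⟨by linarith [hx'.1], by linarith [hx'.2]⟩
    have hx2 : _root_.deriv φ x = 0 := by
      by_contra hne
      have hx' := hs hne
      exact hxq ⟨by linarith [hx'.1], by linarith [hx'.2]⟩
    exact hx (by simp [hx1, hx2])

/-- Integrate from the left of the support: the vanishing total integral makes the primitive vanish
to the right as well. Order connectedness of `I` places the hull `[p, q]` of the support inside `I`.
-/
theorem exists_antideriv (h : IsTestFn I ψ) (hI : I.OrdConnected) (h0 : ∫ x, ψ x = 0) :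
    ∃ φ, IsTestFn I φ ∧ _root_.deriv φ = ψ := by
  rcases (tsupport ψ).eq_empty_or_nonempty with he | hne
  · have hψ : ψ = 0 := tsupport_eq_empty_iff.1 he
    exact ⟨0, ⟨contDiff_const, HasCompactSupport.zero, by simp⟩, by rw [hψ]; exact deriv_zero⟩
  obtain ⟨p, hp, hp'⟩ := h.hasCompactSupport.isCompact.exists_isLeast hne
  obtain ⟨q, hq, hq'⟩ := h.hasCompactSupport.isCompact.exists_isGreatest hne
  have hzero : ∀ x, x ∉ Icc p q → ψ x = 0 := fun x hx => by
    by_contra hne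
    exact hx ⟨hp' (subset_tsupport ψ hne), hq' (subset_tsupport ψ hne)⟩
  have hd : ∀ x, HasDerivAt (fun x => ∫ t in (p - 1)..x, ψ t) (ψ x) x := fun x =>
    intervalIntegral.integral_hasDerivAt_right (h.integrable.intervalIntegrable)
      h.contDiff.continuous.stronglyMeasurable.stronglyMeasurableAtFilter
      h.contDiff.continuous.continuousAt
  have hder : _root_.deriv (fun x => ∫ t in (p - 1)..x, ψ t) = ψ := funext fun x => (hd x).deriv
  have hsupp : Function.support (fun x => ∫ t in (p - 1)..x, ψ t) ⊆ Icc p q := by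
    intro x hx
    by_contra hcon
    apply hx
    rcases lt_or_ge x p with hxp | hxp
    · refine intervalIntegral.integral_zero_ae (Eventually.of_forall fun t ht => hzero t ?_)
      intro ht'
      have := ht.2
      have h3 : max (p - 1) x < p := max_lt (by linarith) hxp
      linarith [ht'.1]
    · have hxq : q < x := by
        by_contra hle
        exact hcon ⟨hxp, not_lt.1 hle⟩
      change ∫ t in (p - 1)..x, ψ t = 0
      rw [intervalIntegral.integral_eq_integral_of_support_subset, h0]
      intro t ht
      have ht' : t ∈ Icc p q := by
        by_contra hcon'
        exact ht (hzero t hcon')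
      exact ⟨by linarith [ht'.1], by linarith [ht'.2]⟩
  refine ⟨_, ⟨?_, HasCompactSupport.of_support_subset_isCompact isCompact_Icc hsupp, ?_⟩, hder⟩
  · rw [contDiff_infty_iff_deriv, hder]
    exact ⟨fun x => (hd x).differentiableAt, h.contDiff⟩
  · exact (closure_minimal hsupp isClosed_Icc).trans
      (hI.out (h.tsupport_subset hp) (h.tsupport_subset hq))

end IsTestFn

theorem exists_isTestFn_integral_eq_one {I : Set ℝ} (hI : IsOpen I) (hne : I.Nonempty) :
    ∃ ψ, IsTestFn I ψ ∧ ∫ x, ψ x = 1 := by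
  obtain ⟨x, hx⟩ := hne
  obtain ⟨ε, hε, hball⟩ := Metric.isOpen_iff.1 hI x hx
  let b : ContDiffBump x := ⟨ε / 4, ε / 2, by positivity, by linarith⟩
  refine ⟨b.normed volume, ⟨b.contDiff_normed, b.hasCompactSupport_normed, ?_⟩, b.integral_normed⟩
  rw [b.tsupport_normed_eq]
  exact (Metric.closedBall_subset_ball (show ε / 2 < ε by linarith)).trans hball

/-- Subtracting `(∫ ψ) ψ₀` with `∫ ψ₀ = 1` turns `ψ` into a test function of integral zero, which is
a derivative and so is annihilated by `T`. Only compatibility of `T` with such differences is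
needed. -/
theorem exists_eq_mul_integral {I : Set ℝ} (hI : IsOpen I) (hne : I.Nonempty)
    (hc : I.OrdConnected) (T : (ℝ → ℝ) → ℂ)
    (hsub : ∀ φ ψ, IsTestFn I φ → IsTestFn I ψ → ∀ r : ℝ, T (φ - r • ψ) = T φ - r * T ψ)
    (hT : ∀ φ, IsTestFn I φ → T (deriv φ) = 0) :
    ∃ c, ∀ ψ, IsTestFn I ψ → T ψ = c * ((∫ x, ψ x : ℝ) : ℂ) := by
  obtain ⟨ψ₀, h₀, hi₀⟩ := exists_isTestFn_integral_eq_one hI hne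
  refine ⟨T ψ₀, fun ψ hψ => ?_⟩
  obtain ⟨φ, hφ, hφ'⟩ := (hψ.sub_smul h₀ (∫ x, ψ x)).exists_antideriv hc (by
    simp only [Pi.sub_apply, Pi.smul_apply, smul_eq_mul]
    rw [integral_sub hψ.integrable (h₀.integrable.const_mul _), integral_const_mul, hi₀]
    simp)
  have h1 := hT φ hφ
  rw [hφ', hsub _ _ hψ h₀, sub_eq_zero] at h1
  rw [h1, mul_comm]

theorem deriv_sub_smul {φ ψ : ℝ → ℝ} (hφ : ContDiff ℝ ∞ φ) (hψ : ContDiff ℝ ∞ ψ) (r : ℝ) :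
    deriv (φ - r • ψ) = deriv φ - r • deriv ψ := by
  funext x
  have h1 := ((hφ.differentiable (by simp)) x)
  have h2 := ((hψ.differentiable (by simp)) x)
  exact (h1.hasDerivAt.sub (h2.hasDerivAt.const_smul r)).deriv

theorem integral_sub_smul_mul {I : Set ℝ} {φ ψ : ℝ → ℝ} (hφ : IsTestFn I φ) (hψ : IsTestFn I ψ)
    (r : ℝ) {f : ℝ → ℂ} (hf : LocallyIntegrable f) :
    ∫ x, (((φ - r • ψ) x : ℝ) : ℂ) * f x
      = (∫ x, (φ x : ℂ) * f x) - r * ∫ x, (ψ x : ℂ) * f x := by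
  rw [← integral_const_mul, ← integral_sub (hφ.integrable_mul hf)
    ((hψ.integrable_mul hf).const_mul _)]
  congr 1
  funext x
  simp only [Pi.sub_apply, Pi.smul_apply, smul_eq_mul, Complex.ofReal_sub, Complex.ofReal_mul]
  ring

theorem isPrimitive_id : IsPrimitive (fun x => (x : ℂ)) (fun _ => 1) :=
  IsPrimitive.of_hasDerivAt (fun _ => Complex.ofRealCLM.hasDerivAt) continuous_const

theorem isPrimitive_sq_half :
    IsPrimitive (fun x => (x : ℂ) ^ 2 / 2) (fun x => (x : ℂ)) := by
  have h := (isPrimitive_id.mul isPrimitive_id).const_mul (1 / 2)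
  convert h using 2
  · ring
  · ring

/-- Three applications of `exists_eq_mul_integral`, each removing one derivative from the test
function at the cost of subtracting a multiple of `x² / 2`, `x` and `1` in turn. -/
theorem ae_eq_quadratic {I : Set ℝ} (hI : IsOpen I) (hne : I.Nonempty) (hc : I.OrdConnected)
    {h : ℝ → ℂ} (hh : LocallyIntegrable h)
    (hint : ∀ φ, IsTestFn I φ → ∫ x, ((deriv (deriv (deriv φ)) x : ℝ) : ℂ) * h x = 0) :
    ∃ c₀ c₁ c₂ : ℂ, ∀ᵐ x : ℝ, x ∈ I → h x = c₀ + c₁ * x + c₂ * ((x : ℂ) ^ 2 / 2) := by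
  have hone : ∀ φ, IsTestFn I φ → ((∫ x, φ x : ℝ) : ℂ) = ∫ x, (φ x : ℂ) * (1 : ℂ) := fun φ _ => by
    simp only [mul_one, integral_complex_ofReal]
  have hi0 : LocallyIntegrable fun _ : ℝ => (1 : ℂ) := continuous_const.locallyIntegrable
  have hi1 : LocallyIntegrable fun x : ℝ => (x : ℂ) := isPrimitive_id.continuous.locallyIntegrable
  have hi2 : LocallyIntegrable fun x : ℝ => (x : ℂ) ^ 2 / 2 :=
    isPrimitive_sq_half.continuous.locallyIntegrable
  have hsubmul : ∀ (φ : ℝ → ℝ) (f g : ℝ → ℂ) (c : ℂ), IsTestFn I φ → LocallyIntegrable f →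
      LocallyIntegrable g →
      ∫ x, (φ x : ℂ) * (f x - c * g x) = (∫ x, (φ x : ℂ) * f x) - c * ∫ x, (φ x : ℂ) * g x := by
    intro φ f g c hφ hf hg
    rw [← integral_const_mul, ← integral_sub (hφ.integrable_mul hf)
      ((hφ.integrable_mul hg).const_mul _)]
    congr 1
    funext x
    ring
  obtain ⟨c₂, h2⟩ := exists_eq_mul_integral hI hne hc
    (fun φ => ∫ x, ((deriv (deriv φ) x : ℝ) : ℂ) * h x) (fun φ ψ hφ hψ r => by
      have h1 := deriv_sub_smul hφ.contDiff hψ.contDiff r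
      have h2 := deriv_sub_smul hφ.deriv.contDiff hψ.deriv.contDiff r
      rw [h1, h2, integral_sub_smul_mul hφ.deriv.deriv hψ.deriv.deriv r hh]) hint
  have hh1 : LocallyIntegrable fun x => h x - c₂ * ((x : ℂ) ^ 2 / 2) := hh.sub (hi2.smul c₂)
  have h2' : ∀ φ, IsTestFn I φ →
      ∫ x, ((deriv (deriv φ) x : ℝ) : ℂ) * (h x - c₂ * ((x : ℂ) ^ 2 / 2)) = 0 := by
    intro φ hφ
    rw [hsubmul _ h (fun x => (x : ℂ) ^ 2 / 2) c₂ hφ.deriv.deriv hh hi2, h2 φ hφ,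
      hφ.deriv.integral_deriv_mul isPrimitive_sq_half, hφ.integral_deriv_mul isPrimitive_id,
      hone φ hφ]
    ring
  obtain ⟨c₁, h1⟩ := exists_eq_mul_integral hI hne hc
    (fun φ => ∫ x, ((deriv φ x : ℝ) : ℂ) * (h x - c₂ * ((x : ℂ) ^ 2 / 2)))
    (fun φ ψ hφ hψ r => by
      have h1 := deriv_sub_smul hφ.contDiff hψ.contDiff r
      rw [h1, integral_sub_smul_mul hφ.deriv hψ.deriv r hh1]) h2'
  -- The coefficient of `x` is `-c₁`, since `∫ φ' x = -∫ φ`.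
  have hh0 : LocallyIntegrable fun x => h x - c₂ * ((x : ℂ) ^ 2 / 2) - (-c₁) * (x : ℂ) :=
    hh1.sub (hi1.smul (-c₁))
  have h1' : ∀ φ, IsTestFn I φ →
      ∫ x, ((deriv φ x : ℝ) : ℂ) * (h x - c₂ * ((x : ℂ) ^ 2 / 2) - (-c₁) * (x : ℂ)) = 0 := by
    intro φ hφ
    rw [hsubmul _ (fun x => h x - c₂ * ((x : ℂ) ^ 2 / 2)) (fun x => (x : ℂ)) (-c₁) hφ.deriv hh1 hi1,
      h1 φ hφ, hφ.integral_deriv_mul isPrimitive_id, hone φ hφ]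
    ring
  obtain ⟨c₀, h0⟩ := exists_eq_mul_integral hI hne hc
    (fun φ => ∫ x, ((φ x : ℝ) : ℂ) * (h x - c₂ * ((x : ℂ) ^ 2 / 2) - (-c₁) * (x : ℂ)))
    (fun φ ψ hφ hψ r => integral_sub_smul_mul hφ hψ r hh0) h1'
  have hfin := hI.ae_eq_zero_of_integral_contDiff_smul_eq_zero (μ := volume)
    (f := fun x => h x - c₂ * ((x : ℂ) ^ 2 / 2) - (-c₁) * (x : ℂ) - c₀ * 1)
    ((hh0.sub (hi0.smul c₀)).locallyIntegrableOn I) (fun g hg hg' hg'' => by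
      have hφ : IsTestFn I g := ⟨hg, hg', hg''⟩
      simp only [Complex.real_smul]
      rw [hsubmul g (fun x => h x - c₂ * ((x : ℂ) ^ 2 / 2) - (-c₁) * (x : ℂ)) (fun _ => 1) c₀ hφ
        hh0 hi0, h0 g hφ, hone g hφ]
      ring)
  refine ⟨c₀, -c₁, c₂, ?_⟩
  filter_upwards [hfin] with x hx hxI
  linear_combination hx hxI


/-! ### Boundary estimates -/

theorem iteratedDeriv_eq_zero_of_notMem_tsupport {f : ℝ → ℂ} {x : ℝ} (hx : x ∉ tsupport f) (n : ℕ) :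
    iteratedDeriv n f x = 0 := by
  have h : f =ᶠ[𝓝 x] fun _ => 0 := notMem_tsupport_iff_eventuallyEq.1 hx
  rw [h.iteratedDeriv_eq, iteratedDeriv_const]
  simp

/-- Smooth functions supported in `[-1, 1]` with prescribed derivatives at `0`. -/
theorem exists_smooth_dual : ∃ ψ : Fin 3 → ℝ → ℂ, ∀ k, ContDiff ℝ ∞ (ψ k) ∧
    HasCompactSupport (ψ k) ∧ tsupport (ψ k) ⊆ Metric.closedBall 0 1 ∧
    ∀ j : Fin 3, iteratedDeriv j (ψ k) 0 = if j = k then 1 else 0 := by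
  let χ : ContDiffBump (0 : ℝ) := ⟨1 / 2, 1, by norm_num, by norm_num⟩
  -- The cutoff is `1` near `0`, so the Taylor monomial `x ^ k / k!` determines the derivatives
  -- there.
  refine ⟨fun k x => (χ x : ℂ) * ((x ^ (k : ℕ) / (k : ℕ).factorial : ℝ) : ℂ), fun k => ?_⟩
  have hsupp : Function.support (fun x => (χ x : ℂ) * ((x ^ (k : ℕ) / (k : ℕ).factorial : ℝ) : ℂ))
      ⊆ Metric.closedBall 0 1 := by
    intro x hx
    have h1 : x ∈ Function.support χ := fun h =>
      hx (by simp only [h, Complex.ofReal_zero, zero_mul])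
    rw [χ.support_eq] at h1
    exact Metric.ball_subset_closedBall h1
  refine ⟨?_, HasCompactSupport.of_support_subset_isCompact (isCompact_closedBall 0 1) hsupp,
    closure_minimal hsupp Metric.isClosed_closedBall, fun j => ?_⟩
  · refine (Complex.ofRealCLM.contDiff.comp χ.contDiff).mul (Complex.ofRealCLM.contDiff.comp ?_)
    exact (contDiff_id.pow _).div_const _
  · have h1 : (fun x => (χ x : ℂ) * ((x ^ (k : ℕ) / (k : ℕ).factorial : ℝ) : ℂ))
        =ᶠ[𝓝 0] fun x => ((k : ℕ).factorial : ℂ)⁻¹ * ((x ^ (k : ℕ) : ℝ) : ℂ) := by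
      filter_upwards [χ.eventuallyEq_one] with x hx
      rw [hx]
      simp [div_eq_inv_mul]
    have h2 : ∀ n : ℕ, iteratedDeriv n (fun x : ℝ => ((x ^ (k : ℕ) : ℝ) : ℂ))
        = fun x => ((iteratedDeriv n (fun x : ℝ => x ^ (k : ℕ)) x : ℝ) : ℂ) := by
      intro n
      induction n with
      | zero => simp
      | succ n ih =>
        funext x
        rw [iteratedDeriv_succ, ih, iteratedDeriv_succ]
        refine HasDerivAt.deriv (HasDerivAt.ofReal_comp ?_)
        exact (((contDiff_id.pow _ :
          ContDiff ℝ ∞ fun x : ℝ => x ^ (k : ℕ)).differentiable_iteratedDeriv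
          n (by exact_mod_cast WithTop.coe_lt_top n)) x).hasDerivAt
    rw [h1.iteratedDeriv_eq, iteratedDeriv_const_mul_field, h2]
    simp only [iteratedDeriv_fun_pow_zero]
    fin_cases k <;> fin_cases j <;> simp [Nat.factorial]

theorem exists_iteratedDeriv_bound {ψ : Fin 3 → ℝ → ℂ}
    (hψ : ∀ k, ContDiff ℝ ∞ (ψ k) ∧ HasCompactSupport (ψ k)) :
    ∃ M : ℝ, 0 ≤ M ∧ ∀ (n : Fin 4) k x, ‖iteratedDeriv n (ψ k) x‖ ≤ M := by
  have h : ∀ p : Fin 4 × Fin 3, ∃ C : ℝ, ∀ x, ‖iteratedDeriv p.1 (ψ p.2) x‖ ≤ C := by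
    intro p
    refine ((hψ p.2).1.continuous_iteratedDeriv _ ?_).bounded_above_of_compact_support ?_
    · exact_mod_cast le_top
    · refine (hψ p.2).2.mono' fun x hx => ?_
      by_contra hcon
      exact hx (iteratedDeriv_eq_zero_of_notMem_tsupport hcon _)
  choose C hC using h
  refine ⟨∑ p, |C p|, Finset.sum_nonneg fun _ _ => abs_nonneg _, fun n k x => ?_⟩
  exact (hC (n, k) x).trans ((le_abs_self _).trans
    (Finset.single_le_sum (f := fun p => |C p|) (fun _ _ => abs_nonneg _) (Finset.mem_univ (n, k))))

/-- A common bound for the coefficients on an edge. -/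
structure CoeffBound (K a b : ℝ) : Prop where
  pos : 0 < a
  le : a ≤ K
  inv_le : a⁻¹ ≤ K
  abs_le : |b| ≤ K

theorem CoeffBound.nonneg {K a b : ℝ} (h : CoeffBound K a b) : 0 ≤ K :=
  h.pos.le.trans h.le

theorem CoeffBound.norm_le_of_mul {K a b : ℝ} (h : CoeffBound K a b) {z : ℂ} {S : ℝ}
    (hz : ‖(a : ℂ) * z‖ ≤ S) : ‖z‖ ≤ K * S := by
  rw [norm_mul, Complex.norm_real, Real.norm_of_nonneg h.pos.le] at hz
  have h1 : ‖z‖ = a⁻¹ * (a * ‖z‖) := by field_simp [h.pos.ne']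
  rw [h1]
  exact mul_le_mul h.inv_le hz (by have := h.pos; positivity) h.nonneg

/-- Green's formula on `[0, 2]` against the functions of `exists_smooth_dual`, which vanish near
`2`, expresses boundary terms at `0` through `f` and `a f₃ + b f₁` alone. No separate control of
intermediate derivatives is needed, and the constant depends only on `K`. -/
theorem exists_norm_le_integral (K : ℝ) : ∃ C : ℝ, 0 ≤ C ∧ ∀ a b, CoeffBound K a b →
    ∀ f f₁ f₂ f₃ : ℝ → ℂ, IsJet f f₁ f₂ f₃ → ∀ k : Fin 3,
      ‖(![f 0, f₁ 0, f₂ 0] : Fin 3 → ℂ) k‖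
        ≤ C * ∫ x in (0 : ℝ)..2, (‖f x‖ + ‖a * f₃ x + b * f₁ x‖) := by
  obtain ⟨ψ, hψ⟩ := exists_smooth_dual
  obtain ⟨M, hM0, hM⟩ := exists_iteratedDeriv_bound fun k => ⟨(hψ k).1, (hψ k).2.1⟩
  -- The last factor bounds the test functions and their images `a ψ''' + b ψ'`; the others come
  -- from solving a triangular system for `f 0`, `f₁ 0`, `f₂ 0`. The maximum makes the constant
  -- nonnegative for every `K`; it equals `K` as soon as an admissible pair `a`, `b` exists.
  refine ⟨max K 0 * (1 + K ^ 2) * (M * (1 + 2 * max K 0)), by positivity,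
    fun a b hab f f₁ f₂ f₃ hf => ?_⟩
  rw [max_eq_left hab.nonneg]
  set J := ∫ x in (0 : ℝ)..2, (‖f x‖ + ‖a * f₃ x + b * f₁ x‖) with hJ
  have hJ0 : 0 ≤ J := intervalIntegral.integral_nonneg (by norm_num) fun x _ => by positivity
  have hK := hab.nonneg
  have hw : LocallyIntegrable fun x => (a : ℂ) * f₃ x + b * f₁ x :=
    (hf.prim₃.locallyIntegrable.smul (a : ℂ)).add
      (hf.prim₁.locallyIntegrable.smul (b : ℂ))
  have key : ∀ k, ‖bdForm a b ![f 0, f₁ 0, f₂ 0] fun j => if j = k then 1 else 0‖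
      ≤ M * (1 + 2 * K) * J := by
    intro k
    have hg := IsJet.of_contDiff (hψ k).1
    have h2 := (hf.isPrimitive_bdForm hg a b).sub_eq 0 2
    have hz : ∀ n, iteratedDeriv n (ψ k) 2 = 0 := fun n =>
      iteratedDeriv_eq_zero_of_notMem_tsupport (fun h => by
        have := (hψ k).2.2.1 h
        rw [Metric.mem_closedBall, Real.dist_eq] at this
        norm_num at this) n
    have hz0 : ψ k 2 = 0 := by simpa using hz 0
    have h3 : bdForm a b ![f 2, f₁ 2, f₂ 2]
        ![ψ k 2, iteratedDeriv 1 (ψ k) 2, iteratedDeriv 2 (ψ k) 2] = 0 := by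
      simp only [bdForm, Matrix.cons_val, hz, hz0, star_zero, mul_zero, sub_zero, add_zero]
    have h4 : (![ψ k 0, iteratedDeriv 1 (ψ k) 0, iteratedDeriv 2 (ψ k) 0] : Fin 3 → ℂ)
        = fun j => if j = k then 1 else 0 := by
      funext j
      rw [← (hψ k).2.2.2 j]
      fin_cases j <;> simp
    rw [h3, h4, zero_sub] at h2
    rw [← norm_neg, h2]
    refine (intervalIntegral.norm_integral_le_integral_norm (by norm_num)).trans ?_
    rw [hJ, ← intervalIntegral.integral_const_mul]
    have hwi : IntervalIntegrable (fun x => ‖(a : ℂ) * f₃ x + b * f₁ x‖) volume 0 2 :=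
      ((hw.integrableOn_isCompact isCompact_uIcc).intervalIntegrable).norm
    refine intervalIntegral.integral_mono_on (by norm_num)
      ((hf.isPrimitive_bdForm hg a b).intervalIntegrable 0 2).norm
      (((hf.prim₁.continuous.norm.intervalIntegrable 0 2).add hwi).const_mul _) fun x _ => ?_
    have b0 : ‖ψ k x‖ ≤ M := by simpa using hM 0 k x
    have b1 : ‖iteratedDeriv 1 (ψ k) x‖ ≤ M := hM 1 k x
    have b3 : ‖iteratedDeriv 3 (ψ k) x‖ ≤ M := hM 3 k x
    refine (norm_add_le _ _).trans ?_
    rw [norm_mul, norm_mul, norm_star, norm_star]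
    have h5 : ‖(a : ℂ) * iteratedDeriv 3 (ψ k) x + b * iteratedDeriv 1 (ψ k) x‖ ≤ 2 * K * M := by
      refine (norm_add_le _ _).trans ?_
      rw [norm_mul, norm_mul, Complex.norm_real, Complex.norm_real, Real.norm_of_nonneg hab.pos.le]
      have h6 := mul_le_mul hab.le b3 (norm_nonneg _) hK
      have h7 := mul_le_mul hab.abs_le b1 (norm_nonneg _) hK
      rw [Real.norm_eq_abs]
      linarith
    have h8 := mul_le_mul_of_nonneg_left b0 (norm_nonneg ((a : ℂ) * f₃ x + b * f₁ x))
    have h9 := mul_le_mul_of_nonneg_left h5 (norm_nonneg (f x))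
    have h10 : 0 ≤ M * K * ‖(a : ℂ) * f₃ x + b * f₁ x‖ := by positivity
    have h11 : 0 ≤ M * ‖f x‖ := by positivity
    nlinarith
  set S := M * (1 + 2 * K) * J with hS
  have hS0 : 0 ≤ S := by positivity
  -- Pairing with the three unit vectors gives, up to sign, `a f₂ + b f`, `a f₁` and `a f` at `0`;
  -- dividing by `a` costs a factor `K`.
  have k0 : ‖(a : ℂ) * f₂ 0 + b * f 0‖ ≤ S := by simpa [bdForm] using key 0
  have k1 : ‖(a : ℂ) * f₁ 0‖ ≤ S := by simpa [bdForm] using key 1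
  have k2 : ‖(a : ℂ) * f 0‖ ≤ S := by simpa [bdForm] using key 2
  have e0 := hab.norm_le_of_mul k2
  have e1 := hab.norm_le_of_mul k1
  have e2 : ‖f₂ 0‖ ≤ K * (S + K * (K * S)) := by
    refine hab.norm_le_of_mul ?_
    have h1 : (a : ℂ) * f₂ 0 = ((a : ℂ) * f₂ 0 + b * f 0) - b * f 0 := by ring
    rw [h1]
    refine (norm_sub_le _ _).trans (add_le_add k0 ?_)
    rw [norm_mul, Complex.norm_real, Real.norm_eq_abs]
    exact mul_le_mul hab.abs_le e0 (norm_nonneg _) hK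
  have h0 : K * (1 + K ^ 2) * (M * (1 + 2 * K)) * J = K * (S + K * (K * S)) := by
    rw [hS]; ring
  have h1 : K * S ≤ K * (S + K * (K * S)) :=
    mul_le_mul_of_nonneg_left (le_add_of_nonneg_right (by positivity)) hK
  intro k
  rw [h0]
  fin_cases k
  · exact e0.trans h1
  · exact e1.trans h1
  · exact e2

/-- Cauchy–Schwarz on an interval of length `2`, from nonnegativity of the variance of `h`. -/
theorem sq_integral_le {h : ℝ → ℝ} {r : ℝ} (h1 : IntervalIntegrable h volume r (r + 2))
    (h2 : IntervalIntegrable (fun x => h x ^ 2) volume r (r + 2)) :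
    (∫ x in r..(r + 2), h x) ^ 2 ≤ 2 * ∫ x in r..(r + 2), h x ^ 2 := by
  set m := (∫ x in r..(r + 2), h x) / 2 with hm
  have h3 : 0 ≤ ∫ x in r..(r + 2), (h x - m) ^ 2 :=
    intervalIntegral.integral_nonneg (by linarith) fun x _ => sq_nonneg _
  have h4 : (fun x => (h x - m) ^ 2) = fun x => (h x ^ 2 - 2 * m * h x) + m ^ 2 := by
    funext x; ring
  rw [h4, intervalIntegral.integral_add (h2.sub (h1.const_mul _)) (by simp),
    intervalIntegral.integral_sub h2 (h1.const_mul _), intervalIntegral.integral_const_mul,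
    intervalIntegral.integral_const] at h3
  simp only [add_sub_cancel_left, smul_eq_mul] at h3
  have h5 : (∫ x in r..(r + 2), h x) = 2 * m := by rw [hm]; ring
  rw [h5] at h3 ⊢
  nlinarith

theorem exists_sq_norm_le_integral (K : ℝ) : ∃ C : ℝ, 0 ≤ C ∧ ∀ a b, CoeffBound K a b →
    ∀ f f₁ f₂ f₃ : ℝ → ℂ, IsJet f f₁ f₂ f₃ → ∀ r : ℝ,
      IntervalIntegrable (fun x => ‖f x‖ ^ 2 + ‖a * f₃ x + b * f₁ x‖ ^ 2) volume r (r + 2) →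
      ∀ k : Fin 3, ‖(![f r, f₁ r, f₂ r] : Fin 3 → ℂ) k‖ ^ 2
        ≤ C * ∫ x in r..(r + 2), (‖f x‖ ^ 2 + ‖a * f₃ x + b * f₁ x‖ ^ 2) := by
  obtain ⟨C, hC0, hC⟩ := exists_norm_le_integral K
  -- One factor `2` is the length of the interval in Cauchy–Schwarz, the other comes from `(p + q)²
  -- ≤ 2 (p² + q²)`.
  refine ⟨4 * C ^ 2, by positivity, fun a b hab f f₁ f₂ f₃ hf r hi k => ?_⟩
  have h1 := hC a b hab _ _ _ _ (hf.comp_add r) k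
  simp only [zero_add] at h1
  rw [intervalIntegral.integral_comp_add_right (fun x => ‖f x‖ + ‖a * f₃ x + b * f₁ x‖), zero_add,
    add_comm 2 r] at h1
  have hw : LocallyIntegrable fun x => (a : ℂ) * f₃ x + b * f₁ x :=
    (hf.prim₃.locallyIntegrable.smul (a : ℂ)).add
      (hf.prim₁.locallyIntegrable.smul (b : ℂ))
  have hwi : IntervalIntegrable (fun x => ‖(a : ℂ) * f₃ x + b * f₁ x‖) volume r (r + 2) :=
    ((hw.integrableOn_isCompact isCompact_uIcc).intervalIntegrable).norm
  have hs : IntervalIntegrable (fun x => ‖f x‖ + ‖(a : ℂ) * f₃ x + b * f₁ x‖) volume r (r + 2) :=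
    (hf.prim₁.continuous.norm.intervalIntegrable _ _).add hwi
  have hle : ∀ x, (‖f x‖ + ‖(a : ℂ) * f₃ x + b * f₁ x‖) ^ 2
      ≤ 2 * (‖f x‖ ^ 2 + ‖(a : ℂ) * f₃ x + b * f₁ x‖ ^ 2) := fun x => by
    nlinarith [sq_nonneg (‖f x‖ - ‖(a : ℂ) * f₃ x + b * f₁ x‖)]
  have hs2 : IntervalIntegrable (fun x => (‖f x‖ + ‖(a : ℂ) * f₃ x + b * f₁ x‖) ^ 2) volume
      r (r + 2) := by
    refine (hi.const_mul 2).mono_fun ((hs.def').aestronglyMeasurable.pow 2) ?_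
    refine Eventually.of_forall fun x => ?_
    have h0 : (0 : ℝ) ≤ 2 * (‖f x‖ ^ 2 + ‖(a : ℂ) * f₃ x + b * f₁ x‖ ^ 2) := by positivity
    beta_reduce
    rw [Real.norm_of_nonneg (sq_nonneg _), Real.norm_of_nonneg h0]
    exact hle x
  have h2 := sq_integral_le hs hs2
  have h3 : ∫ x in r..(r + 2), (‖f x‖ + ‖(a : ℂ) * f₃ x + b * f₁ x‖) ^ 2
      ≤ ∫ x in r..(r + 2), 2 * (‖f x‖ ^ 2 + ‖(a : ℂ) * f₃ x + b * f₁ x‖ ^ 2) :=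
    intervalIntegral.integral_mono_on (by linarith) hs2 (hi.const_mul 2) fun x _ => hle x
  rw [intervalIntegral.integral_const_mul] at h3
  have h4 := pow_le_pow_left₀ (norm_nonneg _) h1 2
  rw [mul_pow] at h4
  refine h4.trans ?_
  have h5 := mul_le_mul_of_nonneg_left (h2.trans (mul_le_mul_of_nonneg_left h3 zero_le_two))
    (sq_nonneg C)
  linarith


/-! ### Green's formula on half-lines -/

section HalfLine

variable {f f₁ f₂ f₃ g g₁ g₂ g₃ : ℝ → ℂ} {a b : ℝ}

theorem integrableOn_sq_add_sq {μ : Measure ℝ} {f w : ℝ → ℂ} (hf : MemLp f 2 μ)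
    (hw : MemLp w 2 μ) : Integrable (fun x => ‖f x‖ ^ 2 + ‖w x‖ ^ 2) μ :=
  hf.norm.integrable_sq.add hw.norm.integrable_sq

/-- The squared jet at `r` is bounded by a multiple of an integral over `[r, r + 2]`, which tends to
zero for an integrable function. Hence Green's formula on a half-line has no boundary term at
infinity. -/
theorem IsJet.tendsto_atTop_zero (hf : IsJet f f₁ f₂ f₃) (ha : 0 < a)
    (hf2 : MemLp f 2 (volume.restrict (Ioi 0)))
    (hw2 : MemLp (fun x => a * f₃ x + b * f₁ x) 2 (volume.restrict (Ioi 0))) (k : Fin 3) :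
    Tendsto (fun r => (![f r, f₁ r, f₂ r] : Fin 3 → ℂ) k) atTop (𝓝 0) := by
  obtain ⟨C, hC0, hC⟩ := exists_sq_norm_le_integral (max a (max a⁻¹ |b|))
  have hab : CoeffBound (max a (max a⁻¹ |b|)) a b :=
    ⟨ha, le_max_left _ _, (le_max_left _ _).trans (le_max_right _ _),
      (le_max_right _ _).trans (le_max_right _ _)⟩
  have hi := integrableOn_sq_add_sq hf2 hw2
  set G := fun x => ‖f x‖ ^ 2 + ‖(a : ℂ) * f₃ x + b * f₁ x‖ ^ 2 with hG
  have hii : ∀ p q, 0 ≤ p → 0 ≤ q → IntervalIntegrable G volume p q := fun p q hp hq =>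
    ⟨IntegrableOn.mono_set hi fun x hx => hp.trans_lt hx.1,
      IntegrableOn.mono_set hi fun x hx => hq.trans_lt hx.1⟩
  have h1 := intervalIntegral_tendsto_integral_Ioi 0 hi tendsto_id
  have h2 : Tendsto (fun r : ℝ => C * ∫ x in r..(r + 2), G x) atTop (𝓝 0) := by
    have h3 := ((h1.comp (tendsto_atTop_add_const_right _ (2 : ℝ) tendsto_id)).sub h1).const_mul C
    rw [sub_self, mul_zero] at h3
    refine h3.congr' ?_
    filter_upwards [eventually_ge_atTop 0] with r hr
    simp only [Function.comp_apply, id]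
    rw [intervalIntegral.integral_interval_sub_left (hii _ _ le_rfl (by linarith))
      (hii _ _ le_rfl hr)]
  have h4 : Tendsto (fun r => ‖(![f r, f₁ r, f₂ r] : Fin 3 → ℂ) k‖ ^ 2) atTop (𝓝 0) := by
    refine squeeze_zero' (Eventually.of_forall fun _ => sq_nonneg _) ?_ h2
    filter_upwards [eventually_ge_atTop 0] with r hr
    exact hC a b hab _ _ _ _ hf r (hii _ _ hr (by linarith)) k
  rw [tendsto_zero_iff_norm_tendsto_zero]
  have h5 := (Real.continuous_sqrt.tendsto 0).comp h4
  rw [Real.sqrt_zero] at h5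
  exact h5.congr fun r => Real.sqrt_sq (norm_nonneg _)

theorem integrable_green {μ : Measure ℝ} {f w g z : ℝ → ℂ} (hf : MemLp f 2 μ) (hw : MemLp w 2 μ)
    (hg : MemLp g 2 μ) (hz : MemLp z 2 μ) :
    Integrable (fun x => w x * star (g x) + f x * star (z x)) μ :=
  (hw.integrable_mul hg.star).add (hf.integrable_mul hz.star)

theorem IsJet.integral_Ioi (hf : IsJet f f₁ f₂ f₃) (hg : IsJet g g₁ g₂ g₃) (ha : 0 < a)
    (hf2 : MemLp f 2 (volume.restrict (Ioi 0)))
    (hfw : MemLp (fun x => a * f₃ x + b * f₁ x) 2 (volume.restrict (Ioi 0)))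
    (hg2 : MemLp g 2 (volume.restrict (Ioi 0)))
    (hgw : MemLp (fun x => a * g₃ x + b * g₁ x) 2 (volume.restrict (Ioi 0))) :
    ∫ x in Ioi 0, ((a * f₃ x + b * f₁ x) * star (g x) + f x * star (a * g₃ x + b * g₁ x))
      = -bdForm a b ![f 0, f₁ 0, f₂ 0] ![g 0, g₁ 0, g₂ 0] := by
  have h1 := intervalIntegral_tendsto_integral_Ioi 0 (integrable_green hf2 hfw hg2 hgw) tendsto_id
  have hf0 := hf.tendsto_atTop_zero ha hf2 hfw
  have hg0 := hg.tendsto_atTop_zero ha hg2 hgw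
  have h2 : Tendsto (fun r => bdForm a b ![f r, f₁ r, f₂ r] ![g r, g₁ r, g₂ r]
      - bdForm a b ![f 0, f₁ 0, f₂ 0] ![g 0, g₁ 0, g₂ 0]) atTop
      (𝓝 (-bdForm a b ![f 0, f₁ 0, f₂ 0] ![g 0, g₁ 0, g₂ 0])) := by
    have hp : ∀ i j : Fin 3, Tendsto (fun r => (![f r, f₁ r, f₂ r] : Fin 3 → ℂ) i
        * star ((![g r, g₁ r, g₂ r] : Fin 3 → ℂ) j)) atTop (𝓝 0) := fun i j => by
      simpa using (hf0 i).mul (hg0 j).star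
    have h3 := (((((hp 2 0).sub (hp 1 1)).add (hp 0 2)).const_mul (a : ℂ)).add
      ((hp 0 0).const_mul (b : ℂ))).sub_const
      (bdForm a b ![f 0, f₁ 0, f₂ 0] ![g 0, g₁ 0, g₂ 0])
    simp only [sub_self, add_zero, mul_zero, zero_sub] at h3
    exact h3
  refine tendsto_nhds_unique h1 (h2.congr fun r => ?_)
  exact (hf.isPrimitive_bdForm hg a b).sub_eq 0 r

theorem memLp_comp_neg_Iio {f : ℝ → ℂ} (hf : MemLp f 2 (volume.restrict (Iio 0))) :
    MemLp (fun x => f (-x)) 2 (volume.restrict (Ioi 0)) := by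
  have h := (Measure.measurePreserving_neg (volume : Measure ℝ)).restrict_preimage
    (measurableSet_Iio (a := (0 : ℝ)))
  have h2 : Neg.neg ⁻¹' Iio (0 : ℝ) = Ioi 0 := by ext x; simp
  rw [h2] at h
  exact hf.comp_measurePreserving h

theorem integral_comp_neg_Ioi_zero (h : ℝ → ℂ) :
    ∫ x in Ioi (0 : ℝ), h (-x) = ∫ x in Iio 0, h x := by
  rw [integral_comp_neg_Ioi, neg_zero, integral_Iic_eq_integral_Iio]

/-- Reduction to `(0, ∞)` by reflection. Odd derivatives, and thus the whole differential
expression, change sign, while `bdForm` pairs first derivatives with each other and is unchanged. -/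
theorem IsJet.integral_Iio (hf : IsJet f f₁ f₂ f₃) (hg : IsJet g g₁ g₂ g₃) (ha : 0 < a)
    (hf2 : MemLp f 2 (volume.restrict (Iio 0)))
    (hfw : MemLp (fun x => a * f₃ x + b * f₁ x) 2 (volume.restrict (Iio 0)))
    (hg2 : MemLp g 2 (volume.restrict (Iio 0)))
    (hgw : MemLp (fun x => a * g₃ x + b * g₁ x) 2 (volume.restrict (Iio 0))) :
    ∫ x in Iio 0, ((a * f₃ x + b * f₁ x) * star (g x) + f x * star (a * g₃ x + b * g₁ x))
      = bdForm a b ![f 0, f₁ 0, f₂ 0] ![g 0, g₁ 0, g₂ 0] := by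
  have e : ∀ {f₁ f₃ : ℝ → ℂ}, (fun x => (a : ℂ) * -f₃ (-x) + b * -f₁ (-x))
      = -fun x => (fun y => (a : ℂ) * f₃ y + b * f₁ y) (-x) := by
    intro f₁ f₃
    funext x
    simp only [Pi.neg_apply]
    ring
  have h := hf.comp_neg.integral_Ioi hg.comp_neg ha (b := b) (memLp_comp_neg_Iio hf2)
    (by rw [e]; exact (memLp_comp_neg_Iio hfw).neg) (memLp_comp_neg_Iio hg2)
    (by rw [e]; exact (memLp_comp_neg_Iio hgw).neg)
  rw [← integral_comp_neg_Ioi_zero]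
  have h1 : ∀ x, ((a : ℂ) * -f₃ (-x) + b * -f₁ (-x)) * star (g (-x))
      + f (-x) * star ((a : ℂ) * -g₃ (-x) + b * -g₁ (-x))
      = -((a * f₃ (-x) + b * f₁ (-x)) * star (g (-x))
        + f (-x) * star (a * g₃ (-x) + b * g₁ (-x))) := by
    intro x
    simp only [star_add, star_mul', star_neg]
    ring
  simp only [h1, integral_neg, neg_zero] at h
  rw [neg_inj] at h
  rw [h]
  simp [bdForm]

theorem exists_sq_norm_le_Ioi (K : ℝ) : ∃ C : ℝ, 0 ≤ C ∧ ∀ a b, CoeffBound K a b →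
    ∀ f f₁ f₂ f₃ : ℝ → ℂ, IsJet f f₁ f₂ f₃ →
      MemLp f 2 (volume.restrict (Ioi 0)) →
      MemLp (fun x => a * f₃ x + b * f₁ x) 2 (volume.restrict (Ioi 0)) →
      ∀ k : Fin 3, ‖(![f 0, f₁ 0, f₂ 0] : Fin 3 → ℂ) k‖ ^ 2
        ≤ C * ∫ x in Ioi 0, (‖f x‖ ^ 2 + ‖a * f₃ x + b * f₁ x‖ ^ 2) := by
  obtain ⟨C, hC0, hC⟩ := exists_sq_norm_le_integral K
  refine ⟨C, hC0, fun a b hab f f₁ f₂ f₃ hf hf2 hw2 k => ?_⟩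
  have hi := integrableOn_sq_add_sq hf2 hw2
  have hi2 : IntegrableOn (fun x => ‖f x‖ ^ 2 + ‖(a : ℂ) * f₃ x + b * f₁ x‖ ^ 2) (Ioc 0 (0 + 2)) :=
    IntegrableOn.mono_set hi fun x hx => hx.1
  have hi3 : IntervalIntegrable (fun x => ‖f x‖ ^ 2 + ‖(a : ℂ) * f₃ x + b * f₁ x‖ ^ 2) volume
      0 (0 + 2) := (intervalIntegrable_iff_integrableOn_Ioc_of_le (by norm_num)).2 hi2
  refine (hC a b hab f f₁ f₂ f₃ hf 0 hi3 k).trans (mul_le_mul_of_nonneg_left ?_ hC0)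
  rw [intervalIntegral.integral_of_le (by norm_num)]
  exact setIntegral_mono_set hi (Eventually.of_forall fun x => by positivity)
    (Eventually.of_forall fun x hx => hx.1)

theorem exists_sq_norm_le_Iio (K : ℝ) : ∃ C : ℝ, 0 ≤ C ∧ ∀ a b, CoeffBound K a b →
    ∀ f f₁ f₂ f₃ : ℝ → ℂ, IsJet f f₁ f₂ f₃ →
      MemLp f 2 (volume.restrict (Iio 0)) →
      MemLp (fun x => a * f₃ x + b * f₁ x) 2 (volume.restrict (Iio 0)) →
      ∀ k : Fin 3, ‖(![f 0, f₁ 0, f₂ 0] : Fin 3 → ℂ) k‖ ^ 2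
        ≤ C * ∫ x in Iio 0, (‖f x‖ ^ 2 + ‖a * f₃ x + b * f₁ x‖ ^ 2) := by
  obtain ⟨C, hC0, hC⟩ := exists_sq_norm_le_Ioi K
  refine ⟨C, hC0, fun a b hab f f₁ f₂ f₃ hf hf2 hw2 k => ?_⟩
  have e : (fun x => (a : ℂ) * -f₃ (-x) + b * -f₁ (-x))
      = -fun x => (fun y => (a : ℂ) * f₃ y + b * f₁ y) (-x) := by
    funext x
    simp only [Pi.neg_apply]
    ring
  have h := hC a b hab _ _ _ _ hf.comp_neg (memLp_comp_neg_Iio hf2)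
    (by rw [e]; exact (memLp_comp_neg_Iio hw2).neg) k
  have h1 : ∀ x, ‖(a : ℂ) * -f₃ (-x) + b * -f₁ (-x)‖ = ‖(a : ℂ) * f₃ (-x) + b * f₁ (-x)‖ := by
    intro x
    rw [← norm_neg]
    congr 1
    ring
  simp only [h1, neg_zero] at h
  have h2 := integral_comp_neg_Ioi (0 : ℝ) (fun x => ‖f x‖ ^ 2 + ‖(a : ℂ) * f₃ x + b * f₁ x‖ ^ 2)
  rw [neg_zero, integral_Iic_eq_integral_Iio] at h2
  rw [h2] at h
  refine le_trans (le_of_eq ?_) h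
  fin_cases k <;> simp

end HalfLine

/-! ### The maximal operator on a single edge -/

/-- `u ∈ H³(I)` with `w = a u''' + b u'` and boundary values `t` at `0`. -/
def EdgeSol (I : TopologicalSpace.Opens ℝ) (a b : ℝ) (u w : L2On I) (t : Fin 3 → ℂ) : Prop :=
  ∃ f f₁ f₂ f₃ : ℝ → ℂ, IsJet f f₁ f₂ f₃ ∧ (u =ᵐ[volume.restrict (I : Set ℝ)] f) ∧
    (w =ᵐ[volume.restrict (I : Set ℝ)] fun x => a * f₃ x + b * f₁ x) ∧ t = ![f 0, f₁ 0, f₂ 0]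

namespace EdgeSol

variable {I : TopologicalSpace.Opens ℝ} {a b : ℝ} {u w v z : L2On I} {t s : Fin 3 → ℂ}

theorem add (hu : EdgeSol I a b u w t) (hv : EdgeSol I a b v z s) :
    EdgeSol I a b (u + v) (w + z) (t + s) := by
  obtain ⟨f, f₁, f₂, f₃, hf, h1, h2, rfl⟩ := hu
  obtain ⟨g, g₁, g₂, g₃, hg, k1, k2, rfl⟩ := hv
  refine ⟨_, _, _, _, hf.add hg, ?_, ?_, ?_⟩
  · filter_upwards [Lp.coeFn_add u v, h1, k1] with x e1 e2 e3
    rw [e1, Pi.add_apply, e2, e3, Pi.add_apply]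
  · filter_upwards [Lp.coeFn_add w z, h2, k2] with x e1 e2 e3
    rw [e1, Pi.add_apply, e2, e3, Pi.add_apply, Pi.add_apply]
    ring
  · funext k
    fin_cases k <;> simp

theorem smul (hu : EdgeSol I a b u w t) (r : ℂ) : EdgeSol I a b (r • u) (r • w) (r • t) := by
  obtain ⟨f, f₁, f₂, f₃, hf, h1, h2, rfl⟩ := hu
  refine ⟨_, _, _, _, hf.const_mul r, ?_, ?_, ?_⟩
  · filter_upwards [Lp.coeFn_smul r u, h1] with x e1 e2
    rw [e1, Pi.smul_apply, e2, smul_eq_mul]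
  · filter_upwards [Lp.coeFn_smul r w, h2] with x e1 e2
    rw [e1, Pi.smul_apply, e2, smul_eq_mul]
    ring
  · funext k
    fin_cases k <;> simp

/-- The coefficients are real, so taking real parts commutes with the differential expression. -/
theorem re (hu : EdgeSol I a b u w t) :
    EdgeSol I a b (reL2 u) (reL2 w) (fun k => reC (t k)) := by
  obtain ⟨f, f₁, f₂, f₃, hf, h1, h2, rfl⟩ := hu
  refine ⟨_, _, _, _, hf.clm_comp reC, ?_, ?_, ?_⟩
  · filter_upwards [reC.coeFn_compLp u, h1] with x e1 e2
    rw [reL2, e1, e2]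
  · filter_upwards [reC.coeFn_compLp w, h2] with x e1 e2
    rw [reL2, e1, e2]
    apply Complex.ext <;> simp [reC]
  · funext k
    fin_cases k <;> simp

theorem hasBoundaryValues (hu : EdgeSol I a b u w t) : HasBoundaryValues I u t := by
  obtain ⟨f, f₁, f₂, f₃, hf, h1, -, rfl⟩ := hu
  have d1 : deriv f = f₁ := funext fun x => (hf.hasDerivAt₁ x).deriv
  have d2 : deriv f₁ = f₂ := funext fun x => (hf.hasDerivAt₂ x).deriv
  have c1 : ContDiff ℝ 1 f₁ := contDiff_one_iff_deriv.2
    ⟨fun x => (hf.hasDerivAt₂ x).differentiableAt, by rw [d2]; exact hf.prim₃.continuous⟩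
  have c2 : ContDiff ℝ 2 f := by
    rw [show (2 : WithTop ℕ∞) = 1 + 1 by norm_num, contDiff_succ_iff_deriv]
    exact ⟨fun x => (hf.hasDerivAt₁ x).differentiableAt, by simp, by rwa [d1]⟩
  refine ⟨f, c2.contDiffOn, h1, fun k => ?_⟩
  fin_cases k
  · simpa using hf.prim₁.continuous.continuousAt.continuousWithinAt.tendsto
  · simpa [iteratedDeriv_one, d1] using
      hf.prim₂.continuous.continuousAt.continuousWithinAt.tendsto
  · simpa [iteratedDeriv_succ, iteratedDeriv_one, d1, d2] using
      hf.prim₃.continuous.continuousAt.continuousWithinAt.tendsto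

theorem of_testFunction (h0 : (0 : ℝ) ∉ I) (φ : 𝓓(I, ℂ))
    (hu : u =ᵐ[volume.restrict (I : Set ℝ)] φ)
    (hw : w =ᵐ[volume.restrict (I : Set ℝ)] airyExpr a b φ) : EdgeSol I a b u w 0 := by
  have hφ0 : (0 : ℝ) ∉ tsupport φ := fun h => h0 (φ.tsupport_subset h)
  refine ⟨_, _, _, _, IsJet.of_contDiff φ.contDiff, hu, ?_, ?_⟩
  · filter_upwards [hw] with x hx
    rw [hx, airyExpr, iteratedDeriv_one]
  · funext k
    fin_cases k
    · simpa using (image_eq_zero_of_notMem_tsupport hφ0).symm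
    · simpa using (iteratedDeriv_eq_zero_of_notMem_tsupport hφ0 1).symm
    · simpa using (iteratedDeriv_eq_zero_of_notMem_tsupport hφ0 2).symm

end EdgeSol

/-- Two continuous representatives agree on the open set `I`, hence so do their derivatives there
and the limits at `0`. -/
theorem HasBoundaryValues.unique {I : TopologicalSpace.Opens ℝ} [(𝓝[(I : Set ℝ)] 0).NeBot]
    {u : L2On I} {t s : Fin 3 → ℂ} (ht : HasBoundaryValues I u t) (hs : HasBoundaryValues I u s) :
    t = s := by
  obtain ⟨f, hf, huf, hft⟩ := ht
  obtain ⟨g, hg, hug, hgs⟩ := hs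
  have hfg : EqOn f g (I : Set ℝ) :=
    Measure.eqOn_open_of_ae_eq (huf.symm.trans hug) I.isOpen hf.continuousOn hg.continuousOn
  funext k
  refine tendsto_nhds_unique (hft k) ((hgs k).congr' ?_)
  filter_upwards [self_mem_nhdsWithin] with x hx
  exact (hfg.iteratedDeriv_of_isOpen I.isOpen k hx).symm

theorem zero_notMem_halfLine {Em Ep : Type*} (e : Em ⊕ Ep) : (0 : ℝ) ∉ halfLine e := by
  cases e <;> exact lt_irrefl (0 : ℝ)

instance halfLine_neBot {Em Ep : Type*} (e : Em ⊕ Ep) :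
    (𝓝[(halfLine e : Set ℝ)] (0 : ℝ)).NeBot := by
  cases e
  · exact nhdsLT_neBot 0
  · exact nhdsGT_neBot 0

/-! ### Green's formula and boundary values on one edge -/

section Green

variable {Em Ep : Type*} {a b : ℝ} {t s : Fin 3 → ℂ}

theorem inner_add_inner_eq_integral {I : TopologicalSpace.Opens ℝ} {u w v z : L2On I}
    {f f' g g' : ℝ → ℂ} (hu : u =ᵐ[volume.restrict (I : Set ℝ)] f)
    (hw : w =ᵐ[volume.restrict (I : Set ℝ)] f') (hv : v =ᵐ[volume.restrict (I : Set ℝ)] g)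
    (hz : z =ᵐ[volume.restrict (I : Set ℝ)] g') :
    inner ℂ v w + inner ℂ z u = ∫ x in (I : Set ℝ), (f' x * star (g x) + f x * star (g' x)) := by
  rw [L2.inner_def, L2.inner_def, ← integral_add (L2.integrable_inner v w)
    (L2.integrable_inner z u)]
  refine integral_congr_ae ?_
  filter_upwards [hu, hw, hv, hz] with x h1 h2 h3 h4
  rw [h1, h2, h3, h4, RCLike.inner_apply, RCLike.inner_apply]
  rfl

theorem EdgeSol.green_inr {e : Ep} {u w v z : L2On (halfLine (Sum.inr e : Em ⊕ Ep))} (ha : 0 < a)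
    (hu : EdgeSol _ a b u w t) (hv : EdgeSol _ a b v z s) :
    inner ℂ v w + inner ℂ z u = -bdForm a b t s := by
  obtain ⟨f, f₁, f₂, f₃, hf, h1, h2, rfl⟩ := hu
  obtain ⟨g, g₁, g₂, g₃, hg, k1, k2, rfl⟩ := hv
  rw [inner_add_inner_eq_integral h1 h2 k1 k2]
  exact hf.integral_Ioi hg ha ((memLp_congr_ae h1).1 (Lp.memLp u))
    ((memLp_congr_ae h2).1 (Lp.memLp w)) ((memLp_congr_ae k1).1 (Lp.memLp v))
    ((memLp_congr_ae k2).1 (Lp.memLp z))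

theorem EdgeSol.green_inl {e : Em} {u w v z : L2On (halfLine (Sum.inl e : Em ⊕ Ep))} (ha : 0 < a)
    (hu : EdgeSol _ a b u w t) (hv : EdgeSol _ a b v z s) :
    inner ℂ v w + inner ℂ z u = bdForm a b t s := by
  obtain ⟨f, f₁, f₂, f₃, hf, h1, h2, rfl⟩ := hu
  obtain ⟨g, g₁, g₂, g₃, hg, k1, k2, rfl⟩ := hv
  rw [inner_add_inner_eq_integral h1 h2 k1 k2]
  exact hf.integral_Iio hg ha ((memLp_congr_ae h1).1 (Lp.memLp u))
    ((memLp_congr_ae h2).1 (Lp.memLp w)) ((memLp_congr_ae k1).1 (Lp.memLp v))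
    ((memLp_congr_ae k2).1 (Lp.memLp z))

theorem integral_sq_add_sq {I : TopologicalSpace.Opens ℝ} {u w : L2On I} {f f' : ℝ → ℂ}
    (hu : u =ᵐ[volume.restrict (I : Set ℝ)] f) (hw : w =ᵐ[volume.restrict (I : Set ℝ)] f') :
    ∫ x in (I : Set ℝ), (‖f x‖ ^ 2 + ‖f' x‖ ^ 2) = ‖u‖ ^ 2 + ‖w‖ ^ 2 := by
  have key : ∀ u : L2On I, ‖u‖ ^ 2 = ∫ x in (I : Set ℝ), ‖u x‖ ^ 2 := by
    intro u
    have h := inner_self_eq_norm_sq (𝕜 := ℂ) u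
    rw [← h, L2.inner_def]
    simp only [inner_self_eq_norm_sq_to_K]
    have h2 : ∀ x, ((‖u x‖ : ℂ)) ^ 2 = ((‖u x‖ ^ 2 : ℝ) : ℂ) := fun x => by push_cast; rfl
    simp only [Complex.coe_algebraMap, h2]
    rw [integral_complex_ofReal]
    rfl
  rw [key u, key w, ← integral_add (Lp.memLp u).norm.integrable_sq (Lp.memLp w).norm.integrable_sq]
  refine integral_congr_ae ?_
  filter_upwards [hu, hw] with x h1 h2
  rw [h1, h2]

theorem EdgeSol.exists_bound (K : ℝ) : ∃ C : ℝ, 0 ≤ C ∧ ∀ a b, CoeffBound K a b →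
    ∀ (e : Em ⊕ Ep) (u w : L2On (halfLine e)) (t : Fin 3 → ℂ), EdgeSol (halfLine e) a b u w t →
      ∀ k, ‖t k‖ ^ 2 ≤ C * (‖u‖ ^ 2 + ‖w‖ ^ 2) := by
  obtain ⟨C, hC0, hC⟩ := exists_sq_norm_le_Ioi K
  obtain ⟨D, hD0, hD⟩ := exists_sq_norm_le_Iio K
  refine ⟨max C D, le_max_of_le_left hC0, fun a b hab e u w t ht k => ?_⟩
  obtain ⟨f, f₁, f₂, f₃, hf, h1, h2, rfl⟩ := ht
  rw [← integral_sq_add_sq h1 h2]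
  have hf2 := (memLp_congr_ae h1).1 (Lp.memLp u)
  have hw2 := (memLp_congr_ae h2).1 (Lp.memLp w)
  rcases e with e | e
  · refine (hD a b hab f f₁ f₂ f₃ hf hf2 hw2 k).trans
      (mul_le_mul_of_nonneg_right (le_max_right _ _) (integral_nonneg fun x => by positivity))
  · refine (hC a b hab f f₁ f₂ f₃ hf hf2 hw2 k).trans
      (mul_le_mul_of_nonneg_right (le_max_left _ _) (integral_nonneg fun x => by positivity))

end Green

theorem ContDiff.memLp_iteratedDeriv {ψ : ℝ → ℂ} (h : ContDiff ℝ ∞ ψ) (hc : HasCompactSupport ψ)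
    (n : ℕ) (I : Set ℝ) : MemLp (iteratedDeriv n ψ) 2 (volume.restrict I) := by
  refine MemLp.restrict _ ?_
  refine (h.continuous_iteratedDeriv n (by exact_mod_cast le_top)).memLp_of_hasCompactSupport ?_
  refine hc.mono' fun x hx => ?_
  by_contra hcon
  exact hx (iteratedDeriv_eq_zero_of_notMem_tsupport hcon _)

/-- The solution is the combination, with coefficients `t k`, of the restrictions of the functions
of `exists_smooth_dual`. The norms of these restrictions are bounded by norms over the line, so `C`
serves all edges. -/
theorem EdgeSol.exists_of_boundaryValues {Em Ep : Type*} (K : ℝ) :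
    ∃ C : ℝ, 0 ≤ C ∧ ∀ a b, CoeffBound K a b → ∀ (e : Em ⊕ Ep) (t : Fin 3 → ℂ),
      ∃ u w : L2On (halfLine e), EdgeSol (halfLine e) a b u w t ∧
        ‖u‖ ≤ C * ∑ k, ‖t k‖ ∧ ‖w‖ ≤ C * ∑ k, ‖t k‖ := by
  obtain ⟨ψ, hψ⟩ := exists_smooth_dual
  obtain ⟨V, hVψ, hV⟩ : ∃ V : ℕ → (e : Em ⊕ Ep) → Fin 3 → L2On (halfLine e),
      (∀ n e k, V n e k =ᵐ[volume.restrict (halfLine e : Set ℝ)] iteratedDeriv n (ψ k)) ∧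
      ∀ n k, ∃ C : ℝ, 0 ≤ C ∧ ∀ e, ‖V n e k‖ ≤ C := by
    refine ⟨fun n e k => (ContDiff.memLp_iteratedDeriv (hψ k).1 (hψ k).2.1 n (halfLine e)).toLp _,
      fun n e k => MemLp.coeFn_toLp _, fun n k => ?_⟩
    have h := ContDiff.memLp_iteratedDeriv (hψ k).1 (hψ k).2.1 n univ
    rw [Measure.restrict_univ] at h
    refine ⟨(eLpNorm (iteratedDeriv n (ψ k)) 2 volume).toReal, ENNReal.toReal_nonneg, fun e => ?_⟩
    rw [Lp.norm_toLp]
    exact ENNReal.toReal_mono h.2.ne (eLpNorm_mono_measure _ Measure.restrict_le_self)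
  choose D hD0 hD using hV
  set M := ∑ n ∈ Finset.range 4, ∑ k, D n k with hM
  have hDM : ∀ n < 4, ∀ k, D n k ≤ M := fun n hn k =>
    (Finset.single_le_sum (f := fun k => D n k) (fun _ _ => hD0 _ _) (Finset.mem_univ k)).trans
      (Finset.single_le_sum (f := fun n => ∑ k, D n k)
        (fun _ _ => Finset.sum_nonneg fun _ _ => hD0 _ _) (Finset.mem_range.2 hn))
  have hM0 : 0 ≤ M := (hD0 0 0).trans (hDM 0 (by norm_num) 0)
  refine ⟨M * (1 + 2 * max K 0), by positivity, fun a b hab e t => ?_⟩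
  rw [max_eq_left hab.nonneg]
  have hK := hab.nonneg
  have hsol : ∀ k, EdgeSol (halfLine e) a b (V 0 e k) ((a : ℂ) • V 3 e k + (b : ℂ) • V 1 e k)
      (fun j => if j = k then 1 else 0) := by
    intro k
    refine ⟨_, _, _, _, IsJet.of_contDiff (hψ k).1, ?_, ?_, ?_⟩
    · filter_upwards [hVψ 0 e k] with x hx
      rw [hx, iteratedDeriv_zero]
    · filter_upwards [hVψ 3 e k, hVψ 1 e k, Lp.coeFn_add ((a : ℂ) • V 3 e k) ((b : ℂ) • V 1 e k),
        Lp.coeFn_smul (a : ℂ) (V 3 e k), Lp.coeFn_smul (b : ℂ) (V 1 e k)] with x h3 h1 e1 e2 e3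
      rw [e1, Pi.add_apply, e2, e3, Pi.smul_apply, Pi.smul_apply, h3, h1]
      rfl
    · funext j
      rw [← (hψ k).2.2.2 j]
      fin_cases j <;> simp
  have h := (((hsol 0).smul (t 0)).add ((hsol 1).smul (t 1))).add ((hsol 2).smul (t 2))
  have ht : t 0 • (fun j : Fin 3 => if j = 0 then (1 : ℂ) else 0)
      + t 1 • (fun j : Fin 3 => if j = 1 then (1 : ℂ) else 0)
      + t 2 • (fun j : Fin 3 => if j = 2 then (1 : ℂ) else 0) = t := by
    funext j
    fin_cases j <;> simp
  rw [ht] at h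
  have hnorm : ∀ (x : Fin 3 → L2On (halfLine e)) (B : ℝ), (∀ k, ‖x k‖ ≤ B) →
      ‖t 0 • x 0 + t 1 • x 1 + t 2 • x 2‖ ≤ B * ∑ k, ‖t k‖ := by
    intro x B hB
    refine (norm_add₃_le).trans ?_
    rw [norm_smul, norm_smul, norm_smul, Fin.sum_univ_three]
    have := fun k => mul_le_mul_of_nonneg_left (hB k) (norm_nonneg (t k))
    linarith [this 0, this 1, this 2]
  have hM1 : M ≤ M * (1 + 2 * K) := by nlinarith [mul_nonneg hM0 hK]
  refine ⟨_, _, h, hnorm (V 0 e) _ fun k => ?_, 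
    hnorm (fun k => (a : ℂ) • V 3 e k + (b : ℂ) • V 1 e k) _ fun k => ?_⟩
  · exact ((hD 0 k e).trans (hDM _ (by norm_num) _)).trans hM1
  · refine (norm_add_le _ _).trans ?_
    rw [norm_smul, norm_smul, Complex.norm_real, Complex.norm_real, Real.norm_eq_abs,
      Real.norm_eq_abs, abs_of_pos hab.pos]
    have h1 := mul_le_mul hab.le ((hD 3 k e).trans (hDM _ (by norm_num) _)) (norm_nonneg _) hK
    have h2 := mul_le_mul hab.abs_le ((hD 1 k e).trans (hDM _ (by norm_num) _)) (norm_nonneg _) hK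
    have h3 : a * ‖V 3 e k‖ + |b| * ‖V 1 e k‖ ≤ K * M + K * M := add_le_add h1 h2
    refine h3.trans ?_
    nlinarith [mul_nonneg hM0 hK]


/-! ### Regularity of weak solutions -/

theorem ordConnected_halfLine {Em Ep : Type*} (e : Em ⊕ Ep) :
    (halfLine e : Set ℝ).OrdConnected := by
  cases e
  · exact ordConnected_Iio
  · exact ordConnected_Ioi

theorem halfLine_nonempty {Em Ep : Type*} (e : Em ⊕ Ep) : (halfLine e : Set ℝ).Nonempty := by
  cases e
  · exact nonempty_Iio
  · exact nonempty_Ioi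

theorem mem_halfLine_of_mem_uIoc {Em Ep : Type*} (e : Em ⊕ Ep) {x t : ℝ} (hx : x ∈ halfLine e)
    (ht : t ∈ uIoc 0 x) (h0 : t ≠ 0) : t ∈ halfLine e := by
  rcases e with e | e
  · have hx' : x < 0 := hx
    rw [uIoc_of_ge hx'.le] at ht
    exact lt_of_le_of_ne ht.2 h0
  · have hx' : 0 < x := hx
    rw [uIoc_of_le hx'.le] at ht
    exact ht.1

theorem integral_zero_congr_of_ae_eq {Em Ep : Type*} (e : Em ⊕ Ep) {f g : ℝ → ℂ}
    (h : ∀ᵐ x : ℝ, x ∈ (halfLine e : Set ℝ) → f x = g x) {x : ℝ} (hx : x ∈ halfLine e) :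
    ∫ t in (0 : ℝ)..x, f t = ∫ t in (0 : ℝ)..x, g t := by
  refine intervalIntegral.integral_congr_ae ?_
  have h0 : ∀ᵐ t : ℝ, t ≠ 0 := by simp [ae_iff, measure_singleton]
  filter_upwards [h, h0] with t ht ht0 htx
  exact ht (mem_halfLine_of_mem_uIoc e hx htx ht0)

theorem L2On.locallyIntegrable_indicator {I : TopologicalSpace.Opens ℝ} (u : L2On I) :
    LocallyIntegrable (indicator (I : Set ℝ) (u : ℝ → ℂ)) volume :=
  ((memLp_indicator_iff_restrict I.isOpen.measurableSet).2 (Lp.memLp u)).locallyIntegrable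
    (by norm_num)

/-- Weakly `a u''' = w - b u'`. Subtracting from `u` an explicit solution, built from iterated
integrals of `w` and `u` extended by zero, leaves a function with vanishing third distributional
derivative, hence a quadratic polynomial. -/
theorem EdgeSol.of_weak {Em Ep : Type*} (e : Em ⊕ Ep) {a b : ℝ} (ha : 0 < a)
    (u w : L2On (halfLine e))
    (h : ∀ φ, IsTestFn (halfLine e : Set ℝ) φ →
      (∫ x in (halfLine e : Set ℝ),
        ((a * deriv (deriv (deriv φ)) x + b * deriv φ x : ℝ) : ℂ) * u x)
        + ∫ x in (halfLine e : Set ℝ), (φ x : ℂ) * w x = 0) :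
    ∃ t, EdgeSol (halfLine e) a b u w t := by
  set I : Set ℝ := (halfLine e : Set ℝ) with hI
  have hIm : MeasurableSet I := (halfLine e).isOpen.measurableSet
  have ha' : (a : ℂ) ≠ 0 := by exact_mod_cast ha.ne'
  set U := indicator I (u : ℝ → ℂ) with hU
  set W := indicator I (w : ℝ → ℂ) with hW
  have hUl : LocallyIntegrable U := L2On.locallyIntegrable_indicator u
  have hWl : LocallyIntegrable W := L2On.locallyIntegrable_indicator w
  have pW1 := IsPrimitive.of_integral hWl 0
  set W1 := fun x => ∫ t in (0 : ℝ)..x, W t with hW1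
  have pW2 := IsPrimitive.of_integral pW1.continuous.locallyIntegrable 0
  set W2 := fun x => ∫ t in (0 : ℝ)..x, W1 t with hW2
  have pW3 := IsPrimitive.of_integral pW2.continuous.locallyIntegrable 0
  set W3 := fun x => ∫ t in (0 : ℝ)..x, W2 t with hW3
  have pU1 := IsPrimitive.of_integral hUl 0
  set U1 := fun x => ∫ t in (0 : ℝ)..x, U t with hU1
  have pU2 := IsPrimitive.of_integral pU1.continuous.locallyIntegrable 0
  set U2 := fun x => ∫ t in (0 : ℝ)..x, U1 t with hU2
  -- The candidate `a⁻¹ (W3 - b U2)`: its third derivative is formally `a⁻¹ (W - b U')`.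
  have hV := (pW3.add (pU2.const_mul (-b))).const_mul (a : ℂ)⁻¹
  obtain ⟨c₀, c₁, c₂, hquad⟩ := ae_eq_quadratic (halfLine e).isOpen (halfLine_nonempty e)
    (ordConnected_halfLine e)
    (h := fun x => U x - (a : ℂ)⁻¹ * (W3 + fun x => -(b : ℂ) * U2 x) x)
    (hUl.sub hV.continuous.locallyIntegrable) (fun φ hφ => by
      have e1 : ∫ x, ((deriv (deriv (deriv φ)) x : ℝ) : ℂ) * W3 x = -∫ x, (φ x : ℂ) * W x := by
        rw [hφ.deriv.deriv.integral_deriv_mul pW3, hφ.deriv.integral_deriv_mul pW2,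
          hφ.integral_deriv_mul pW1, neg_neg]
      have e2 : ∫ x, ((deriv (deriv (deriv φ)) x : ℝ) : ℂ) * U2 x
          = ∫ x, ((deriv φ x : ℝ) : ℂ) * U x := by
        rw [hφ.deriv.deriv.integral_deriv_mul pU2, hφ.deriv.integral_deriv_mul pU1, neg_neg]
      have e3 : ∀ ψ : ℝ → ℝ, ∀ v : L2On (halfLine e), (∫ x in I, (ψ x : ℂ) * v x)
          = ∫ x, (ψ x : ℂ) * indicator I (v : ℝ → ℂ) x := by
        intro ψ v
        rw [← integral_indicator hIm]
        congr 1
        funext x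
        by_cases hx : x ∈ I <;> simp [hx]
      have i1 := hφ.deriv.deriv.deriv.integrable_mul hUl
      have i2 := hφ.deriv.deriv.deriv.integrable_mul pW3.continuous.locallyIntegrable
      have i3 := hφ.deriv.deriv.deriv.integrable_mul pU2.continuous.locallyIntegrable
      have i4 := hφ.deriv.integrable_mul hUl
      have e4 := h φ hφ
      rw [e3, e3] at e4
      have e5 : ∫ x, ((a * deriv (deriv (deriv φ)) x + b * deriv φ x : ℝ) : ℂ) * U x
          = a * (∫ x, ((deriv (deriv (deriv φ)) x : ℝ) : ℂ) * U x)
            + b * ∫ x, ((deriv φ x : ℝ) : ℂ) * U x := by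
        rw [← integral_const_mul, ← integral_const_mul, ← integral_add (i1.const_mul _)
          (i4.const_mul _)]
        congr 1
        funext x
        push_cast
        ring
      rw [e5] at e4
      have e6 : ∫ x, ((deriv (deriv (deriv φ)) x : ℝ) : ℂ)
          * (U x - (a : ℂ)⁻¹ * (W3 + fun x => -(b : ℂ) * U2 x) x)
          = (∫ x, ((deriv (deriv (deriv φ)) x : ℝ) : ℂ) * U x)
            - ((a : ℂ)⁻¹ * (∫ x, ((deriv (deriv (deriv φ)) x : ℝ) : ℂ) * W3 x)
              - (a : ℂ)⁻¹ * b * ∫ x, ((deriv (deriv (deriv φ)) x : ℝ) : ℂ) * U2 x) := by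
        have i5 : Integrable fun x => (a : ℂ)⁻¹ * (((deriv (deriv (deriv φ)) x : ℝ) : ℂ) * W3 x)
            - (a : ℂ)⁻¹ * b * (((deriv (deriv (deriv φ)) x : ℝ) : ℂ) * U2 x) :=
          (i2.const_mul _).sub (i3.const_mul _)
        rw [← integral_const_mul, ← integral_const_mul, ← integral_sub (i2.const_mul _)
          (i3.const_mul _), ← integral_sub i1 i5]
        congr 1
        funext x
        simp only [Pi.add_apply]
        ring
      rw [e6, e1, e2]
      have e7 := congrArg (fun y => (a : ℂ)⁻¹ * y) e4
      simp only [mul_add, mul_zero, inv_mul_cancel_left₀ ha'] at e7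
      linear_combination e7)
  -- the continuous representative, first in terms of `U`, then in terms of itself
  have pq := (((isPrimitive_sq_half.const_mul c₂).add (isPrimitive_id.const_mul c₁)).add
    (IsPrimitive.const c₀))
  have pq1 := ((isPrimitive_id.const_mul c₂).add (IsPrimitive.const c₁))
  have pq2 := IsPrimitive.const c₂
  have pf := hV.add pq
  set F := ((fun x => (a : ℂ)⁻¹ * (W3 + fun x => -(b : ℂ) * U2 x) x)
    + (((fun x : ℝ => c₂ * ((x : ℂ) ^ 2 / 2)) + fun x : ℝ => c₁ * (x : ℂ)) + fun _ => c₀)) with hF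
  have hUF : ∀ᵐ x : ℝ, x ∈ (halfLine e : Set ℝ) → U x = F x := by
    filter_upwards [hquad] with x hx hxI
    have := hx hxI
    simp only [hF, Pi.add_apply] at this ⊢
    linear_combination this
  -- Differentiating the term with `U2` twice would produce `U`, which is merely square integrable
  -- and need not have a primitive structure of its own. Replacing `U` by `F`, which equals it
  -- almost everywhere on the half-line, gives a second derivative that is again a primitive, and
  -- `Q1`, `Q2` agree with `U1`, `U2` there.
  have pQ1 := IsPrimitive.of_integral pf.continuous.locallyIntegrable 0
  set Q1 := fun x => ∫ t in (0 : ℝ)..x, F t with hQ1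
  have pQ2 := IsPrimitive.of_integral pQ1.continuous.locallyIntegrable 0
  set Q2 := fun x => ∫ t in (0 : ℝ)..x, Q1 t with hQ2
  have hUQ1 : ∀ x ∈ I, U1 x = Q1 x := fun x hx => integral_zero_congr_of_ae_eq e hUF hx
  have hUQ2 : ∀ x ∈ I, U2 x = Q2 x := fun x hx =>
    integral_zero_congr_of_ae_eq e (Eventually.of_forall fun y hy => hUQ1 y hy) hx
  have j1 := ((pW3.add (pQ2.const_mul (-b))).const_mul (a : ℂ)⁻¹).add pq
  have j2 := ((pW2.add (pQ1.const_mul (-b))).const_mul (a : ℂ)⁻¹).add pq1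
  have j3 := ((pW1.add (pf.const_mul (-b))).const_mul (a : ℂ)⁻¹).add pq2
  refine ⟨_, _, _, fun x => (a : ℂ)⁻¹ * (W1 + fun x => -(b : ℂ) * F x) x + c₂,
    fun x => (a : ℂ)⁻¹ * (W x - b * ((a : ℂ)⁻¹ * (W2 x - b * U1 x) + (c₂ * x + c₁))),
    ⟨j1, ?_, ?_⟩, ?_, ?_, rfl⟩
  · convert j2 using 1
    · funext x
      simp
    · funext x
      simp
  · have e8 : (fun x => (a : ℂ)⁻¹ * (W x - b * ((a : ℂ)⁻¹ * (W2 x - b * U1 x) + (c₂ * x + c₁))))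
        = fun x => (a : ℂ)⁻¹ * (W x + -b * ((a : ℂ)⁻¹ * (W2 x + -b * U1 x)
          + ((c₂ * x + c₁ * 1) + 0))) + 0 := by
      funext x
      ring
    rw [e8]
    exact j3
  · rw [EventuallyEq, ae_restrict_iff' hIm]
    filter_upwards [hUF] with x hx hxI
    have h1 := hx hxI
    rw [hU, indicator_of_mem hxI] at h1
    rw [h1, hF]
    simp only [Pi.add_apply, hUQ2 x hxI]
  · rw [EventuallyEq, ae_restrict_iff' hIm]
    refine Eventually.of_forall fun x hxI => ?_
    simp only [Pi.add_apply, ← hUQ1 x hxI]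
    have h1 : W x = w x := by rw [hW, indicator_of_mem hxI]
    rw [h1]
    field_simp
    ring


/-! ### Square summable families -/

section Lp2

variable {ι : Type*} {G : ι → Type*} [∀ i, NormedAddCommGroup (G i)]

theorem lp_two_hasSum_norm_sq (x : lp G 2) : HasSum (fun i => ‖x i‖ ^ 2) (‖x‖ ^ 2) := by
  have h := lp.hasSum_norm (p := 2) (by norm_num) x
  simpa using h

theorem memℓp_two_of_le {x : ∀ i, G i} {g : ι → ℝ} (hg : Summable g)
    (h : ∀ i, ‖x i‖ ^ 2 ≤ g i) : Memℓp x 2 := by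
  refine memℓp_gen ?_
  simp only [ENNReal.toReal_ofNat, Real.rpow_ofNat]
  exact Summable.of_nonneg_of_le (fun _ => sq_nonneg _) h hg

theorem lp_two_norm_sq_le {x : lp G 2} {g : ι → ℝ} {S : ℝ} (hg : HasSum g S)
    (h : ∀ i, ‖x i‖ ^ 2 ≤ g i) : ‖x‖ ^ 2 ≤ S :=
  hasSum_le h (lp_two_hasSum_norm_sq x) hg

end Lp2

/-! ### Boundary values on the graph -/

section Trace

variable {Em Ep : Type*} {c : AiryCoeff (Em ⊕ Ep)}

/-- `(u, w)` belongs to the graph of the maximal operator and has boundary values `p`. -/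
structure HasTrace (c : AiryCoeff (Em ⊕ Ep)) (u w : L2Graph Em Ep)
    (p : BdSpace Em × BdSpace Ep) : Prop where
  inl : ∀ e : Em, EdgeSol (halfLine (.inl e)) (c.α (.inl e)) (c.β (.inl e)) (u (.inl e))
    (w (.inl e)) fun k => p.1 k e
  inr : ∀ e : Ep, EdgeSol (halfLine (.inr e)) (c.α (.inr e)) (c.β (.inr e)) (u (.inr e))
    (w (.inr e)) fun k => p.2 k e

theorem AiryCoeff.exists_coeffBound {E : Type*} (c : AiryCoeff E) :
    ∃ K, ∀ e, CoeffBound K (c.α e) (c.β e) := by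
  obtain ⟨C₁, h₁⟩ := c.α_bdd
  obtain ⟨C₂, h₂⟩ := c.α_inv_bdd
  obtain ⟨C₃, h₃⟩ := c.β_bdd
  exact ⟨max C₁ (max C₂ C₃), fun e => ⟨c.α_pos e, (h₁ e).trans (le_max_left _ _),
    (h₂ e).trans ((le_max_left _ _).trans (le_max_right _ _)),
    (h₃ e).trans ((le_max_right _ _).trans (le_max_right _ _))⟩⟩

namespace HasTrace

variable {u w v z : L2Graph Em Ep} {p q : BdSpace Em × BdSpace Ep}

theorem add (hu : HasTrace c u w p) (hv : HasTrace c v z q) :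
    HasTrace c (u + v) (w + z) (p + q) :=
  ⟨fun e => (hu.inl e).add (hv.inl e), fun e => (hu.inr e).add (hv.inr e)⟩

theorem smul (hu : HasTrace c u w p) (r : ℂ) : HasTrace c (r • u) (r • w) (r • p) :=
  ⟨fun e => (hu.inl e).smul r, fun e => (hu.inr e).smul r⟩

theorem sub (hu : HasTrace c u w p) (hv : HasTrace c v z q) :
    HasTrace c (u - v) (w - z) (p - q) := by
  have h := hu.add (hv.smul (-1))
  simpa only [neg_smul, one_smul, ← sub_eq_add_neg] using h

theorem re (hu : HasTrace c u w p) :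
    HasTrace c (reGraph u) (reGraph w) (reBd p.1, reBd p.2) :=
  ⟨fun e => (hu.inl e).re, fun e => (hu.inr e).re⟩

theorem eq_of_hasBoundaryValues (hu : HasTrace c u w p)
    (h1 : ∀ e : Em, HasBoundaryValues (halfLine (.inl e)) (u (.inl e)) fun k => q.1 k e)
    (h2 : ∀ e : Ep, HasBoundaryValues (halfLine (.inr e)) (u (.inr e)) fun k => q.2 k e) :
    p = q := by
  refine Prod.ext ?_ ?_
  · ext k e
    exact congrFun ((hu.inl e).hasBoundaryValues.unique (h1 e)) k
  · ext k e
    exact congrFun ((hu.inr e).hasBoundaryValues.unique (h2 e)) k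

end HasTrace

theorem hasSum_norm_sq_add (u w : L2Graph Em Ep) (C : ℝ) :
    HasSum (fun e => C * (‖u e‖ ^ 2 + ‖w e‖ ^ 2)) (C * (‖u‖ ^ 2 + ‖w‖ ^ 2)) :=
  ((lp_two_hasSum_norm_sq u).add (lp_two_hasSum_norm_sq w)).mul_left C

/-- The edgewise boundary values are square summable because the constant in `EdgeSol.exists_bound`
is the same for all edges. -/
theorem HasTrace.exists_of_edgeSol {u w : L2Graph Em Ep}
    (h : ∀ e, ∃ t, EdgeSol (halfLine e) (c.α e) (c.β e) (u e) (w e) t) :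
    ∃ p, HasTrace c u w p := by
  obtain ⟨K, hK⟩ := c.exists_coeffBound
  obtain ⟨C, hC0, hC⟩ := EdgeSol.exists_bound (Em := Em) (Ep := Ep) K
  choose t ht using h
  have hb := fun e k => hC _ _ (hK e) e _ _ _ (ht e) k
  have hs := (hasSum_norm_sq_add u w C).summable
  refine ⟨(WithLp.toLp 2 fun k => ⟨fun e => t (.inl e) k, ?_⟩,
    WithLp.toLp 2 fun k => ⟨fun e => t (.inr e) k, ?_⟩), fun e => ht _, fun e => ht _⟩
  · exact memℓp_two_of_le (hs.comp_injective Sum.inl_injective) fun e => hb (.inl e) k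
  · exact memℓp_two_of_le (hs.comp_injective Sum.inr_injective) fun e => hb (.inr e) k

/-- Continuity of the boundary map in the graph norm. The factor `3` counts the components of the
boundary space. -/
theorem HasTrace.exists_bound (c : AiryCoeff (Em ⊕ Ep)) : ∃ C : ℝ, 0 ≤ C ∧
    ∀ (u w : L2Graph Em Ep) (p : BdSpace Em × BdSpace Ep), HasTrace c u w p →
      ‖p.1‖ ^ 2 ≤ C * (‖u‖ ^ 2 + ‖w‖ ^ 2) ∧ ‖p.2‖ ^ 2 ≤ C * (‖u‖ ^ 2 + ‖w‖ ^ 2) := by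
  obtain ⟨K, hK⟩ := c.exists_coeffBound
  obtain ⟨C, hC0, hC⟩ := EdgeSol.exists_bound (Em := Em) (Ep := Ep) K
  refine ⟨3 * C, by positivity, fun u w p hp => ?_⟩
  have hs := hasSum_norm_sq_add u w C
  have hpos : ∀ e, 0 ≤ C * (‖u e‖ ^ 2 + ‖w e‖ ^ 2) := fun e => by positivity
  have h1 : ∀ k, ‖p.1 k‖ ^ 2 ≤ C * (‖u‖ ^ 2 + ‖w‖ ^ 2) := fun k =>
    (lp_two_norm_sq_le (hs.summable.comp_injective Sum.inl_injective).hasSum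
      fun e => hC _ _ (hK _) _ _ _ _ (hp.inl e) k).trans
      ((_root_.tsum_comp_le_tsum_of_inj hs.summable hpos Sum.inl_injective).trans_eq hs.tsum_eq)
  have h2 : ∀ k, ‖p.2 k‖ ^ 2 ≤ C * (‖u‖ ^ 2 + ‖w‖ ^ 2) := fun k =>
    (lp_two_norm_sq_le (hs.summable.comp_injective Sum.inr_injective).hasSum
      fun e => hC _ _ (hK _) _ _ _ _ (hp.inr e) k).trans
      ((_root_.tsum_comp_le_tsum_of_inj hs.summable hpos Sum.inr_injective).trans_eq hs.tsum_eq)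
  rw [PiLp.norm_sq_eq_of_L2, PiLp.norm_sq_eq_of_L2, Fin.sum_univ_three, Fin.sum_univ_three]
  constructor
  · linarith [h1 0, h1 1, h1 2]
  · linarith [h2 0, h2 1, h2 2]

/-- Surjectivity of the boundary map. The edgewise lifts are square summable because `C` is uniform
and `(∑ k, ‖t k‖)² ≤ 3 ∑ k, ‖t k‖²`. -/
theorem HasTrace.exists_of_trace (c : AiryCoeff (Em ⊕ Ep)) (p : BdSpace Em × BdSpace Ep) :
    ∃ u w, HasTrace c u w p := by
  obtain ⟨K, hK⟩ := c.exists_coeffBound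
  obtain ⟨C, hC0, hC⟩ := EdgeSol.exists_of_boundaryValues (Em := Em) (Ep := Ep) K
  let t : Em ⊕ Ep → Fin 3 → ℂ := Sum.elim (fun e k => p.1 k e) fun e k => p.2 k e
  choose u w hsol hu hw using fun e => hC _ _ (hK e) e (t e)
  have hs : Summable fun e => 3 * C ^ 2 * ∑ k, ‖t e k‖ ^ 2 := by
    refine Summable.mul_left _ (summable_sum fun k _ => ?_)
    exact (HasSum.sum (f := fun e => ‖t e k‖ ^ 2) (lp_two_hasSum_norm_sq (p.1 k))
      (lp_two_hasSum_norm_sq (p.2 k))).summable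
  have hle : ∀ e, ∀ x : L2On (halfLine e), ‖x‖ ≤ C * ∑ k, ‖t e k‖ →
      ‖x‖ ^ 2 ≤ 3 * C ^ 2 * ∑ k, ‖t e k‖ ^ 2 := by
    intro e x hx
    have h1 := pow_le_pow_left₀ (norm_nonneg x) hx 2
    have h2 := sq_sum_le_card_mul_sum_sq (s := (Finset.univ : Finset (Fin 3)))
      (f := fun k => ‖t e k‖)
    simp only [Finset.card_univ, Fintype.card_fin, Nat.cast_ofNat] at h2
    rw [mul_pow] at h1
    have h3 := mul_le_mul_of_nonneg_left h2 (sq_nonneg C)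
    linarith
  exact ⟨⟨u, memℓp_two_of_le hs fun e => hle e _ (hu e)⟩,
    ⟨w, memℓp_two_of_le hs fun e => hle e _ (hw e)⟩, fun e => hsol _, fun e => hsol _⟩

theorem krein_eq_sum {E : Type*} (c : AiryCoeff E) (x y : BdSpace E) :
    krein c x y = inner ℂ (y 0) (-c.mulβ (x 0) - c.mulα (x 2)) + inner ℂ (y 1) (c.mulα (x 1))
      + inner ℂ (y 2) (-c.mulα (x 0)) := by
  rw [krein, PiLp.inner_apply, Fin.sum_univ_three]
  rfl

/-- The Krein form is minus the sum of the boundary forms over the edges. Green's formula produces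
`-bdForm` on `(0, ∞)` and `bdForm` on `(-∞, 0)`, whence the difference of Krein forms on the graph.
-/
theorem hasSum_krein {E : Type*} (c : AiryCoeff E) (x y : BdSpace E) :
    HasSum (fun e => -bdForm (c.α e) (c.β e) (fun k => x k e) fun k => y k e) (krein c x y) := by
  rw [krein_eq_sum]
  refine (((lp.hasSum_inner (𝕜 := ℂ) (y 0) (-c.mulβ (x 0) - c.mulα (x 2))).add
    (lp.hasSum_inner (𝕜 := ℂ) (y 1) (c.mulα (x 1)))).add
    (lp.hasSum_inner (𝕜 := ℂ) (y 2) (-c.mulα (x 0)))).congr_fun fun e => ?_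
  simp only [bdForm, AiryCoeff.mulα, AiryCoeff.mulβ, lp.coeFn_sub, lp.coeFn_neg, Pi.sub_apply,
    Pi.neg_apply, mulOp_apply, RCLike.inner_apply, starRingEnd_apply]
  ring

/-- Green's formula on the graph. -/
theorem HasTrace.green {u w v z : L2Graph Em Ep} {p q : BdSpace Em × BdSpace Ep}
    (hu : HasTrace c u w p) (hv : HasTrace c v z q) :
    inner ℂ v w + inner ℂ z u = krein c.plus p.2 q.2 - krein c.minus p.1 q.1 := by
  have h1 := (lp.hasSum_inner (𝕜 := ℂ) v w).add (lp.hasSum_inner (𝕜 := ℂ) z u)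
  have h2 := HasSum.sum (f := fun e => inner ℂ (v e) (w e) + inner ℂ (z e) (u e))
    (a := -krein c.minus p.1 q.1) (b := krein c.plus p.2 q.2) ?_ ?_
  · rw [h1.unique h2]; ring
  · have h3 := (hasSum_krein c.minus p.1 q.1).neg
    simp only [neg_neg] at h3
    refine h3.congr_fun fun e => ?_
    exact (hu.inl e).green_inl (c.α_pos _) (hv.inl e)
  · refine (hasSum_krein c.plus p.2 q.2).congr_fun fun e => ?_
    exact (hu.inr e).green_inr (c.α_pos _) (hv.inr e)

end Trace

/-! ### The graph of the Airy operator -/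

section Graph

variable {Em Ep : Type*} {c : AiryCoeff (Em ⊕ Ep)}

/-- The complex test function given by a real one. -/
noncomputable def IsTestFn.toComplex {I : TopologicalSpace.Opens ℝ} {φ : ℝ → ℝ}
    (h : IsTestFn (I : Set ℝ) φ) : 𝓓(I, ℂ) where
  toFun x := (φ x : ℂ)
  contDiff' := Complex.ofRealCLM.contDiff.comp h.contDiff
  hasCompactSupport' := h.hasCompactSupport.comp_left Complex.ofReal_zero
  tsupport_subset' := (tsupport_comp_subset Complex.ofReal_zero φ).trans h.tsupport_subset

theorem IsTestFn.deriv_ofReal {I : Set ℝ} {φ : ℝ → ℝ} (h : IsTestFn I φ) :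
    _root_.deriv (fun x => (φ x : ℂ)) = fun x => ((_root_.deriv φ x : ℝ) : ℂ) := by
  funext x
  exact ((h.contDiff.differentiable (by simp) x).hasDerivAt.ofReal_comp).deriv

theorem IsTestFn.airyExpr_toComplex {I : TopologicalSpace.Opens ℝ} {φ : ℝ → ℝ}
    (h : IsTestFn (I : Set ℝ) φ) (a b : ℝ) : airyExpr a b h.toComplex =
      fun x => ((a * _root_.deriv (_root_.deriv (_root_.deriv φ)) x + 
        b * _root_.deriv φ x : ℝ) : ℂ) := by
  have h0 : (h.toComplex : ℝ → ℂ) = fun x => (φ x : ℂ) := rfl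
  funext x
  rw [airyExpr, h0, iteratedDeriv_succ, iteratedDeriv_succ, iteratedDeriv_one, h.deriv_ofReal,
    h.deriv.deriv_ofReal, h.deriv.deriv.deriv_ofReal]
  push_cast
  rfl

/-- A real test function on a single edge defines an element of the minimal graph. These elements
already suffice for the weak equation on each edge and for density. -/
theorem IsTestFn.exists_mem_minGraph (c : AiryCoeff (Em ⊕ Ep)) {e : Em ⊕ Ep} {φ : ℝ → ℝ}
    (h : IsTestFn (halfLine e : Set ℝ) φ) : ∃ p ∈ minGraph c,
      (∀ y : L2Graph Em Ep, inner ℂ p.1 y = ∫ x in (halfLine e : Set ℝ), (φ x : ℂ) * y e x) ∧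
      ∀ y : L2Graph Em Ep, inner ℂ p.2 y = ∫ x in (halfLine e : Set ℝ),
        ((c.α e * _root_.deriv (_root_.deriv (_root_.deriv φ)) x + 
          c.β e * _root_.deriv φ x : ℝ) : ℂ) * y e x := by
  classical
  set I : Set ℝ := (halfLine e : Set ℝ)
  set ψ : ℝ → ℝ := fun x =>
    c.α e * _root_.deriv (_root_.deriv (_root_.deriv φ)) x + c.β e * _root_.deriv φ x
  have hmem : ∀ {g : ℝ → ℝ}, Continuous g → HasCompactSupport g →
      MemLp (fun x => (g x : ℂ)) 2 (volume.restrict I) := fun hg hc =>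
    ((Complex.continuous_ofReal.comp hg).memLp_of_hasCompactSupport
      (hc.comp_left Complex.ofReal_zero)).restrict _
  have hφ : MemLp (fun x => (φ x : ℂ)) 2 (volume.restrict I) :=
    hmem h.contDiff.continuous h.hasCompactSupport
  have hψ : MemLp (fun x => (ψ x : ℂ)) 2 (volume.restrict I) :=
    hmem ((continuous_const.mul h.deriv.deriv.deriv.contDiff.continuous).add
      (continuous_const.mul h.deriv.contDiff.continuous))
      (h.deriv.deriv.deriv.hasCompactSupport.mul_left.add h.deriv.hasCompactSupport.mul_left)
  have hinner : ∀ {g : ℝ → ℝ} (hg : MemLp (fun x => (g x : ℂ)) 2 (volume.restrict I))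
      (y : L2Graph Em Ep), inner ℂ (lp.single 2 e (hg.toLp _) : L2Graph Em Ep) y
        = ∫ x in I, (g x : ℂ) * y e x := by
    intro g hg y
    rw [lp.inner_single_left, L2.inner_def]
    refine integral_congr_ae ?_
    filter_upwards [hg.coeFn_toLp] with x hx
    rw [hx, RCLike.inner_apply, Complex.conj_ofReal, mul_comm]
  refine ⟨(lp.single 2 e (hφ.toLp _), lp.single 2 e (hψ.toLp _)),
    ⟨Pi.single e h.toComplex, ?_, fun e' => ?_⟩, hinner hφ, hinner hψ⟩
  · refine (finite_singleton e).subset fun e' he' => ?_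
    by_contra hne
    exact he' (Pi.single_eq_of_ne hne _)
  · rcases eq_or_ne e' e with rfl | hne
    · simp only [lp.single_apply_self, Pi.single_eq_same]
      rw [h.airyExpr_toComplex]
      exact ⟨hφ.coeFn_toLp, hψ.coeFn_toLp⟩
    · have hz : airyExpr (c.α e') (c.β e') (0 : 𝓓(halfLine e', ℂ)) = 0 := by
        simpa using airyExpr_smul (c.α e') (c.β e') (0 : ℂ) (0 : 𝓓(halfLine e', ℂ))
      rw [Pi.single_eq_of_ne hne, hz]
      simp only [lp.single_apply_ne _ _ _ hne]
      exact ⟨Lp.coeFn_zero _ _ _, Lp.coeFn_zero _ _ _⟩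

theorem HasTrace.of_mem_minGraph {p : L2Graph Em Ep × L2Graph Em Ep} (hp : p ∈ minGraph c) :
    HasTrace c p.1 p.2 0 := by
  obtain ⟨φ, -, h⟩ := hp
  exact ⟨fun e => .of_testFunction (zero_notMem_halfLine _) (φ _) (h _).1 (h _).2,
    fun e => .of_testFunction (zero_notMem_halfLine _) (φ _) (h _).1 (h _).2⟩

theorem krein_zero_right {E : Type*} (c : AiryCoeff E) (x : BdSpace E) : krein c x 0 = 0 :=
  inner_zero_left _

/-- Forward, Green's formula with an element whose boundary values vanish. Backward, testing edge by
edge and regularity of weak solutions. The right side says that `(u, -w)` is in the graph of `A₀*`.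
-/
theorem exists_hasTrace_iff (u w : L2Graph Em Ep) : (∃ p, HasTrace c u w p) ↔
    ∀ p ∈ minGraph c, inner ℂ p.2 u + inner ℂ p.1 w = 0 := by
  refine ⟨fun ⟨q, hq⟩ p hp => ?_, fun h => ?_⟩
  · have h := hq.green (HasTrace.of_mem_minGraph hp)
    rw [add_comm, h]
    simp [krein_zero_right]
  · refine HasTrace.exists_of_edgeSol fun e => EdgeSol.of_weak e (c.α_pos e) _ _ fun φ hφ => ?_
    obtain ⟨p, hp, h1, h2⟩ := hφ.exists_mem_minGraph c
    rw [← h1, ← h2, h p hp]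

theorem dense_minOp_domain (c : AiryCoeff (Em ⊕ Ep)) :
    Dense ((minOp c).domain : Set (L2Graph Em Ep)) := by
  rw [Submodule.dense_iff_topologicalClosure_eq_top, Submodule.topologicalClosure_eq_top_iff,
    Submodule.eq_bot_iff]
  intro y hy
  ext e : 2
  refine Lp.ext ?_
  have hI : MeasurableSet (halfLine e : Set ℝ) := (halfLine e).isOpen.measurableSet
  have h0 : ∀ᵐ x : ℝ, x ∈ (halfLine e : Set ℝ) → y e x = 0 := by
    refine (halfLine e).isOpen.ae_eq_zero_of_integral_contDiff_smul_eq_zero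
      (locallyIntegrableOn_of_locallyIntegrable_restrict
        ((Lp.memLp (y e)).locallyIntegrable (by norm_num))) fun φ h1 h2 h3 => ?_
    · obtain ⟨p, hp, h, -⟩ := (IsTestFn.mk h1 h2 h3).exists_mem_minGraph c
      have h4 : inner ℂ p.1 y = 0 := by
        refine hy p.1 ?_
        rw [LinearPMap.mem_domain_iff, minOp_graph]
        exact ⟨p.2, hp⟩
      rw [h, ← integral_indicator hI] at h4
      rw [← h4]
      refine integral_congr_ae (Eventually.of_forall fun x => ?_)
      by_cases hx : x ∈ (halfLine e : Set ℝ)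
      · simp [hx]
      · have : φ x = 0 := image_eq_zero_of_notMem_tsupport fun hm => hx (h3 hm)
        simp [hx, this]
  filter_upwards [(ae_restrict_iff' hI).2 h0,
    Lp.coeFn_zero ℂ 2 (volume.restrict (halfLine e : Set ℝ))]
    with x h1 h2
  rw [h1]
  exact h2.symm

theorem mem_neg_adjoint_graph (u w : L2Graph Em Ep) :
    (u, w) ∈ (-(minOp c).adjoint).graph ↔ ∃ p, HasTrace c u w p := by
  rw [exists_hasTrace_iff, LinearPMap.neg_graph, Submodule.mem_map]
  have h : (∃ y ∈ (minOp c).adjoint.graph, (LinearMap.id.prodMap (-LinearMap.id) :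
      L2Graph Em Ep × L2Graph Em Ep →ₗ[ℂ] _) y = (u, w)) ↔ (u, -w) ∈ (minOp c).adjoint.graph := by
    refine ⟨?_, fun h => ⟨_, h, by simp⟩⟩
    rintro ⟨⟨y, z⟩, hy, h⟩
    obtain ⟨rfl, rfl⟩ : y = u ∧ -z = w := by simpa using h
    simpa using hy
  rw [h, LinearPMap.adjoint_graph_eq_graph_adjoint (dense_minOp_domain c), minOp_graph,
    Submodule.mem_adjoint_iff]
  simp only [inner_neg_right, sub_neg_eq_add]
  exact ⟨fun h p hp => h p.1 p.2 hp, fun h a b hab => h (a, b) hab⟩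

/-- The working description of the operator. Regularity supplies boundary values of `u`, and
uniqueness identifies them with those in the definition of `bdPreimage`. -/
theorem mem_airyOp_graph {X : Submodule ℂ (BdSpace Em × BdSpace Ep)} {u w : L2Graph Em Ep} :
    (u, w) ∈ (airyOp c X).graph ↔ ∃ p ∈ X, HasTrace c u w p := by
  have key : (u, w) ∈ (airyOp c X).graph ↔
      u ∈ bdPreimage X ∧ (u, w) ∈ (-(minOp c).adjoint).graph := by
    simp only [LinearPMap.mem_graph_iff]
    constructor
    · rintro ⟨⟨y, hy1, hy2⟩, rfl, h⟩
      exact ⟨hy1, ⟨y, hy2⟩, rfl, h⟩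
    · rintro ⟨hu, ⟨y, hy⟩, rfl, h⟩
      exact ⟨⟨y, hu, hy⟩, rfl, h⟩
  rw [key, mem_neg_adjoint_graph]
  constructor
  · rintro ⟨⟨q, hq, h1, h2⟩, p, hp⟩
    exact ⟨q, hq, hp.eq_of_hasBoundaryValues h1 h2 ▸ hp⟩
  · rintro ⟨p, hp, h⟩
    exact ⟨⟨p, hp, fun e => (h.inl e).hasBoundaryValues, fun e => (h.inr e).hasBoundaryValues⟩,
      p, h⟩

end Graph

/-! ### Generation for abstract boundary conditions -/

section Generation

variable {Em Ep : Type*} {c : AiryCoeff (Em ⊕ Ep)}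

theorem reGraph_add (u v : L2Graph Em Ep) : reGraph (u + v) = reGraph u + reGraph v := by
  ext e : 2
  exact map_add (reC.compLpL 2 (volume.restrict (halfLine e : Set ℝ))) (u e) (v e)

theorem norm_reGraph_le (u : L2Graph Em Ep) : ‖reGraph u‖ ≤ ‖u‖ := by
  refine abs_le_of_sq_le_sq' ?_ (norm_nonneg u) |>.2
  exact lp_two_norm_sq_le (lp_two_hasSum_norm_sq u) fun e =>
    pow_le_pow_left₀ (norm_nonneg _) (norm_reL2_le (u e)) 2

/-- The real part as a bounded real linear operator in `L²(G)`. -/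
noncomputable def reGraphCLM : L2Graph Em Ep →L[ℝ] L2Graph Em Ep :=
  AddMonoidHom.toRealLinearMap (AddMonoidHom.mk' reGraph reGraph_add)
    (AddMonoidHomClass.continuous_of_bound _ 1 fun u => by
      simpa using norm_reGraph_le u)

variable {X : Submodule ℂ (BdSpace Em × BdSpace Ep)}

/-- Green's formula with `v = u` reads `2 Re (u, w) = ⟨p₊ | p₊⟩₊ - ⟨p₋ | p₋⟩₋`. -/
theorem isDissipative_airyOp
    (hD : ∀ x ∈ X, (krein c.plus x.2 x.2).re ≤ (krein c.minus x.1 x.1).re) :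
    IsDissipative (airyOp c X) := by
  intro u w huw
  obtain ⟨p, hp, h⟩ := mem_airyOp_graph.1 huw
  have h1 := congrArg Complex.re (h.green h)
  have h2 : (inner ℂ w u).re = (inner ℂ u w).re := inner_re_symm (𝕜 := ℂ) w u
  rw [Complex.add_re, Complex.sub_re, h2] at h1
  linarith [hD p hp]

theorem dense_airyOp_domain (c : AiryCoeff (Em ⊕ Ep))
    (X : Submodule ℂ (BdSpace Em × BdSpace Ep)) :
    Dense ((airyOp c X).domain : Set (L2Graph Em Ep)) := by
  refine (dense_minOp_domain c).mono fun u hu => ?_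
  rw [SetLike.mem_coe, LinearPMap.mem_domain_iff, minOp_graph] at hu
  obtain ⟨w, hw⟩ := hu
  exact LinearPMap.mem_domain_iff.2 ⟨w, mem_airyOp_graph.2 ⟨0, X.zero_mem, .of_mem_minGraph hw⟩⟩

/-- If `X` is invariant under real parts, so is the graph of the operator; contractivity and
commutation with the real part then follow from dissipativity, without closedness of `X`. -/
theorem airyOp_semigroup
    (hD : ∀ x ∈ X, (krein c.plus x.2 x.2).re ≤ (krein c.minus x.1 x.1).re)
    (hre : ∀ x ∈ X, (reBd x.1, reBd x.2) ∈ X) {T : C0Semigroup (L2Graph Em Ep)}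
    (hT : T.IsGeneratedBy (airyOp c X)) : T.IsContractive ∧ IsRealSemigroup T := by
  have hA := isDissipative_airyOp hD
  refine ⟨hA.isContractive (dense_airyOp_domain c X) hT, fun t u => ?_⟩
  refine hA.commutes (dense_airyOp_domain c X) hT hT reGraphCLM (fun u w huw => ?_) t u
  obtain ⟨p, hp, h⟩ := mem_airyOp_graph.1 huw
  exact mem_airyOp_graph.2 ⟨_, hre p hp, h.re⟩

theorem tendsto_of_norm_sub_sq_le {E : Type*} [NormedAddCommGroup E] {f : ℕ → E} {a : E}
    {g : ℕ → ℝ} (hg : Tendsto g atTop (𝓝 0)) (h : ∀ n, ‖f n - a‖ ^ 2 ≤ g n) :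
    Tendsto f atTop (𝓝 a) := by
  rw [tendsto_iff_norm_sub_tendsto_zero]
  have h1 := (squeeze_zero (fun n => sq_nonneg _) h hg).sqrt
  simpa [Real.sqrt_sq] using h1

/-- The weak characterization shows that the limit is in the maximal graph, and
`HasTrace.exists_bound` makes the boundary values converge, so the limit trace stays in `X`. -/
theorem isClosed_airyOp (hX : IsClosed (X : Set (BdSpace Em × BdSpace Ep))) :
    (airyOp c X).IsClosed := by
  refine isClosed_of_closure_subset fun ⟨u, w⟩ huw => ?_
  obtain ⟨s, hs, hlim⟩ := mem_closure_iff_seq_limit.1 huw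
  choose p hp h using fun n => mem_airyOp_graph.1 (hs n : ((s n).1, (s n).2) ∈ (airyOp c X).graph)
  have h1 : Tendsto (fun n => (s n).1) atTop (𝓝 u) := (continuous_fst.tendsto _).comp hlim
  have h2 : Tendsto (fun n => (s n).2) atTop (𝓝 w) := (continuous_snd.tendsto _).comp hlim
  obtain ⟨q, hq⟩ : ∃ q, HasTrace c u w q := by
    refine (exists_hasTrace_iff u w).2 fun z hz => ?_
    refine tendsto_nhds_unique
      ((tendsto_const_nhds.inner (𝕜 := ℂ) h1).add (tendsto_const_nhds.inner (𝕜 := ℂ) h2)) ?_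
    exact tendsto_const_nhds.congr fun n =>
      ((exists_hasTrace_iff (c := c) (s n).1 (s n).2).1 ⟨p n, h n⟩ z hz).symm
  refine mem_airyOp_graph.2 ⟨q, ?_, hq⟩
  obtain ⟨C, -, hC⟩ := HasTrace.exists_bound c
  have h3 : Tendsto (fun n => C * (‖(s n).1 - u‖ ^ 2 + ‖(s n).2 - w‖ ^ 2)) atTop (𝓝 0) := by
    have := ((((h1.sub_const u).norm).pow 2).add (((h2.sub_const w).norm).pow 2)).const_mul C
    simpa using this
  refine hX.mem_of_tendsto (b := atTop) (f := p) ?_ (Eventually.of_forall hp)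
  rw [nhds_prod_eq]
  have h4 := fun n => hC _ _ _ ((h n).sub hq)
  exact (tendsto_of_norm_sub_sq_le h3 fun n => (h4 n).1).prodMk
    (tendsto_of_norm_sub_sq_le h3 fun n => (h4 n).2)

theorem airyOp_resolventRange (hX : IsClosed (X : Set (BdSpace Em × BdSpace Ep)))
    (hD : ∀ x ∈ X, (krein c.plus x.2 x.2).re ≤ (krein c.minus x.1 x.1).re)
    (hD' : ∀ q : BdSpace Em × BdSpace Ep,
      (∀ x ∈ X, krein c.plus x.2 q.2 = krein c.minus x.1 q.1) →
      (krein c.minus q.1 q.1).re ≤ (krein c.plus q.2 q.2).re) {r : ℝ} (hr : 0 < r) :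
    resolventRange (airyOp c X) r = ⊤ := by
  refine (isDissipative_airyOp hD).resolventRange_eq_top (isClosed_airyOp hX) hr fun z hz => ?_
  -- Testing only with the minimal operator, a restriction of `airyOp c X`, shows that `z` is a weak
  -- and hence a regular solution of `α z''' + β z' = -r z`.
  obtain ⟨q, hq⟩ : ∃ q, HasTrace c z (-((r : ℂ) • z)) q := by
    refine (exists_hasTrace_iff _ _).2 fun p hp => ?_
    have h := hz p.1 p.2 (mem_airyOp_graph.2 ⟨0, X.zero_mem, .of_mem_minGraph hp⟩)
    have h' := congrArg (starRingEnd ℂ) h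
    rw [inner_conj_symm, map_zero, inner_sub_left, inner_smul_left, Complex.conj_ofReal] at h'
    rw [inner_neg_right, inner_smul_right]
    linear_combination -h'
  -- Every `x ∈ X` is the trace of some `u` in the domain; in Green's formula for `u` and `z` the
  -- orthogonality of `z` cancels the interior terms.
  have hq' := hD' q fun x hx => by
    obtain ⟨u, w, huw⟩ := HasTrace.exists_of_trace c x
    have h := hz u w (mem_airyOp_graph.2 ⟨x, hx, huw⟩)
    have h' := huw.green hq
    rw [inner_neg_left, inner_smul_left, Complex.conj_ofReal] at h'
    rw [inner_sub_right, inner_smul_right] at h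
    linear_combination -h' - h
  have h := congrArg Complex.re (hq.green hq)
  rw [inner_neg_left, inner_neg_right, inner_smul_left, inner_smul_right, Complex.conj_ofReal,
    inner_self_eq_norm_sq_to_K, Complex.sub_re] at h
  have h' : (-((r : ℂ) * ((‖z‖ : ℝ) : ℂ) ^ 2) + -((r : ℂ) * ((‖z‖ : ℝ) : ℂ) ^ 2)).re
      = -(2 * r * ‖z‖ ^ 2) := by
    rw [← Complex.ofReal_pow, ← Complex.ofReal_mul, Complex.add_re, Complex.neg_re,
      Complex.ofReal_re]
    ring
  have h2 : -(2 * r * ‖z‖ ^ 2) = (krein c.plus q.2 q.2).re - (krein c.minus q.1 q.1).re :=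
    h'.symm.trans h
  have h3 : ‖z‖ ^ 2 ≤ 0 := by
    by_contra hcon
    have := mul_pos (mul_pos two_pos hr) (not_le.1 hcon)
    linarith
  exact norm_eq_zero.1 (pow_eq_zero_iff two_ne_zero |>.1 (le_antisymm h3 (sq_nonneg _)))

theorem airyOp_existsUnique (hX : IsClosed (X : Set (BdSpace Em × BdSpace Ep)))
    (hD : ∀ x ∈ X, (krein c.plus x.2 x.2).re ≤ (krein c.minus x.1 x.1).re)
    (hD' : ∀ q : BdSpace Em × BdSpace Ep,
      (∀ x ∈ X, krein c.plus x.2 q.2 = krein c.minus x.1 q.1) →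
      (krein c.minus q.1 q.1).re ≤ (krein c.plus q.2 q.2).re) :
    ∃! T : C0Semigroup (L2Graph Em Ep), T.IsGeneratedBy (airyOp c X) := by
  have hA := isDissipative_airyOp hD
  have hdense := dense_airyOp_domain c X
  obtain ⟨T, hT⟩ := hA.exists_isGeneratedBy hdense fun r hr => airyOp_resolventRange hX hD hD' hr
  exact ⟨T, hT, fun S hS => hA.unique hdense hS hT⟩

end Generation

/-! ### Boundary conditions given by an operator -/

section GraphCondition

variable {Em Ep : Type*} {c : AiryCoeff (Em ⊕ Ep)} {L : BdSpace Em →ₗ.[ℂ] BdSpace Ep}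

theorem IsKreinContraction.re_le {E F : Type*} {c : AiryCoeff E} {d : AiryCoeff F}
    {S : BdSpace E →ₗ.[ℂ] BdSpace F} (hS : IsKreinContraction c d S)
    {x : BdSpace E × BdSpace F} (hx : x ∈ S.graph) :
    (krein d x.2 x.2).re ≤ (krein c x.1 x.1).re := by
  obtain ⟨y, h1, h2⟩ := LinearPMap.mem_graph_iff _ |>.1 hx
  rw [← h1, ← h2]
  exact hS y

theorem IsRealOp.re_mem_graph {E F : Type*} {S : BdSpace E →ₗ.[ℂ] BdSpace F} (hS : IsRealOp S)
    {x : BdSpace E × BdSpace F} (hx : x ∈ S.graph) : (reBd x.1, reBd x.2) ∈ S.graph := by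
  obtain ⟨y, h1, h2⟩ := LinearPMap.mem_graph_iff _ |>.1 hx
  obtain ⟨h, h3⟩ := hS y
  rw [← h1, ← h2, ← h3]
  exact LinearPMap.mem_graph S ⟨_, h⟩

/-- The condition on `q` says precisely that `(q.2, q.1)` is in the graph of the Krein adjoint, so
contractivity of the adjoint is the required reverse inequality. -/
theorem re_krein_le_of_kreinAdjoint {E F : Type*} {c : AiryCoeff E} {d : AiryCoeff F}
    {S : BdSpace E →ₗ.[ℂ] BdSpace F} (hdense : Dense (S.domain : Set (BdSpace E)))
    (hS : IsKreinContraction d c (kreinAdjoint c d S)) {q : BdSpace E × BdSpace F}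
    (hq : ∀ x ∈ S.graph, krein d x.2 q.2 = krein c x.1 q.1) :
    (krein c q.1 q.1).re ≤ (krein d q.2 q.2).re := by
  refine hS.re_le (x := (q.2, q.1)) ?_
  rw [kreinAdjoint_graph c d S hdense]
  intro x
  have h := hq ((x : BdSpace E), S x) (LinearPMap.mem_graph S x)
  exact h

end GraphCondition

/-! ### Separated boundary conditions -/

section Separated

variable {E : Type*}

theorem hasSum_weightedInner (c : AiryCoeff E) (x : Ell2 E) :
    HasSum (fun e => c.α e * ‖x e‖ ^ 2) (weightedInner c x x).re := by
  have h := Complex.hasSum_re (lp.hasSum_inner (𝕜 := ℂ) x (c.mulα x))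
  refine h.congr_fun fun e => ?_
  rw [AiryCoeff.mulα, mulOp_apply, RCLike.inner_apply, mul_assoc, Complex.re_ofReal_mul,
    Complex.mul_conj, Complex.normSq_eq_norm_sq, Complex.ofReal_re]

theorem weightedInner_nonneg (c : AiryCoeff E) (x : Ell2 E) : 0 ≤ (weightedInner c x x).re :=
  (hasSum_weightedInner c x).nonneg fun e => mul_nonneg (c.α_pos e).le (sq_nonneg _)

theorem weightedInner_conj_symm (c : AiryCoeff E) (x y : Ell2 E) :
    (starRingEnd ℂ) (weightedInner c x y) = weightedInner c y x := by
  rw [weightedInner, weightedInner, inner_conj_symm, AiryCoeff.mulα, inner_mulOp]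

/-- In weighted norms, `0 ≤ ‖q - U p‖² = ‖q‖² - 2 ‖p‖² + ‖U p‖² ≤ ‖q‖² - ‖p‖²`. It plays the role of
contractivity of the adjoint, with `p` as the image of `q`. -/
theorem weightedInner_le_of_adjoint {F : Type*} {c : AiryCoeff E} {d : AiryCoeff F}
    {U : Ell2 E →ₗ[ℂ] Ell2 F} (hU : IsWeightedContraction c d U) {p : Ell2 E} {q : Ell2 F}
    (h : weightedInner d (U p) q = weightedInner c p p) :
    (weightedInner c p p).re ≤ (weightedInner d q q).re := by
  have h1 := weightedInner_nonneg d (q - U p)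
  have h2 : weightedInner d (q - U p) (q - U p) = weightedInner d q q - weightedInner d (U p) q
      - (weightedInner d q (U p) - weightedInner d (U p) (U p)) := by
    simp only [weightedInner, map_sub, inner_sub_left, inner_sub_right]
    ring
  have h3 : (weightedInner d q (U p)).re = (weightedInner c p p).re := by
    rw [← weightedInner_conj_symm, h, Complex.conj_re]
  rw [h2, h, Complex.sub_re, Complex.sub_re, Complex.sub_re, h3] at h1
  linarith [hU p]

theorem mulOp_continuous (a : E → ℝ) (ha : ∃ C, ∀ e, |a e| ≤ C) : Continuous (mulOp a ha) := by
  obtain ⟨C, hC⟩ := id ha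
  refine AddMonoidHomClass.continuous_of_bound (mulOp a ha) |C| fun x => ?_
  refine (abs_le_of_sq_le_sq' ?_ (by positivity)).2
  rw [mul_pow]
  refine lp_two_norm_sq_le ((lp_two_hasSum_norm_sq x).mul_left (|C| ^ 2)) fun e => ?_
  rw [mulOp_apply, norm_mul, mul_pow, Complex.norm_real, Real.norm_eq_abs]
  exact mul_le_mul_of_nonneg_right
    (pow_le_pow_left₀ (abs_nonneg _) ((hC e).trans (le_abs_self C)) 2) (sq_nonneg _)

/-- The weighted and unweighted norms are equivalent: `α` is bounded above on the source and `α⁻¹`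
on the target. -/
theorem IsWeightedContraction.continuous {F : Type*} {c : AiryCoeff E} {d : AiryCoeff F}
    {U : Ell2 E →ₗ[ℂ] Ell2 F} (hU : IsWeightedContraction c d U) : Continuous U := by
  obtain ⟨C, hC⟩ := c.α_bdd
  obtain ⟨D, hD⟩ := d.α_inv_bdd
  have hC' : ∀ e, c.α e ≤ |C| := fun e => (hC e).trans (le_abs_self C)
  have hD' : ∀ e, (d.α e)⁻¹ ≤ |D| := fun e => (hD e).trans (le_abs_self D)
  refine AddMonoidHomClass.continuous_of_bound U (√(|D| * |C|)) fun x => ?_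
  refine (abs_le_of_sq_le_sq' ?_ (by positivity)).2
  rw [mul_pow, Real.sq_sqrt (by positivity)]
  have h1 : ‖U x‖ ^ 2 ≤ |D| * (weightedInner d (U x) (U x)).re := by
    refine lp_two_norm_sq_le ((hasSum_weightedInner d (U x)).mul_left |D|) fun e => ?_
    have h := mul_le_mul_of_nonneg_right (hD' e) (d.α_pos e).le
    rw [inv_mul_cancel₀ (d.α_pos e).ne'] at h
    rw [← mul_assoc]
    exact le_mul_of_one_le_left (sq_nonneg _) h
  have h2 : (weightedInner c x x).re ≤ |C| * ‖x‖ ^ 2 :=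
    hasSum_le (fun e => mul_le_mul_of_nonneg_right (hC' e) (sq_nonneg _))
      (hasSum_weightedInner c x) ((lp_two_hasSum_norm_sq x).mul_left |C|)
  calc ‖U x‖ ^ 2 ≤ |D| * (weightedInner d (U x) (U x)).re := h1
    _ ≤ |D| * (|C| * ‖x‖ ^ 2) := mul_le_mul_of_nonneg_left ((hU x).trans h2) (abs_nonneg D)
    _ = |D| * |C| * ‖x‖ ^ 2 := by ring

theorem bdComp_continuous (k : Fin 3) : Continuous (bdComp E k) :=
  PiLp.continuous_apply 2 _ k

theorem AiryCoeff.flux_apply (c : AiryCoeff E) (x : BdSpace E) :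
    c.flux x = c.mulα (x 2) + (1 / 2 : ℂ) • c.mulβ (x 0) := rfl

theorem AiryCoeff.flux_continuous (c : AiryCoeff E) : Continuous c.flux :=
  ((mulOp_continuous c.α c.α_abs_bdd).comp (bdComp_continuous 2)).add
    (((mulOp_continuous c.β c.β_bdd).comp (bdComp_continuous 0)).const_smul _)

/-- Value, first derivative and flux are free coordinates on the boundary space, because
multiplication by `α` is invertible and the flux can be solved for the second derivative. -/
theorem AiryCoeff.exists_flux_eq (c : AiryCoeff E) (x₀ x₁ f : Ell2 E) :
    ∃ x : BdSpace E, x 0 = x₀ ∧ x 1 = x₁ ∧ c.flux x = f := by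
  have hinv : ∃ C, ∀ e, |(c.α e)⁻¹| ≤ C := c.α_inv_bdd.imp fun _ h e => by
    rw [abs_of_pos (inv_pos.2 (c.α_pos e))]
    exact h e
  refine ⟨WithLp.toLp 2 ![x₀, x₁, mulOp (fun e => (c.α e)⁻¹) hinv
    (f - (1 / 2 : ℂ) • c.mulβ x₀)], rfl, rfl, ?_⟩
  have h : ∀ y, c.mulα (mulOp (fun e => (c.α e)⁻¹) hinv y) = y := fun y => by
    ext e
    have h0 : (c.α e : ℂ) ≠ 0 := by exact_mod_cast (c.α_pos e).ne'
    simp [AiryCoeff.mulα, h0]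
  rw [AiryCoeff.flux_apply]
  change c.mulα (mulOp (fun e => (c.α e)⁻¹) hinv (f - (1 / 2 : ℂ) • c.mulβ x₀))
    + (1 / 2 : ℂ) • c.mulβ x₀ = f
  rw [h, sub_add_cancel]

/-- Distributing the `β` term evenly between the two fluxes leaves a weighted inner product of first
derivatives and a symmetric pairing of values with fluxes. -/
theorem krein_eq_flux (c : AiryCoeff E) (x y : BdSpace E) :
    krein c x y = weightedInner c (x 1) (y 1) - inner ℂ (y 0) (c.flux x)
      - inner ℂ (c.flux y) (x 0) := by
  have h2 : inner ℂ (c.mulα (y 2)) (x 0) = inner ℂ (y 2) (c.mulα (x 0)) :=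
    (inner_mulOp _ _ _ _).symm
  have h3 : inner ℂ (c.mulβ (y 0)) (x 0) = inner ℂ (y 0) (c.mulβ (x 0)) :=
    (inner_mulOp _ _ _ _).symm
  rw [krein_eq_sum, weightedInner, c.flux_apply, c.flux_apply]
  simp only [inner_sub_right, inner_neg_right, inner_add_right, inner_add_left, inner_smul_left,
    inner_smul_right, h2, h3, map_div₀, map_one, map_ofNat]
  ring

theorem inner_reEll2_reEll2 (x y : Ell2 E) :
    inner ℂ (reEll2 x) (reEll2 y) = reC (inner ℂ (reEll2 x) y) := by
  refine (lp.hasSum_inner (𝕜 := ℂ) (reEll2 x) (reEll2 y)).unique ?_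
  refine (reC.hasSum (lp.hasSum_inner (𝕜 := ℂ) (reEll2 x) y)).congr_fun fun e => ?_
  have h : ∀ z w : ℂ, inner ℂ (reC z) (reC w) = reC (inner ℂ (reC z) w) := fun z w => by
    simp [reC, RCLike.inner_apply]
  exact h (x e) (y e)

theorem reEll2_decomp (x : Ell2 E) :
    x = reEll2 x + Complex.I • reEll2 (-Complex.I • x) := by
  ext e
  have h : ∀ z : ℂ, z = reC z + Complex.I * reC (-Complex.I * z) := fun z => by
    apply Complex.ext <;> simp [reC]
  exact h (x e)

theorem flux_reBd (c : AiryCoeff E) (x : BdSpace E) : c.flux (reBd x) = reEll2 (c.flux x) := by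
  ext e
  have h : ∀ (a b : ℝ) (z w : ℂ), (a : ℂ) * reC z + (1 / 2 : ℂ) * ((b : ℂ) * reC w)
      = reC ((a : ℂ) * z + (1 / 2 : ℂ) * ((b : ℂ) * w)) := fun a b z w => by
    apply Complex.ext <;> simp [reC]
  exact h (c.α e) (c.β e) (x 2 e) (x 0 e)

theorem reBd_apply (x : BdSpace E) (k : Fin 3) : reBd x k = reEll2 (x k) := rfl

theorem reEll2_neg (x : Ell2 E) : reEll2 (-x) = -reEll2 x := by
  ext e
  exact map_neg reC (x e)

variable {Em Ep : Type*} {c : AiryCoeff (Em ⊕ Ep)}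

/-- Componentwise real part on `ℓ²(Em) ⊕ ℓ²(Ep)`. -/
noncomputable def rePair (p : WithLp 2 (Ell2 Em × Ell2 Ep)) : WithLp 2 (Ell2 Em × Ell2 Ep) :=
  WithLp.toLp 2 (reEll2 p.fst, reEll2 p.snd)

theorem rePair_toLp (x : Ell2 Em) (y : Ell2 Ep) :
    rePair (WithLp.toLp 2 (x, y)) = WithLp.toLp 2 (reEll2 x, reEll2 y) := rfl

/-- Pairing with a real vector commutes with taking real parts, and each element of `Y` is `y₁ + i
y₂` with real `y₁`, `y₂` in `Y`, so orthogonality to real vectors of `Y` is enough. -/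
theorem rePair_mem_orthogonal {Y : Submodule ℂ (WithLp 2 (Ell2 Em × Ell2 Ep))}
    (hY : ∀ p ∈ Y, rePair p ∈ Y) {z : WithLp 2 (Ell2 Em × Ell2 Ep)} (hz : z ∈ Yᗮ) :
    rePair z ∈ Yᗮ := by
  have h1 : ∀ p ∈ Y, inner ℂ (rePair p) (rePair z) = 0 := fun p hp => by
    have h := hz _ (hY p hp)
    rw [WithLp.prod_inner_apply] at h ⊢
    have h' := congrArg reC h
    rw [map_add, map_zero] at h'
    rw [← h']
    exact congrArg₂ (· + ·) (inner_reEll2_reEll2 _ _) (inner_reEll2_reEll2 _ _)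
  intro p hp
  have hdec : p = rePair p + Complex.I • rePair (-Complex.I • p) := by
    refine (WithLp.ofLp_injective 2) (Prod.ext ?_ ?_)
    · exact reEll2_decomp p.fst
    · exact reEll2_decomp p.snd
  rw [hdec, inner_add_left, inner_smul_left, h1 p hp, h1 _ (Y.smul_mem _ hp)]
  simp

variable {Y : Submodule ℂ (WithLp 2 (Ell2 Em × Ell2 Ep))} {U : Ell2 Em →ₗ[ℂ] Ell2 Ep}

theorem mem_sepCond_toPMap {x : BdSpace Em × BdSpace Ep} :
    x ∈ sepCond c Y (U.toPMap ⊤) ↔ WithLp.toLp 2 (x.1 0, x.2 0) ∈ Y ∧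
      WithLp.toLp 2 (-c.minus.flux x.1, c.plus.flux x.2) ∈ Yᗮ ∧ x.2 1 = U (x.1 1) := by
  have h : (x.1 1, x.2 1) ∈ (U.toPMap ⊤).graph ↔ x.2 1 = U (x.1 1) := by
    rw [LinearPMap.mem_graph_iff]
    constructor
    · rintro ⟨y, hy, h⟩
      exact h.symm.trans (congrArg U hy)
    · exact fun h => ⟨⟨x.1 1, trivial⟩, rfl, h.symm⟩
  rw [← h]
  exact mem_sepCond c Y _ x.1 x.2

theorem krein_sub_krein_eq (x q : BdSpace Em × BdSpace Ep) :
    krein c.plus x.2 q.2 - krein c.minus x.1 q.1 =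
      weightedInner c.plus (x.2 1) (q.2 1) - weightedInner c.minus (x.1 1) (q.1 1)
      - inner ℂ (WithLp.toLp 2 (q.1 0, q.2 0) : WithLp 2 (Ell2 Em × Ell2 Ep))
        (WithLp.toLp 2 (-c.minus.flux x.1, c.plus.flux x.2))
      - inner ℂ (WithLp.toLp 2 (-c.minus.flux q.1, c.plus.flux q.2) : WithLp 2 (Ell2 Em × Ell2 Ep))
        (WithLp.toLp 2 (x.1 0, x.2 0)) := by
  rw [krein_eq_flux, krein_eq_flux, WithLp.prod_inner_apply, WithLp.prod_inner_apply]
  simp only [inner_neg_left, inner_neg_right]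
  ring

theorem krein_sub_krein_of_mem {q : BdSpace Em × BdSpace Ep}
    (h0 : WithLp.toLp 2 (q.1 0, q.2 0) ∈ Y)
    (h1 : WithLp.toLp 2 (-c.minus.flux q.1, c.plus.flux q.2) ∈ Yᗮ) :
    krein c.plus q.2 q.2 - krein c.minus q.1 q.1 =
      weightedInner c.plus (q.2 1) (q.2 1) - weightedInner c.minus (q.1 1) (q.1 1) := by
  rw [krein_sub_krein_eq, h1 _ h0, Submodule.inner_left_of_mem_orthogonal h0 h1, sub_zero, sub_zero]

theorem sepCond_re_le (hU : IsWeightedContraction c.minus c.plus U) :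
    ∀ x ∈ sepCond c Y (U.toPMap ⊤), (krein c.plus x.2 x.2).re ≤ (krein c.minus x.1 x.1).re := by
  intro x hx
  obtain ⟨h0, h1, h2⟩ := mem_sepCond_toPMap.1 hx
  have h := congrArg Complex.re (krein_sub_krein_of_mem h0 h1)
  rw [h2, Complex.sub_re, Complex.sub_re] at h
  linarith [hU (x.1 1)]

theorem sepCond_re_mem (hY : ∀ p ∈ Y, rePair p ∈ Y) (hU : ∀ x, reEll2 (U x) = U (reEll2 x)) :
    ∀ x ∈ sepCond c Y (U.toPMap ⊤), (reBd x.1, reBd x.2) ∈ sepCond c Y (U.toPMap ⊤) := by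
  intro x hx
  obtain ⟨h0, h1, h2⟩ := mem_sepCond_toPMap.1 hx
  refine mem_sepCond_toPMap.2 ⟨?_, ?_, ?_⟩
  · dsimp only
    rw [reBd_apply, reBd_apply, ← rePair_toLp]
    exact hY _ h0
  · dsimp only
    rw [flux_reBd, flux_reBd, ← reEll2_neg]
    rw [← rePair_toLp]
    exact rePair_mem_orthogonal hY h1
  · dsimp only
    rw [reBd_apply, reBd_apply, h2, hU]

theorem isClosed_sepCond (hY : IsClosed (Y : Set (WithLp 2 (Ell2 Em × Ell2 Ep))))
    (hU : Continuous U) :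
    IsClosed (sepCond c Y (U.toPMap ⊤) : Set (BdSpace Em × BdSpace Ep)) := by
  have h : (sepCond c Y (U.toPMap ⊤) : Set (BdSpace Em × BdSpace Ep)) =
      {x | WithLp.toLp 2 (bdComp Em 0 x.1, bdComp Ep 0 x.2) ∈ (Y : Set _)} ∩
      ({x | WithLp.toLp 2 (-c.minus.flux x.1, c.plus.flux x.2) ∈ (Yᗮ : Set _)} ∩
      {x | bdComp Ep 1 x.2 = U (bdComp Em 1 x.1)}) := by
    ext x
    exact mem_sepCond_toPMap
  rw [h]
  refine (hY.preimage ?_).inter ((Y.isClosed_orthogonal.preimage ?_).inter (isClosed_eq ?_ ?_))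
  · exact (WithLp.prod_continuous_toLp 2 _ _).comp
      (((bdComp_continuous 0).comp continuous_fst).prodMk
        ((bdComp_continuous 0).comp continuous_snd))
  · exact (WithLp.prod_continuous_toLp 2 _ _).comp
      ((c.minus.flux_continuous.comp continuous_fst).neg.prodMk
        (c.plus.flux_continuous.comp continuous_snd))
  · exact (bdComp_continuous 1).comp continuous_snd
  · exact hU.comp ((bdComp_continuous 1).comp continuous_fst)

/-- Values in `Y`, fluxes in `Yᗮ` and first derivatives can be varied independently, so the
orthogonality of `q` splits into three conditions: its values are in `Yᗮᗮ = Y`, its fluxes in `Yᗮ`,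
and its first derivatives satisfy the weighted adjoint relation for `U`. -/
theorem sepCond_orthogonal_re_le (hY : IsClosed (Y : Set (WithLp 2 (Ell2 Em × Ell2 Ep))))
    (hU : IsWeightedContraction c.minus c.plus U) (q : BdSpace Em × BdSpace Ep)
    (hq : ∀ x ∈ sepCond c Y (U.toPMap ⊤), krein c.plus x.2 q.2 = krein c.minus x.1 q.1) :
    (krein c.minus q.1 q.1).re ≤ (krein c.plus q.2 q.2).re := by
  have key : ∀ (y z : WithLp 2 (Ell2 Em × Ell2 Ep)) (x₁ : Ell2 Em), y ∈ Y → z ∈ Yᗮ →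
      weightedInner c.plus (U x₁) (q.2 1) - weightedInner c.minus x₁ (q.1 1)
      - inner ℂ (WithLp.toLp 2 (q.1 0, q.2 0) : WithLp 2 (Ell2 Em × Ell2 Ep)) z
      - inner ℂ (WithLp.toLp 2 (-c.minus.flux q.1, c.plus.flux q.2) :
        WithLp 2 (Ell2 Em × Ell2 Ep)) y = 0 := by
    intro y z x₁ hy hz
    obtain ⟨a, ha0, ha1, ha2⟩ := c.minus.exists_flux_eq y.fst x₁ (-z.fst)
    obtain ⟨b, hb0, hb1, hb2⟩ := c.plus.exists_flux_eq y.snd (U x₁) z.snd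
    have hy' : WithLp.toLp 2 (a 0, b 0) = y := by rw [ha0, hb0]; rfl
    have hz' : WithLp.toLp 2 (-c.minus.flux a, c.plus.flux b) = z := by
      rw [ha2, hb2, neg_neg]; rfl
    have h := krein_sub_krein_eq (c := c) (a, b) q
    rw [hq (a, b) (mem_sepCond_toPMap.2 ⟨hy'.symm ▸ hy, hz'.symm ▸ hz, by rw [hb1, ha1]⟩),
      sub_self] at h
    dsimp only at h
    rw [hy', hz', ha1, hb1] at h
    exact h.symm
  have hw0 : ∀ w : Ell2 Ep, weightedInner c.plus 0 w = 0 := fun w => by simp [weightedInner]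
  have hw0' : ∀ w : Ell2 Em, weightedInner c.minus 0 w = 0 := fun w => by simp [weightedInner]
  -- Closedness of `Y` enters here, through `Yᗮᗮ = Y`.
  have h0 : WithLp.toLp 2 (q.1 0, q.2 0) ∈ Y := by
    have : CompleteSpace Y := hY.completeSpace_coe
    rw [← Y.orthogonal_orthogonal, Submodule.mem_orthogonal']
    intro z hz
    have h := key 0 z 0 Y.zero_mem hz
    rw [map_zero, hw0, hw0', inner_zero_right] at h
    linear_combination -h
  have h1 : WithLp.toLp 2 (-c.minus.flux q.1, c.plus.flux q.2) ∈ Yᗮ := by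
    rw [Submodule.mem_orthogonal']
    intro y hy
    have h := key y 0 0 hy (Submodule.zero_mem _)
    rw [map_zero, hw0, hw0', inner_zero_right] at h
    linear_combination -h
  have h2 : weightedInner c.plus (U (q.1 1)) (q.2 1) = weightedInner c.minus (q.1 1) (q.1 1) := by
    have h := key 0 0 (q.1 1) Y.zero_mem (Submodule.zero_mem _)
    rw [inner_zero_right, inner_zero_right, sub_zero, sub_zero] at h
    exact sub_eq_zero.1 h
  have h3 := weightedInner_le_of_adjoint hU h2
  have h := congrArg Complex.re (krein_sub_krein_of_mem h0 h1)
  rw [Complex.sub_re, Complex.sub_re] at h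
  linarith

end Separated

end AiryStar

/-! ### The proposition for graph conditions and separated conditions -/

theorem proposition3p18 {Em Ep : Type*} [Countable Em] [Countable Ep]
    (c : AiryStar.AiryCoeff (Em ⊕ Ep)) :
    (∀ L : AiryStar.BdSpace Em →ₗ.[ℂ] AiryStar.BdSpace Ep,
      Dense (L.domain : Set (AiryStar.BdSpace Em)) →
      AiryStar.IsKreinContraction c.minus c.plus L →
      AiryStar.IsKreinContraction c.plus c.minus (AiryStar.kreinAdjoint c.minus c.plus L) →
      AiryStar.IsRealOp L →
      (∀ T : AiryStar.C0Semigroup (AiryStar.L2Graph Em Ep),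
        T.IsGeneratedBy (AiryStar.airyOpL c L) → T.IsContractive ∧ AiryStar.IsRealSemigroup T) ∧
      (L.IsClosed → ∃! T : AiryStar.C0Semigroup (AiryStar.L2Graph Em Ep),
        T.IsGeneratedBy (AiryStar.airyOpL c L))) ∧
    (∀ (Y : Submodule ℂ (WithLp 2 (AiryStar.Ell2 Em × AiryStar.Ell2 Ep)))
      (U : AiryStar.Ell2 Em →ₗ[ℂ] AiryStar.Ell2 Ep),
      IsClosed (Y : Set (WithLp 2 (AiryStar.Ell2 Em × AiryStar.Ell2 Ep))) →
      AiryStar.IsWeightedContraction c.minus c.plus U →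
      (∀ p ∈ Y, WithLp.toLp 2 (AiryStar.reEll2 p.fst, AiryStar.reEll2 p.snd) ∈ Y) →
      (∀ x, AiryStar.reEll2 (U x) = U (AiryStar.reEll2 x)) →
      (∀ T : AiryStar.C0Semigroup (AiryStar.L2Graph Em Ep),
        T.IsGeneratedBy (AiryStar.airyOpYU c Y (U.toPMap ⊤)) →
        T.IsContractive ∧ AiryStar.IsRealSemigroup T) ∧
      ∃! T : AiryStar.C0Semigroup (AiryStar.L2Graph Em Ep),
        T.IsGeneratedBy (AiryStar.airyOpYU c Y (U.toPMap ⊤))) := by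
  refine ⟨fun L hdense hL hL' hre => ⟨fun T hT => ?_, fun hcl => ?_⟩,
    fun Y U hY hU hYre hUre => ⟨fun T hT => ?_, ?_⟩⟩
  · exact AiryStar.airyOp_semigroup (fun x hx => hL.re_le hx) (fun x hx => hre.re_mem_graph hx) hT
  -- An operator is closed when its graph is, so `hcl` is the closedness of the boundary condition.
  · exact AiryStar.airyOp_existsUnique hcl (fun x hx => hL.re_le hx)
      fun q hq => AiryStar.re_krein_le_of_kreinAdjoint hdense hL' hq
  · exact AiryStar.airyOp_semigroup (AiryStar.sepCond_re_le hU)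
      (AiryStar.sepCond_re_mem hYre hUre) hT
  · exact AiryStar.airyOp_existsUnique (AiryStar.isClosed_sepCond hY hU.continuous)
      (AiryStar.sepCond_re_le hU) (AiryStar.sepCond_orthogonal_re_le hY hU)
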